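/- **Definitions.** Let $G$ be a finite connected undirected graph (parallel edges are allowed) with a fixed vertex $\top$. Fix a direction of traversal for each cycle of $G$. Given $c(C)\in\mathbb N_0$ for each cycle $C$ of $G$, a *$c$-orientation* of $G$ is an orientation of $G$ in which every cycle $C$ has exactly $c(C)$ edges directed along its direction of traversal. A *vertex flip* in an orientation $D$ of $G$ reverses all edges incident with a vertex $v\neq\top$ that is a source or a sink of $D$. A *vertex flip sequence* from an orientation $X$ to an orientation $Y$ is a finite sequence of vertices $v_1,\dots,v_k$ different from $\top$ such that flipping $v_1,\dots,v_k$ one after the other is possible, starting from $X$ (each $v_i$ is a source or a sink at the moment when it is flipped), and results in $Y$; its length is $k$. **Theorem.** There is a polynomial-time algorithm that, given a finite connected graph $G$ with a fixed vertex $\top$ and two acyclic $c$-orientations $X,Y$ of $G$ (for the same $c$), outputs a vertex flip sequence from $X$ to $Y$ whose length is minimum among all vertex flip sequences from $X$ to $Y$. (In particular, such a sequence always exists.) Here an algorithm is a deterministic Turing machine with finitely many stacks; the input $(G,\top,X,Y)$ is written as the number of vertices, the vertex $\top$, and the list of edges, each with its two endpoints and one bit for its direction in each of $X$ and $Y$,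 with vertices numbered $0,\dots,|V(G)|-1$ and written in binary; the output is the list of the numbers of the flipped vertices, in binary; and the number of steps is bounded by a polynomial in the length of the input. -/

import Mathlib

open Computability

namespace VertexFlip

/-- An undirected graph with vertex set `V` and edge set `E`; parallel edges are allowed.
The two endpoints of an edge `e` are `G.fst e` and `G.snd e`; the order in which they are listed
carries no meaning beyond fixing how an orientation is written down as a family of Booleans. -/
structure Multigraph (V E : Type*) where
  fst : E → V
  snd : E → V

/-- An orientation of a graph with edge set `E`: `true` means that the edge is directed from its
first listed endpoint to its second one, `false` that it is directed the other way. -/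
abbrev Orientation (E : Type*) := E → Bool

namespace Multigraph

variable {V E : Type*} (G : Multigraph V E)

/-- The starting vertex of the edge `d.1` when it is traversed in the direction `d.2`
(`true`: from the first to the second listed endpoint). -/
def start (d : E × Bool) : V := if d.2 then G.fst d.1 else G.snd d.1

/-- The final vertex of the edge `d.1` when it is traversed in the direction `d.2`. -/
def finish (d : E × Bool) : V := if d.2 then G.snd d.1 else G.fst d.1

/-- The tail of the edge `e` in the orientation `X`. -/
def tail (X : Orientation E) (e : E) : V := G.start (e, X e)

/-- The head of the edge `e` in the orientation `X`. -/
def head (X : Orientation E) (e : E) : V := G.finish (e, X e)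

/-- Every two vertices are joined by a walk in the undirected graph. -/
def Connected : Prop :=
  ∀ u v : V, Relation.ReflTransGen (fun a b => ∃ d : E × Bool, G.start d = a ∧ G.finish d = b) u v

/-- A cycle of the undirected graph together with a direction of traversal (and a starting point):
a nonempty closed chain of traversed edges with no repeated vertex and no repeated edge. -/
structure Cycle where
  steps : List (E × Bool)
  ne_nil : steps ≠ []
  chain : steps.IsChain (fun d d' => G.finish d = G.start d')
  closed : G.finish (steps.getLast ne_nil) = G.start (steps.head ne_nil)
  vertices_nodup : (steps.map G.start).Nodup
  edges_nodup : (steps.map Prod.fst).Nodup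

variable {G}

/-- The number of edges of the cycle that `X` directs along the direction of traversal. -/
def Cycle.forward (C : G.Cycle) (X : Orientation E) : ℕ :=
  C.steps.countP (fun d => X d.1 == d.2)

variable (G)

/-- `X` is a `c`-orientation: each cycle `C` has exactly `c C` forward edges in `X`.
Here `c` is given on both traversals of each cycle, which is no restriction: the two forward
counts of the two traversals add up to the length of the cycle. -/
def IsCOrientation (c : G.Cycle → ℕ) (X : Orientation E) : Prop :=
  ∀ C : G.Cycle, C.forward X = c C

/-- `X` has no directed cycle. -/
def Acyclic (X : Orientation E) : Prop :=
  ¬ ∃ C : G.Cycle, ∀ d ∈ C.steps, X d.1 = d.2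

/-- No edge is directed into `v`. -/
def IsSource (X : Orientation E) (v : V) : Prop := ∀ e, G.head X e ≠ v

/-- No edge is directed out of `v`. -/
def IsSink (X : Orientation E) (v : V) : Prop := ∀ e, G.tail X e ≠ v

/-- Reverse the edges incident with `v`. -/
def flip [DecidableEq V] (X : Orientation E) (v : V) : Orientation E :=
  fun e => if G.fst e = v ∨ G.snd e = v then !(X e) else X e

/-- The list of vertices is a vertex flip sequence transforming `X` into `Y`: the listed vertices
are flipped one after the other, and each of them is different from `top` and is a source or a
sink at the moment when it is flipped. -/
def IsFlipSeq [DecidableEq V] (top : V) (Y : Orientation E) : Orientation E → List V → Prop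
  | X, [] => X = Y
  | X, v :: l => v ≠ top ∧ (G.IsSource X v ∨ G.IsSink X v) ∧ IsFlipSeq top Y (G.flip X v) l

/-- A vertex flip sequence transforming `X` into `Y` whose length is smallest possible. -/
def IsShortestFlipSeq [DecidableEq V] (top : V) (X Y : Orientation E) (l : List V) : Prop :=
  G.IsFlipSeq top Y X l ∧ ∀ l' : List V, G.IsFlipSeq top Y X l' → l.length ≤ l'.length

end Multigraph

/-- The data given to the algorithm: a finite graph `G` with vertices `0, …, n - 1` and edges
`0, …, m - 1`, a vertex `top`, and two orientations `X`, `Y` of `G`. -/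
structure Input where
  n : ℕ
  m : ℕ
  G : Multigraph (Fin n) (Fin m)
  top : Fin n
  X : Orientation (Fin m)
  Y : Orientation (Fin m)

/-- The admissible inputs: `G` is connected, and `X` and `Y` are acyclic `c`-orientations of `G`
for one and the same `c`. -/
structure Input.Admissible (I : Input) : Prop where
  connected : I.G.Connected
  acyclic_X : I.G.Acyclic I.X
  acyclic_Y : I.G.Acyclic I.Y
  cOrientations : ∃ c : I.G.Cycle → ℕ, I.G.IsCOrientation c I.X ∧ I.G.IsCOrientation c I.Y

/-- A natural number as a word over the alphabet `{0, 1, #}` (the symbol `#` is `none`):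
its binary digits, followed by the end marker `#`. -/
def encodeNumber (k : ℕ) : List (Option Bool) := (encodeNat k).map some ++ [none]

/-- A list of natural numbers as a word: the concatenation of the words for its entries. -/
def encodeNumbers (l : List ℕ) : List (Option Bool) := l.flatMap encodeNumber

/-- An input as a word: the number of vertices, the vertex `top`, and then, for each edge,
its two endpoints in binary and one bit each for its direction in `X` and in `Y`. -/
def Input.encode (I : Input) : List (Option Bool) :=
  encodeNumber I.n ++ encodeNumber I.top ++
    (List.finRange I.m).flatMap (fun e =>
      encodeNumber (I.G.fst e) ++ encodeNumber (I.G.snd e) ++ [some (I.X e), some (I.Y e)])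

end VertexFlip

/-! Count each flip of a source as `1` and each flip of a sink as `-1`. An edge of `X` ends up
reversed exactly when its tail has a net count one larger than its head, so the net counts `z` on
the way from `X` to `Y` form a potential: along an edge of `X`, `z` drops by one if `Y` differs
there and is constant otherwise. Since `X` and `Y` have equally many forward edges on each cycle,
closed walks have weight zero, and a potential with `z top = 0` exists (`exists_isPotential`);
connectedness makes it unique. A flip changes one value by one, so every flip sequence has length at
least `∑ |z v|` (`IsFlipSeq.sum_abs_le`).

This bound is attained. Rank the vertices along the acyclic orientation `X`. In round `j = 0, 1, …`
flip, by increasing rank, every vertex with `z v > j`. An in-neighbour of such a vertex has at least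
its potential and is flipped earlier in the same round; an out-neighbour has potential at least `z v
- 1`, was flipped in every previous round and comes later in this one. Hence `v` is a source at its
turn (`Reaches.step`). This settles the positive part of `z`. The negative part is the positive part
for the orientations with all edges reversed, where sources and sinks change roles. No flip is ever
undone, so the total length is `∑ |z v|`.

The potential takes all values between any two of its values, so `|z v| < n`, and `n ≤ 2 * m + 1` by
connectedness. The algorithm finds `n + z` and a ranking by relaxation: start with small values and
raise those that violate the condition of an edge. The true potential and some ranking bound the
values from above, so fewer than `B * B` passes can change anything, where `B` is the length of the
input (`run_solve`).

The algorithm is written for a small random access machine whose loops all run `B` times.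
`Prog.computable` turns such programs into Turing machines: numbers are kept in unary on stacks, and
since no instruction raises the largest number by more than one, all stacks keep polynomial length.
-/

namespace StackProgram

open Function

/-! ### Structured stack programs and their translation into Turing machines -/

/-- The stack alphabet. -/
abbrev Sym := Option Bool

/-- The internal state: the symbol that was popped last, if there was one. -/
abbrev Var := Option Sym

/-- Structured programs operating on stacks indexed by `K`. -/
inductive Com (K : Type)
  | skip : Com K
  | push (k : K) (f : Var → Sym) : Com K
  | pop (k : K) : Com K
  | seq (p q : Com K) : Com K
  | ite (f : Var → Bool) (p q : Com K) : Com K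
  | loop (f : Var → Bool) (p : Com K) : Com K

namespace Com

variable {K : Type}

/-- The labels of the machine code of a program. -/
def Label : Com K → Type
  | skip | push _ _ | pop _ => Unit
  | seq p q => p.Label ⊕ q.Label
  | ite _ p q => Option (p.Label ⊕ q.Label)
  | loop _ p => Option p.Label

instance Label.fintype : (p : Com K) → Fintype p.Label
  | skip | push _ _ | pop _ => inferInstanceAs (Fintype Unit)
  | seq p q => by
    have := Label.fintype p
    have := Label.fintype q
    exact inferInstanceAs (Fintype (p.Label ⊕ q.Label))
  | ite _ p q => by
    have := Label.fintype p
    have := Label.fintype q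
    exact inferInstanceAs (Fintype (Option (p.Label ⊕ q.Label)))
  | loop _ p => by
    have := Label.fintype p
    exact inferInstanceAs (Fintype (Option p.Label))

/-- The label at which the execution of a program starts. -/
def entry : (p : Com K) → p.Label
  | skip | push _ _ | pop _ => ()
  | seq p _ => Sum.inl p.entry
  | ite _ _ _ => none
  | loop _ _ => none

/-- The machine code of a program inside a machine with label set `Λ`: the labels of the program
are placed by `emb`, and the execution continues at `exit`. -/
def code {Λ : Type} : (p : Com K) → (p.Label → Λ) → Λ → p.Label →
    Turing.TM2.Stmt (fun _ : K => Sym) Λ Var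
  | skip, _, exit, _ => .goto fun _ => exit
  | push k f, _, exit, _ => .push k f (.goto fun _ => exit)
  | pop k, _, exit, _ => .pop k (fun _ a => a) (.goto fun _ => exit)
  | seq p q, emb, exit, l =>
    match l with
    | Sum.inl l => p.code (fun l => emb (Sum.inl l)) (emb (Sum.inr q.entry)) l
    | Sum.inr l => q.code (fun l => emb (Sum.inr l)) exit l
  | ite f p q, emb, exit, l =>
    match l with
    | none => .branch f (.goto fun _ => emb (some (Sum.inl p.entry)))
        (.goto fun _ => emb (some (Sum.inr q.entry)))
    | some (Sum.inl l) => p.code (fun l => emb (some (Sum.inl l))) exit l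
    | some (Sum.inr l) => q.code (fun l => emb (some (Sum.inr l))) exit l
  | loop f p, emb, exit, l =>
    match l with
    | none => .branch f (.goto fun _ => emb (some p.entry)) (.goto fun _ => exit)
    | some l => p.code (fun l => emb (some l)) (emb none) l

/-- The state of a program: the internal state and the stacks. -/
abbrev Store (K : Type) := Var × (K → List Sym)

variable [DecidableEq K]

/-- `Exec p s t s'`: started in `s`, the program `p` terminates in `s'` after at most `t` steps. -/
inductive Exec : Com K → Store K → ℕ → Store K → Prop
  | skip {s} : Exec skip s 1 s
  | push {k f v S} : Exec (push k f) (v, S) 1 (v, update S k (f v :: S k))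
  | pop {k v S} : Exec (pop k) (v, S) 1 ((S k).head?, update S k (S k).tail)
  | seq {p q s t s' t' s''} : Exec p s t s' → Exec q s' t' s'' → Exec (seq p q) s (t + t') s''
  | ite_true {f p q s t s'} : f s.1 = true → Exec p s t s' → Exec (ite f p q) s (t + 1) s'
  | ite_false {f p q s t s'} : f s.1 = false → Exec q s t s' → Exec (ite f p q) s (t + 1) s'
  | loop_false {f p s} : f s.1 = false → Exec (loop f p) s 1 s
  | loop_true {f p s t s' t' s''} : f s.1 = true → Exec p s t s' → Exec (loop f p) s' t' s'' →
      Exec (loop f p) s (t + t' + 1) s''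
  | mono {p s t s' t'} : Exec p s t s' → t ≤ t' → Exec p s t' s'

/-- `Steps M t c c'`: the machine `M` passes from `c` to `c'` in at most `t` steps. -/
def Steps {Λ : Type} (M : Λ → Turing.TM2.Stmt (fun _ : K => Sym) Λ Var) (t : ℕ)
    (c c' : Turing.TM2.Cfg (fun _ : K => Sym) Λ Var) : Prop :=
  ∃ t' ≤ t, (flip bind (Turing.TM2.step M))^[t'] (some c) = some c'

section

variable {Λ : Type} {M : Λ → Turing.TM2.Stmt (fun _ : K => Sym) Λ Var}
  {c c' c'' : Turing.TM2.Cfg (fun _ : K => Sym) Λ Var} {t t' : ℕ}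

theorem Steps.single (h : Turing.TM2.step M c = some c') : Steps M 1 c c' :=
  ⟨1, le_rfl, h⟩

theorem Steps.trans (h : Steps M t c c') (h' : Steps M t' c' c'') : Steps M (t + t') c c'' := by
  obtain ⟨a, ha, h⟩ := h
  obtain ⟨b, hb, h'⟩ := h'
  exact ⟨b + a, by omega, by rw [iterate_add_apply, h, h']⟩

theorem Steps.mono (h : Steps M t c c') (htt' : t ≤ t') : Steps M t' c c' := by
  obtain ⟨a, ha, h⟩ := h
  exact ⟨a, by omega, h⟩

/-- The machine code of a program behaves as the program does. -/
theorem Exec.steps {p : Com K} {s s' : Store K} (h : Exec p s t s') (emb : p.Label → Λ)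
    (exit : Λ) (hM : ∀ l, M (emb l) = p.code emb exit l) :
    Steps M t ⟨some (emb p.entry), s.1, s.2⟩ ⟨some exit, s'.1, s'.2⟩ := by
  induction h generalizing exit with
  | skip =>
    refine .single ?_
    rw [Turing.TM2.step, hM]; rfl
  | push =>
    refine .single ?_
    rw [Turing.TM2.step, hM]; rfl
  | pop =>
    refine .single ?_
    rw [Turing.TM2.step, hM]; rfl
  | @seq p q s t s' t' s'' _ _ ih₁ ih₂ =>
    exact (ih₁ (fun l => emb (Sum.inl l)) (emb (Sum.inr q.entry)) fun l => hM (Sum.inl l)).trans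
      (ih₂ (fun l => emb (Sum.inr l)) exit fun l => hM (Sum.inr l))
  | @ite_true f p q s t s' hf _ ih =>
    -- The machine executes the branch before the body, whereas the time bound adds its step at the
    -- end.
    rw [add_comm]
    refine (Steps.single ?_).trans
      (ih (fun l => emb (some (Sum.inl l))) exit fun l => hM (some (Sum.inl l)))
    rw [Turing.TM2.step, hM (entry (ite f p q))]
    exact congrArg (fun b => some (cond b _ _)) hf
  | @ite_false f p q s t s' hf _ ih =>
    rw [add_comm]
    refine (Steps.single ?_).trans
      (ih (fun l => emb (some (Sum.inr l))) exit fun l => hM (some (Sum.inr l)))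
    rw [Turing.TM2.step, hM (entry (ite f p q))]
    exact congrArg (fun b => some (cond b _ _)) hf
  | @loop_false f p s hf =>
    refine .single ?_
    rw [Turing.TM2.step, hM (entry (loop f p))]
    exact congrArg (fun b => some (cond b _ _)) hf
  -- The body exits to the label `none` of the test, which is also the entry of the loop, so the
  -- remaining iterations are covered by `ih₂` for the same placement of labels.
  | @loop_true f p s t s' t' s'' hf _ _ ih₁ ih₂ =>
    rw [add_comm]
    refine (Steps.single ?_).trans
      ((ih₁ (fun l => emb (some l)) (emb none) fun l => hM (some l)).trans (ih₂ emb exit hM))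
    rw [Turing.TM2.step, hM (entry (loop f p))]
    exact congrArg (fun b => some (cond b _ _)) hf
  | mono _ hle ih => exact (ih emb exit hM).mono hle

end

/-- The machine that executes a program, reading its input from the stack `inp` and leaving its
output on the stack `out`. -/
def machine [Fintype K] (p : Com K) (inp out : K) : Turing.FinTM2 where
  K := K
  k₀ := inp
  k₁ := out
  Γ _ := Sym
  Λ := Option p.Label
  main := some p.entry
  σ := Var
  initialState := none
  m
    | none => .halt
    | some l => p.code some none l

theorem initList_machine [Fintype K] (p : Com K) (inp out : K) (l : List Sym) :
    Turing.initList (p.machine inp out) l =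
      ⟨some (some p.entry), none, update (fun _ => []) inp l⟩ := by
  refine congrArg (Turing.TM2.Cfg.mk _ _) (funext fun (k : K) => ?_)
  by_cases hk : k = inp
  · subst hk
    exact (dif_pos rfl).trans (update_self k l fun _ => []).symm
  · exact (dif_neg hk).trans (update_of_ne hk l fun _ => []).symm

theorem haltList_machine [Fintype K] (p : Com K) (inp out : K) (l : List Sym) :
    Turing.haltList (p.machine inp out) l = ⟨none, none, update (fun _ => []) out l⟩ := by
  refine congrArg (Turing.TM2.Cfg.mk _ _) (funext fun (k : K) => ?_)
  by_cases hk : k = out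
  · subst hk
    exact (dif_pos rfl).trans (update_self k l fun _ => []).symm
  · exact (dif_neg hk).trans (update_of_ne hk l fun _ => []).symm

/-- A program that, on every input, turns the word for the input into the word for the output in
polynomial time gives a Turing machine that does so. -/
theorem computable_of_exec [Fintype K] {α β : Type} {ea : α → List Sym} {eb : β → List Sym}
    {f : α → β} (p : Com K) (inp out : K) (time : Polynomial ℕ)
    (h : ∀ a, Exec p (none, update (fun _ => []) inp (ea a)) (time.eval (ea a).length)
      (none, update (fun _ => []) out (eb (f a)))) :
    Nonempty (Turing.TM2ComputableInPolyTime ea eb f) := by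
  refine ⟨⟨⟨p.machine inp out, Equiv.refl _, Equiv.refl _⟩, time + 1, fun a => ?_⟩⟩
  have h₁ := (h a).steps (M := (p.machine inp out).m) some none fun l => rfl
  -- The label `none` halts; this is the additional step in `time + 1`.
  have h₂ : Steps (p.machine inp out).m 1
      ⟨some none, none, update (fun _ => []) out (eb (f a))⟩
      ⟨none, none, update (fun _ => []) out (eb (f a))⟩ := .single rfl
  have h₃ := h₁.trans h₂
  choose t ht ht' using h₃
  refine ⟨⟨t, ?_⟩, by simpa using ht⟩
  -- The alphabets are identified by `Equiv.refl`, so the input and output words appear mapped by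
  -- `id`.
  have hid (l : List Sym) : l.map id = l := List.map_id l
  exact (congrArg (fun c => (flip bind (Turing.TM2.step (p.machine inp out).m))^[t] (some c))
    ((congrArg (Turing.initList (p.machine inp out)) (hid _)).trans (p.initList_machine inp out _))).trans (ht'.trans
      (congrArg some ((congrArg (Turing.haltList (p.machine inp out)) (hid _)).trans
        (p.haltList_machine inp out _)).symm))

end Com

end StackProgram

/-! ### Stack subroutines: draining, copying, loops over unary numbers -/

namespace StackProgram

open Function

namespace Com

variable {K : Type} [DecidableEq K]

/-- Push one symbol on each of the listed stacks. -/
def pushAll (f : K → Var → Sym) : List K → Com K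
  | [] => skip
  | k :: ks => seq (push k (f k)) (pushAll f ks)

/-- Pop the stack `k` until it is empty, pushing one symbol on each of the listed stacks for each
popped symbol. -/
def drain (k : K) (f : K → Var → Sym) (ks : List K) : Com K :=
  seq (pop k) (loop Option.isSome (seq (pushAll f ks) (pop k)))

/-- Empty a stack. -/
def clear (k : K) : Com K := drain k (fun _ v => v.getD none) []

/-- Move the contents of the stack `k` to the stack `j`, symbol by symbol. -/
def move (k j : K) : Com K := drain k (fun _ v => v.getD none) [j]

/-- Pop the symbols `some true` at the top of the stack `k` and the symbol below them, running `p`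
for each of the former. -/
def block (k : K) (p : Com K) : Com K :=
  seq (pop k) (loop (fun v => v == some (some true)) (seq p (pop k)))

/-- Add a copy of the unary number on the stack `y` to the stack `x`, using the stack `t`. -/
def dup (y t x : K) : Com K :=
  seq (move y t) (block t (seq (push x fun _ => some true) (push y fun _ => some true)))

/-- Empty each of the listed stacks. -/
def clearAll : List K → Com K
  | [] => skip
  | k :: ks => seq (clear k) (clearAll ks)

/-- Final stacks arise as nested updates in the order of execution; this allows them to be compared
stack by stack with the desired form. -/
theorem Exec.of_eq {p : Com K} {s : Store K} {v : Var} {S S' : K → List Sym} {t t' : ℕ}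
    (h : Exec p s t (v, S)) (ht : t ≤ t') (hS : ∀ j, S' j = S j) : Exec p s t' (v, S') := by
  obtain rfl : S' = S := funext hS
  exact h.mono ht

theorem exec_pushAll (f : K → Var → Sym) (ks : List K) (hks : ks.Nodup) (v : Var)
    (S : K → List Sym) :
    Exec (pushAll f ks) (v, S) (ks.length + 1)
      (v, fun j => if j ∈ ks then f j v :: S j else S j) := by
  induction ks generalizing S with
  | nil => simpa [pushAll] using Exec.skip
  | cons k ks ih =>
    rw [List.nodup_cons] at hks
    have h := Exec.seq (Exec.push (k := k) (f := f k) (v := v) (S := S)) (ih hks.2 _)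
    refine h.of_eq (by simp; omega) fun j => ?_
    by_cases hj : j = k
    · subst hj; simp [hks.1]
    · simp [hj]

/-- Each symbol costs `ks.length + 1` steps for the pushes, one for the next pop and one for the
test. Pushing in the order of popping reverses the word. -/
theorem exec_drain (k : K) (f : K → Var → Sym) (ks : List K) (hks : ks.Nodup) (hk : k ∉ ks)
    (v : Var) (S : K → List Sym) :
    Exec (drain k f ks) (v, S) ((ks.length + 3) * (S k).length + 2)
      (none, fun j => if j = k then [] else
        if j ∈ ks then ((S k).map fun a => f j (some a)).reverse ++ S j else S j) := by
  have key : ∀ (l : List Sym) (v : Var) (S : K → List Sym), S k = l →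
      Exec (seq (pop k) (loop Option.isSome (seq (pushAll f ks) (pop k)))) (v, S)
        ((ks.length + 3) * l.length + 2) (none, fun j => if j = k then [] else
          if j ∈ ks then (l.map fun a => f j (some a)).reverse ++ S j else S j) := by
    intro l
    -- The loop is always entered with the top symbol already popped into the internal state, so the
    -- induction is over the pair of head and tail.
    suffices H : ∀ (S : K → List Sym), S k = l.tail →
        Exec (loop Option.isSome (seq (pushAll f ks) (pop k))) (l.head?, S)
          ((ks.length + 3) * l.length + 1) (none, fun j => if j = k then [] else
            if j ∈ ks then (l.map fun a => f j (some a)).reverse ++ S j else S j) by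
      intro v S hS
      have h := Exec.seq (Exec.pop (k := k) (v := v) (S := S))
        (by rw [hS]; exact H (update S k l.tail) (by simp))
      refine h.of_eq (by omega) fun j => ?_
      by_cases hj : j = k <;> simp [hj]
    induction l with
    | nil =>
      intro S hS
      have : (fun j => if j = k then [] else if j ∈ ks then
          (([] : List Sym).map fun a => f j (some a)).reverse ++ S j else S j) = S := by
        funext j
        by_cases hj : j = k
        · subst hj; simpa using hS.symm
        · simp [hj]
      rw [this]
      exact Exec.mono (Exec.loop_false rfl) (by simp)
    | cons a l ih =>
      intro S hS
      rw [List.tail_cons] at hS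
      have h₁ := exec_pushAll f ks hks (some a) S
      have h₂ := Exec.seq h₁ (Exec.pop (k := k))
      simp only [hk, if_false, hS] at h₂
      have h₃ := Exec.loop_true (f := Option.isSome) rfl h₂
        (ih (update (fun j => if j ∈ ks then f j (some a) :: S j else S j) k l.tail) (by simp))
      refine h₃.of_eq (by rw [List.length_cons]; nlinarith) fun j => ?_
      by_cases hj : j = k
      · simp [hj]
      · by_cases hj' : j ∈ ks <;> simp [hj, hj']
  exact key _ v S rfl

theorem exec_clear (k : K) (v : Var) (S : K → List Sym) :
    Exec (clear k) (v, S) (3 * (S k).length + 2) (none, update S k []) := by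
  refine (exec_drain k (fun _ v => v.getD none) [] (by simp) (by simp) v S).of_eq (by simp)
    fun j => ?_
  by_cases hj : j = k <;> simp [hj]

theorem exec_move (k j : K) (hkj : k ≠ j) (v : Var) (S : K → List Sym) :
    Exec (move k j) (v, S) (4 * (S k).length + 2)
      (none, update (update S j ((S k).reverse ++ S j)) k []) := by
  refine (exec_drain k (fun _ v => v.getD none) [j] (by simp) (by simpa using hkj) v S).of_eq
    (by simp) fun i => ?_
  by_cases hi : i = k
  · simp [hi]
  · by_cases hi' : i = j
    · subst hi'; simp [hi]
    · simp [hi, hi']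

theorem exec_clearAll (ks : List K) (v : Var) (S : K → List Sym) (N : ℕ)
    (hN : ∀ k, (S k).length ≤ N) :
    ∃ v', Exec (clearAll ks) (v, S) (ks.length * (3 * N + 2) + 1)
      (v', fun k => if k ∈ ks then [] else S k) := by
  induction ks generalizing v S with
  | nil => exact ⟨v, by simpa [clearAll] using Exec.skip⟩
  | cons k ks ih =>
    obtain ⟨v', h⟩ := ih none (update S k []) fun j => by
      by_cases hj : j = k
      · simp [hj]
      · simpa [hj] using hN j
    have h' := Exec.seq (exec_clear k v S) h
    refine ⟨v', ?_⟩
    have : (fun j => if j ∈ k :: ks then [] else S j) =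
        fun j => if j ∈ ks then [] else update S k [] j := by
      funext j
      by_cases hj : j = k <;> simp [hj]
    rw [this]
    refine h'.mono ?_
    have := hN k
    rw [List.length_cons]
    nlinarith

/-- A loop over a unary number with the states `I n, …, I 0`. -/
theorem exec_block {k : K} {p : Com K} {rest : List Sym} (hrest : rest.head? ≠ some (some true))
    {n c : ℕ} (I : ℕ → K → List Sym) (hk : ∀ i ≤ n, I i k = List.replicate i (some true) ++ rest)
    (step : ∀ i < n, ∃ v, Exec p
      (some (some true), update (I (i + 1)) k (List.replicate i (some true) ++ rest)) c (v, I i))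
    (v : Var) :
    Exec (block k p) (v, I n) ((c + 2) * n + 2) (rest.head?, update (I 0) k rest.tail) := by
  -- Here too, the loop starts after a first pop. The symbol that stops it is popped as well, whence
  -- `rest.tail` at the end.
  suffices H : Exec (loop (fun v => v == some (some true)) (seq p (pop k)))
      ((I n k).head?, update (I n) k (I n k).tail) ((c + 2) * n + 1)
      (rest.head?, update (I 0) k rest.tail) from (Exec.seq Exec.pop H).mono (by omega)
  induction n with
  | zero =>
    rw [hk 0 le_rfl]
    exact (Exec.loop_false (by simpa using hrest)).mono (by simp)
  | succ n ih =>
    obtain ⟨v', hs⟩ := step n (by omega)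
    have h := Exec.loop_true (f := fun v => v == some (some true)) rfl
      (Exec.seq hs (Exec.pop (k := k)))
      (ih (fun i hi => hk i (by omega)) (fun i hi => step i (by omega)))
    rw [hk (n + 1) le_rfl]
    refine h.mono ?_
    have : (c + 2) * (n + 1) + 1 = (c + 2) * n + 1 + (c + 2) := by ring
    omega

/-- A loop over a unary number that takes up the whole of its stack. -/
theorem exec_block_replicate {k : K} {p : Com K} {n c : ℕ} (I : ℕ → K → List Sym)
    (hk : ∀ i ≤ n, I i k = List.replicate i (some true))
    (step : ∀ i < n, ∃ v, Exec p
      (some (some true), update (I (i + 1)) k (List.replicate i (some true))) c (v, I i))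
    (v : Var) : Exec (block k p) (v, I n) ((c + 2) * n + 2) (none, I 0) := by
  have h := exec_block (k := k) (p := p) (rest := []) (by simp) I (by simpa using hk)
    (by simpa using step) v
  have h₀ : update (I 0) k [] = I 0 := by
    conv_rhs => rw [← update_eq_self k (I 0), hk 0 (by omega)]
    rfl
  rwa [List.tail_nil, h₀] at h

/-- A stack can only be read destructively: the number is moved to `t` and then rebuilt on `y` and
`x` simultaneously. In `I i`, there are `i` symbols left on `t` and `n - i` restored. -/
theorem exec_dup {y t x : K} (hyt : y ≠ t) (hyx : y ≠ x) (htx : t ≠ x) {n : ℕ}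
    (S : K → List Sym) (hy : S y = List.replicate n (some true)) (ht : S t = []) (v : Var) :
    Exec (dup y t x) (v, S) (8 * n + 4)
      (none, update S x (List.replicate n (some true) ++ S x)) := by
  have h₁ := exec_move y t hyt v S
  let I : ℕ → K → List Sym := fun i =>
    update (update (update S t (List.replicate i (some true))) y
      (List.replicate (n - i) (some true))) x (List.replicate (n - i) (some true) ++ S x)
  have e₁ : update (update S t ((S y).reverse ++ S t)) y [] = I n := by
    funext j
    by_cases hx : j = x
    · subst hx; simp [I, hyx.symm, htx.symm]
    · simp [I, hx, hy, ht]
  have e₂ : I 0 = update S x (List.replicate n (some true) ++ S x) := by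
    funext j
    by_cases hx : j = x
    · subst hx; simp [I]
    · by_cases h : j = y
      · subst h; simp [I, hx, hy]
      · by_cases h' : j = t
        · subst h'; simp [I, hx, h, ht]
        · simp [I, hx, h, h']
  rw [e₁, hy, List.length_replicate] at h₁
  have h₂ := exec_block_replicate (k := t)
    (p := seq (push x fun _ => some true) (push y fun _ => some true)) (n := n) (c := 2) I
    (fun i _ => by simp [I, htx, hyt.symm])
    (fun i hi => ⟨some (some true), by
      have h := Exec.seq (Exec.push (k := x) (f := fun _ => some true) (v := some (some true))
        (S := update (I (i + 1)) t (List.replicate i (some true))))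
        (Exec.push (k := y) (f := fun _ => some true))
      have hi' : n - i = n - (i + 1) + 1 := by omega
      refine h.of_eq le_rfl fun j => ?_
      by_cases hx : j = x
      · subst hx
        simp [I, hyx.symm, htx.symm, hi', List.replicate_succ]
      · by_cases hy : j = y
        · subst hy; simp [I, hx, hyt, hi', List.replicate_succ]
        · by_cases ht : j = t
          · subst ht; simp [I, hx, hy]
          · simp [I, hx, hy, ht]⟩) none
  rw [e₂] at h₂
  exact (Exec.seq h₁ h₂).mono (by omega)

end Com

end StackProgram

/-! ### Random access programs, growth of their memory, and arrays on stacks -/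

namespace StackProgram

open Function

/-- Programs of a random access machine with registers `ρ`, arrays `α`, an input word that is read
symbol by symbol, and an output word. -/
inductive Prog (ρ α : Type)
  | skip : Prog ρ α
  | clr (x : ρ) : Prog ρ α
  | inc (x : ρ) : Prog ρ α
  | dec (x : ρ) : Prog ρ α
  | cpy (x y : ρ) : Prog ρ α
  | sub (x y : ρ) : Prog ρ α
  | load (x : ρ) (a : α) (i : ρ) : Prog ρ α
  | store (a : α) (i x : ρ) : Prog ρ α
  | ifz (x : ρ) (p q : Prog ρ α) : Prog ρ α
  | read (pend psep pzero pone : Prog ρ α) : Prog ρ α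
  | emit (c : Sym) : Prog ρ α
  | seq (p q : Prog ρ α) : Prog ρ α
  | rep (p : Prog ρ α) : Prog ρ α

/-- The memory of the random access machine. -/
structure Mem (ρ α : Type) where
  reg : ρ → ℕ
  arr : α → ℕ → ℕ
  inp : List Sym
  out : List Sym

/-- The stacks that implement a random access machine. -/
inductive Stack (ρ α : Type) (D : ℕ)
  | reg (x : ρ)
  | arr (a : α)
  | todo (d : Fin D)
  | done (d : Fin D)
  | inp
  | out
  | result
  | tmp
  | idx
  | aux
  deriving DecidableEq, Fintype

variable {ρ α : Type}

namespace Prog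

/-- The effect of a program. The number `B` is the number of cells of each array and also the
number of times that the body of a loop is executed. -/
def run [DecidableEq ρ] [DecidableEq α] (B : ℕ) : Prog ρ α → Mem ρ α → Mem ρ α
  | skip, s => s
  | clr x, s => { s with reg := update s.reg x 0 }
  | inc x, s => { s with reg := update s.reg x (s.reg x + 1) }
  | dec x, s => { s with reg := update s.reg x (s.reg x - 1) }
  | cpy x y, s => { s with reg := update s.reg x (s.reg y) }
  | sub x y, s => { s with reg := update s.reg x (s.reg x - s.reg y) }
  | load x a i, s =>
    { s with reg := update s.reg x (if s.reg i < B then s.arr a (s.reg i) else 0) }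
  | store a i x, s => { s with arr := update s.arr a (update (s.arr a) (s.reg i) (s.reg x)) }
  | ifz x p q, s => if s.reg x = 0 then p.run B s else q.run B s
  | read pe ps p0 p1, s =>
    match s.inp with
    | [] => pe.run B s
    | none :: l => ps.run B { s with inp := l }
    | some false :: l => p0.run B { s with inp := l }
    | some true :: l => p1.run B { s with inp := l }
  | emit c, s => { s with out := s.out ++ [c] }
  | seq p q, s => q.run B (p.run B s)
  | rep p, s => (p.run B)^[B] s

/-- The nesting depth of the loops. -/
def depth : Prog ρ α → ℕ
  | ifz _ p q => max p.depth q.depth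
  | read pe ps p0 p1 => max (max pe.depth ps.depth) (max p0.depth p1.depth)
  | seq p q => max p.depth q.depth
  | rep p => p.depth + 1
  | _ => 0

/-- An upper bound on the number of executed instructions. -/
noncomputable def cost : Prog ρ α → Polynomial ℕ
  | ifz _ p q => p.cost + q.cost + 1
  | read pe ps p0 p1 => pe.cost + ps.cost + p0.cost + p1.cost + 1
  | seq p q => p.cost + q.cost
  | rep p => Polynomial.X * (p.cost + 1) + 1
  | _ => 1

end Prog

namespace Mem

/-- All numbers in the memory and the lengths of the input and the output are at most `N`. -/
structure Bounded (s : Mem ρ α) (N : ℕ) : Prop where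
  reg : ∀ x, s.reg x ≤ N
  arr : ∀ a i, s.arr a i ≤ N
  inp : s.inp.length ≤ N
  out : s.out.length ≤ N

theorem Bounded.mono {s : Mem ρ α} {M N : ℕ} (h : s.Bounded M) (hMN : M ≤ N) : s.Bounded N :=
  ⟨fun x => (h.reg x).trans hMN, fun a i => (h.arr a i).trans hMN, h.inp.trans hMN,
    h.out.trans hMN⟩

theorem Bounded.update_reg [DecidableEq ρ] {s : Mem ρ α} {N : ℕ} (h : s.Bounded N) (x : ρ) {k : ℕ} (hk : k ≤ N) :
    Bounded { s with reg := update s.reg x k } N := by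
  refine ⟨fun y => ?_, h.arr, h.inp, h.out⟩
  by_cases hy : y = x
  · subst hy; simpa using hk
  · simpa [hy] using h.reg y

theorem Bounded.of_inp {s : Mem ρ α} {N : ℕ} (h : s.Bounded N) {c : Sym} {l : List Sym}
    (hl : s.inp = c :: l) : Bounded { s with inp := l } N :=
  ⟨h.reg, h.arr, by have := h.inp; simp [hl] at this; simp; omega, h.out⟩

end Mem

variable [DecidableEq ρ] [DecidableEq α]

-- Only `inc` and `emit` can exceed an existing bound, and by one; all other instructions copy,
-- decrease or overwrite. So the memory grows at most by the number of executed instructions, which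
-- keeps unary notation polynomial.
open Prog in
theorem Mem.Bounded.run {B : ℕ} (p : Prog ρ α) {s : Mem ρ α} {N : ℕ} (h : s.Bounded N) :
    (p.run B s).Bounded (N + p.cost.eval B) := by
  induction p generalizing s N with
  | skip => exact h.mono (by simp)
  | clr x => exact (h.update_reg x (Nat.zero_le _)).mono (by simp)
  | inc x =>
    refine (h.mono (Nat.le_succ _)).update_reg x ?_ |>.mono (by simp [cost])
    have := h.reg x; omega
  | dec x => exact (h.update_reg x (by have := h.reg x; omega)).mono (by simp)
  | cpy x y => exact (h.update_reg x (h.reg y)).mono (by simp)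
  | sub x y => exact (h.update_reg x (by have := h.reg x; omega)).mono (by simp)
  | load x a i =>
    refine (h.update_reg x ?_).mono (by simp)
    split_ifs
    · exact h.arr _ _
    · exact Nat.zero_le _
  | store a i x =>
    refine Bounded.mono ⟨h.reg, fun b j => ?_, h.inp, h.out⟩ (Nat.le_add_right N _)
    by_cases hb : b = a
    · subst hb
      by_cases hj : j = s.reg i
      · subst hj; simpa [Prog.run] using h.reg x
      · simpa [Prog.run, hj] using h.arr b j
    · simpa [Prog.run, hb] using h.arr b j
  | ifz x p q ihp ihq =>
    rw [Prog.run]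
    simp only [cost, Polynomial.eval_add, Polynomial.eval_one]
    split_ifs
    · exact (ihp h).mono (by omega)
    · exact (ihq h).mono (by omega)
  | read pe ps p0 p1 ihe ihs ih0 ih1 =>
    rw [Prog.run]
    simp only [cost, Polynomial.eval_add, Polynomial.eval_one]
    split
    · exact (ihe h).mono (by omega)
    · exact (ihs (h.of_inp ‹_›)).mono (by omega)
    · exact (ih0 (h.of_inp ‹_›)).mono (by omega)
    · exact (ih1 (h.of_inp ‹_›)).mono (by omega)
  | emit c =>
    refine ⟨fun x => (h.reg x).trans (by simp), fun a i => (h.arr a i).trans (by simp),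
      h.inp.trans (by simp), ?_⟩
    simpa [Prog.run, cost] using h.out
  | seq p q ihp ihq =>
    refine (ihq (ihp h)).mono ?_
    simp [cost]; omega
  | rep p ih =>
    have key : ∀ k, ((p.run B)^[k] s).Bounded (N + k * p.cost.eval B) := by
      intro k
      induction k with
      | zero => simpa using h
      | succ k ihk =>
        rw [iterate_succ_apply']
        exact (ih ihk).mono (by rw [Nat.succ_mul]; omega)
    refine (key B).mono ?_
    simp [cost]; nlinarith

/-- An array as a word. -/
def encodeArray (l : List ℕ) : List Sym :=
  l.flatMap fun n => List.replicate n (some true) ++ [none]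

theorem encodeArray_cons (n : ℕ) (l : List ℕ) :
    encodeArray (n :: l) = List.replicate n (some true) ++ none :: encodeArray l := by
  simp [encodeArray]

theorem encodeArray_append (l l' : List ℕ) :
    encodeArray (l ++ l') = encodeArray l ++ encodeArray l' := by
  simp [encodeArray]

theorem length_encodeArray_le {l : List ℕ} {N : ℕ} (h : ∀ n ∈ l, n ≤ N) :
    (encodeArray l).length ≤ l.length * (N + 1) := by
  induction l with
  | nil => simp [encodeArray]
  | cons n l ih =>
    have h₁ := ih fun k hk => h k (by simp [hk])
    have h₂ := h n (by simp)
    rw [encodeArray_cons]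
    simp only [List.length_append, List.length_replicate, List.length_cons]
    nlinarith

namespace Com

open Stack

variable {D : ℕ}

/-- Move the top entry of an array to the stack `aux`. -/
def skipCell (a : α) : Com (Stack ρ α D) :=
  seq (block (arr a) (push aux fun _ => some true))
    (ite (fun v => v == some none) (push aux fun _ => none) skip)

/-- Move as many entries of an array to the stack `aux` as the register `i` says. -/
def seek (a : α) (i : ρ) : Com (Stack ρ α D) :=
  seq (dup (reg i) tmp idx) (block idx (skipCell a))

/-- Implementation of `Prog.load`. -/
def load (x : ρ) (a : α) (i : ρ) : Com (Stack ρ α D) :=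
  seq (seek a i) <| seq (clear (reg x)) <|
    seq (block (arr a) (seq (push aux fun _ => some true) (push (reg x) fun _ => some true))) <|
    seq (ite (fun v => v == some none) (push aux fun _ => none) skip) (move aux (arr a))

/-- Implementation of `Prog.store`. -/
def store (a : α) (i x : ρ) : Com (Stack ρ α D) :=
  seq (seek a i) <| seq (block (arr a) skip) <|
    seq (ite (fun v => v == some none)
      (seq (dup (reg x) tmp aux) (push aux fun _ => none)) skip) (move aux (arr a))

/-- The stacks while the array `a` is being searched: `j` entries have been moved to `aux`. -/
def seekStore (S : Stack ρ α D → List Sym) (a : α) (l : List ℕ) (j : ℕ) :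
    Stack ρ α D → List Sym :=
  update (update S (arr a) (encodeArray (l.drop j))) aux (encodeArray (l.take j)).reverse

/-- The separator ends the unary block and is pushed on `aux` after it, so `aux` holds the reversed
prefix. Beyond the last entry nothing is popped and no separator is pushed, in agreement with `take`
and `drop`. -/
theorem exec_skipCell (S : Stack ρ α D → List Sym) (a : α) (l : List ℕ) (j N : ℕ)
    (hN : ∀ n ∈ l, n ≤ N) (v : Var) :
    ∃ v', Exec (skipCell a) (v, seekStore S a l j) (3 * N + 4) (v', seekStore S a l (j + 1)) := by
  rcases hj : l.drop j with _ | ⟨n, r⟩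
  · have h := exec_block (k := arr a) (p := push (K := Stack ρ α D) aux fun _ => some true)
      (rest := []) (by simp) (n := 0) (c := 1) (fun _ => seekStore S a l j)
      (fun i _ => by simp [seekStore, hj, encodeArray]; omega) (by simp) v
    refine ⟨_, ((Exec.seq h (Exec.ite_false rfl Exec.skip)).of_eq (by omega) fun k => ?_)⟩
    have hl : l.length ≤ j := by simpa using hj
    by_cases hk : k = arr a
    · subst hk; simp [seekStore, List.drop_eq_nil_of_le (show l.length ≤ j + 1 by omega),
        encodeArray]
    · by_cases hk' : k = aux
      · subst hk'
        simp [seekStore, List.take_of_length_le hl,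
          List.take_of_length_le (show l.length ≤ j + 1 by omega)]
      · simp [seekStore, hk, hk']
  · have hjl : j < l.length := by
      by_contra hcon
      rw [List.drop_eq_nil_of_le (by omega)] at hj
      simp at hj
    have hn : l[j] = n ∧ l.drop (j + 1) = r := by
      rw [List.drop_eq_getElem_cons hjl] at hj
      exact List.cons.inj hj
    have hnN : n ≤ N := hn.1 ▸ hN _ (List.getElem_mem hjl)
    let I : ℕ → Stack ρ α D → List Sym := fun i =>
      update (update S (arr a) (List.replicate i (some true) ++ none :: encodeArray r)) aux
        (List.replicate (n - i) (some true) ++ (encodeArray (l.take j)).reverse)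
    have hI : I n = seekStore S a l j := by
      simp [I, seekStore, hj, encodeArray_cons]
    have h := exec_block (k := arr a) (p := push (K := Stack ρ α D) aux fun _ => some true)
      (rest := none :: encodeArray r) (by simp) (n := n) (c := 1) I
      (fun i _ => by simp [I])
      (fun i hi => ⟨some (some true), Exec.push.of_eq le_rfl fun k => by
        have hi' : n - i = n - (i + 1) + 1 := by omega
        by_cases hk' : k = aux
        · subst hk'; simp [I, hi', List.replicate_succ]
        · by_cases hk : k = arr a
          · subst hk; simp [I]
          · simp [I, hk, hk']⟩) v
    rw [hI] at h
    refine ⟨_, ((Exec.seq h (Exec.ite_true rfl Exec.push)).of_eq (by omega) fun k => ?_)⟩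
    by_cases hk : k = arr a
    · subst hk; simp [seekStore, I, hn.2]
    · by_cases hk' : k = aux
      · subst hk'
        simp [seekStore, I, List.take_add_one, hjl, hn.1, encodeArray]
      · simp [seekStore, I, hk, hk']

/-- A copy of the index on `idx` is used up, one symbol per entry, so the register survives. At most
`N` entries, each taking time linear in `N`, give the quadratic bound. -/
theorem exec_seek (S : Stack ρ α D → List Sym) (a : α) (i : ρ) (l : List ℕ) (k N : ℕ)
    (hN : ∀ n ∈ l, n ≤ N) (hk : k ≤ N) (ha : S (arr a) = encodeArray l)
    (hi : S (reg i) = List.replicate k (some true))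
    (htmp : S tmp = []) (hidx : S idx = []) (haux : S aux = []) (v : Var) :
    ∃ v', Exec (seek a i) (v, S) (20 * (N + 1) ^ 2) (v', seekStore S a l k) := by
  have h₁ := exec_dup (y := reg i) (t := tmp) (x := idx) (by simp) (by simp) (by simp) S hi htmp v
  let I : ℕ → Stack ρ α D → List Sym := fun m =>
    update (seekStore S a l (k - m)) idx (List.replicate m (some true))
  have e₁ : update S idx (List.replicate k (some true) ++ S idx) = I k := by
    funext j
    by_cases hj : j = idx
    · subst hj; simp [I, hidx]
    · by_cases hj' : j = aux
      · subst hj'; simp [I, seekStore, haux, encodeArray]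
      · by_cases hj'' : j = arr a
        · subst hj''; simp [I, seekStore, ha]
        · simp [I, seekStore, hj, hj', hj'']
  have e₂ : I 0 = seekStore S a l k := by
    funext j
    by_cases hj : j = idx
    · subst hj; simp [I, seekStore, hidx]
    · simp [I, hj]
  have e₃ (m j : ℕ) (w : List Sym) : update (seekStore S a l j) idx w =
      seekStore (update S idx w) a l j := by
    funext x
    by_cases hj : x = idx
    · subst hj; simp [seekStore]
    · by_cases hj' : x = aux
      · subst hj'; simp [seekStore]
      · by_cases hj'' : x = arr a
        · subst hj''; simp [seekStore]
        · simp [seekStore, hj, hj', hj'']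
  rw [e₁] at h₁
  have h₂ := exec_block_replicate (k := idx) (p := skipCell (ρ := ρ) (D := D) a) (n := k)
    (c := 3 * N + 4) I (fun m _ => by simp [I])
    (fun m hm => by
      simp only [I, update_idem]
      rw [e₃ m, e₃ m, show k - m = k - (m + 1) + 1 by omega]
      exact exec_skipCell _ a l _ N hN _) none
  rw [e₂] at h₂
  exact ⟨_, (Exec.seq h₁ h₂).mono (by nlinarith)⟩

/-- Since `aux` holds the reversed prefix, moving it back restores the order of the array. -/
theorem exec_unseek (S : Stack ρ α D → List Sym) (a : α) (w w' : List Sym) (v : Var) :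
    Exec (move aux (arr a)) (v, update (update S (arr a) w) aux w'.reverse) (4 * w'.length + 2)
      (none, update (update S (arr a) (w' ++ w)) aux []) := by
  refine (exec_move aux (arr a) (by simp) _ _).of_eq (by simp) fun j => ?_
  by_cases hj : j = aux
  · subst hj; simp
  · by_cases hj' : j = arr a
    · subst hj'; simp
    · simp [hj, hj']

/-- The entry is pushed on `reg x` and on `aux` at once, so that the array can be restored. The
target is cleared only after the search, so `x` and `i` may coincide. For an index out of range the
target stays cleared, which is the default `0`. -/
theorem exec_load (S : Stack ρ α D → List Sym) (x : ρ) (a : α) (i : ρ) (l : List ℕ) (k N : ℕ)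
    (hN : ∀ n ∈ l, n ≤ N) (hk : k ≤ N) (hl : l.length ≤ N) (ha : S (arr a) = encodeArray l)
    (hi : S (reg i) = List.replicate k (some true)) (hx : (S (reg x)).length ≤ N)
    (htmp : S tmp = []) (hidx : S idx = []) (haux : S aux = []) (v : Var) :
    ∃ v', Exec (load x a i) (v, S) (50 * (N + 1) ^ 2)
      (v', update S (reg x) (List.replicate (l.getD k 0) (some true))) := by
  obtain ⟨v₁, h₁⟩ := exec_seek S a i l k N hN hk ha hi htmp hidx haux v
  have h₂ := exec_clear (reg x) v₁ (seekStore S a l k)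
  have hlen (l' : List ℕ) (h : ∀ n ∈ l', n ∈ l) (h' : l'.length ≤ l.length) :
      (encodeArray l').length ≤ N * (N + 1) :=
    (length_encodeArray_le fun n hn => hN n (h n hn)).trans
      (Nat.mul_le_mul_right _ (h'.trans hl))
  have hx' : (seekStore S a l k (reg x)).length ≤ N := by simpa [seekStore] using hx
  rcases hj : l.drop k with _ | ⟨n, r⟩
  · have hkl : l.length ≤ k := by simpa using hj
    have h₃ := exec_block (k := arr a) (p := seq (push (K := Stack ρ α D) aux fun _ => some true)
      (push (reg x) fun _ => some true))
      (rest := []) (by simp) (n := 0) (c := 2) (fun _ => update (seekStore S a l k) (reg x) [])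
      (fun i _ => by simp [seekStore, hj, encodeArray]; omega) (by simp) none
    have e : update (update (seekStore S a l k) (reg x) []) (arr a) [] =
        update (update (update S (reg x) []) (arr a) []) aux (encodeArray l).reverse := by
      funext j
      by_cases hj₁ : j = aux
      · subst hj₁; simp [seekStore, List.take_of_length_le hkl]
      · by_cases hj₂ : j = arr a
        · subst hj₂; simp
        · by_cases hj₃ : j = reg x
          · subst hj₃; simp
          · simp [hj₁, hj₂, hj₃, seekStore]
    rw [List.tail_nil, e] at h₃
    have h₄ := exec_unseek (update S (reg x) []) a [] (encodeArray l) none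
    refine ⟨_, ((Exec.seq h₁ (Exec.seq h₂ (Exec.seq h₃ (Exec.seq
      (Exec.ite_false rfl Exec.skip) h₄)))).of_eq ?_ fun j => ?_)⟩
    · have := hlen l (by simp) le_rfl
      nlinarith
    · have hgd : l.getD k 0 = 0 := by simp [hkl]
      by_cases hj₁ : j = aux
      · subst hj₁; simp [haux]
      · by_cases hj₂ : j = arr a
        · subst hj₂; simp [ha]
        · by_cases hj₃ : j = reg x
          · subst hj₃; simp [hkl]
          · simp [hj₁, hj₂, hj₃]
  · have hjl : k < l.length := by
      by_contra hcon
      rw [List.drop_eq_nil_of_le (by omega)] at hj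
      simp at hj
    have hn : l[k] = n ∧ l.drop (k + 1) = r := by
      rw [List.drop_eq_getElem_cons hjl] at hj
      exact List.cons.inj hj
    have hnN : n ≤ N := hn.1 ▸ hN _ (List.getElem_mem hjl)
    let I : ℕ → Stack ρ α D → List Sym := fun m =>
      update (update (update S (reg x) (List.replicate (n - m) (some true)))
        (arr a) (List.replicate m (some true) ++ none :: encodeArray r)) aux
        (List.replicate (n - m) (some true) ++ (encodeArray (l.take k)).reverse)
    have hI : update (seekStore S a l k) (reg x) [] = I n := by
      funext j
      by_cases hj₁ : j = aux
      · subst hj₁; simp [I, seekStore]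
      · by_cases hj₂ : j = arr a
        · subst hj₂; simp [I, seekStore, hj, encodeArray_cons]
        · by_cases hj₃ : j = reg x
          · subst hj₃; simp [I]
          · simp [I, hj₁, hj₂, hj₃, seekStore]
    rw [hI] at h₂
    have h₃ := exec_block (k := arr a) (p := seq (push (K := Stack ρ α D) aux fun _ => some true)
      (push (reg x) fun _ => some true))
      (rest := none :: encodeArray r) (by simp) (n := n) (c := 2) I
      (fun i _ => by simp [I])
      (fun m hm => ⟨some (some true), (Exec.seq Exec.push Exec.push).of_eq le_rfl fun j => by
        have hm' : n - m = n - (m + 1) + 1 := by omega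
        by_cases hj₁ : j = aux
        · subst hj₁; simp [I, hm', List.replicate_succ]
        · by_cases hj₂ : j = arr a
          · subst hj₂; simp [I]
          · by_cases hj₃ : j = reg x
            · subst hj₃; simp [I, hm', List.replicate_succ]
            · simp [I, hj₁, hj₂, hj₃]⟩) none
    have h₄ := Exec.push (k := (aux : Stack ρ α D)) (f := fun _ => none) (v := some none)
      (S := update (I 0) (arr a) (encodeArray r))
    have e : update (update (I 0) (arr a) (encodeArray r)) aux
        (none :: update (I 0) (arr a) (encodeArray r) aux) =
        update (update (update S (reg x) (List.replicate n (some true))) (arr a) (encodeArray r))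
          aux (encodeArray (l.take (k + 1))).reverse := by
      funext j
      by_cases hj₁ : j = aux
      · subst hj₁
        simp [I, List.take_add_one, hjl, hn.1, encodeArray]
      · by_cases hj₂ : j = arr a
        · subst hj₂; simp
        · simp [I, hj₁, hj₂]
    rw [e] at h₄
    have h₅ := exec_unseek (update S (reg x) (List.replicate n (some true))) a (encodeArray r)
      (encodeArray (l.take (k + 1))) (some none)
    refine ⟨_, ((Exec.seq h₁ (Exec.seq h₂ (Exec.seq h₃ (Exec.seq
      (Exec.ite_true rfl h₄) h₅)))).of_eq ?_ fun j => ?_)⟩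
    · have := hlen (l.take (k + 1)) (fun n hn => List.mem_of_mem_take hn) (by simp)
      nlinarith
    · by_cases hj₁ : j = aux
      · subst hj₁; simp [haux]
      · by_cases hj₂ : j = arr a
        · subst hj₂
          rw [← hn.2]
          simp [ha, ← encodeArray_append]
        · by_cases hj₃ : j = reg x
          · subst hj₃; simp [hjl, hn.1]
          · simp [hj₁, hj₂, hj₃]

/-- The old entry is discarded and the new one written on `aux` in its place. If the search ran past
the end, there is no separator to pop, nothing is written, and the array returns unchanged, as
`List.set` prescribes. -/
theorem exec_store (S : Stack ρ α D → List Sym) (x : ρ) (a : α) (i : ρ) (l : List ℕ) (k m N : ℕ)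
    (hN : ∀ n ∈ l, n ≤ N) (hk : k ≤ N) (hm : m ≤ N) (hl : l.length ≤ N)
    (ha : S (arr a) = encodeArray l)
    (hi : S (reg i) = List.replicate k (some true)) (hx : S (reg x) = List.replicate m (some true))
    (htmp : S tmp = []) (hidx : S idx = []) (haux : S aux = []) (v : Var) :
    ∃ v', Exec (store a i x) (v, S) (50 * (N + 1) ^ 2)
      (v', update S (arr a) (encodeArray (l.set k m))) := by
  obtain ⟨v₁, h₁⟩ := exec_seek S a i l k N hN hk ha hi htmp hidx haux v
  have hlen (l' : List ℕ) (h : ∀ n ∈ l', n ∈ l) (h' : l'.length ≤ l.length) :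
      (encodeArray l').length ≤ N * (N + 1) :=
    (length_encodeArray_le fun n hn => hN n (h n hn)).trans
      (Nat.mul_le_mul_right _ (h'.trans hl))
  rcases hj : l.drop k with _ | ⟨n, r⟩
  · have hkl : l.length ≤ k := by simpa using hj
    have h₃ := exec_block (k := arr a) (p := skip (K := Stack ρ α D))
      (rest := []) (by simp) (n := 0) (c := 2) (fun _ => seekStore S a l k)
      (fun i _ => by simp [seekStore, hj, encodeArray]; omega) (by simp) v₁
    have e : update (seekStore S a l k) (arr a) [] =
        update (update S (arr a) []) aux (encodeArray l).reverse := by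
      funext j
      by_cases hj₁ : j = aux
      · subst hj₁; simp [seekStore, List.take_of_length_le hkl]
      · by_cases hj₂ : j = arr a
        · subst hj₂; simp
        · simp [hj₁, hj₂, seekStore]
    rw [List.tail_nil, e] at h₃
    have h₄ := exec_unseek S a [] (encodeArray l) none
    refine ⟨_, ((Exec.seq h₁ (Exec.seq h₃ (Exec.seq
      (Exec.ite_false rfl Exec.skip) h₄))).of_eq ?_ fun j => ?_)⟩
    · have := hlen l (by simp) le_rfl
      nlinarith
    · by_cases hj₁ : j = aux
      · subst hj₁; simp [haux]
      · by_cases hj₂ : j = arr a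
        · subst hj₂; simp [List.set_eq_of_length_le hkl]
        · simp [hj₁, hj₂]
  · have hjl : k < l.length := by
      by_contra hcon
      rw [List.drop_eq_nil_of_le (by omega)] at hj
      simp at hj
    have hn : l[k] = n ∧ l.drop (k + 1) = r := by
      rw [List.drop_eq_getElem_cons hjl] at hj
      exact List.cons.inj hj
    have hnN : n ≤ N := hn.1 ▸ hN _ (List.getElem_mem hjl)
    let I : ℕ → Stack ρ α D → List Sym := fun m =>
      update (seekStore S a l k) (arr a) (List.replicate m (some true) ++ none :: encodeArray r)
    have hI : seekStore S a l k = I n := by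
      funext j
      by_cases hj₂ : j = arr a
      · subst hj₂; simp [I, seekStore, hj, encodeArray_cons]
      · simp [I, hj₂]
    rw [hI] at h₁
    have h₃ := exec_block (k := arr a) (p := skip (K := Stack ρ α D))
      (rest := none :: encodeArray r) (by simp) (n := n) (c := 2) I
      (fun i _ => by simp [I])
      (fun m hm => ⟨some (some true), Exec.skip.of_eq (by omega) fun j => by simp [I]⟩) v₁
    have e₀ : update (I 0) (arr a) (encodeArray r) =
        update (update S (arr a) (encodeArray r)) aux (encodeArray (l.take k)).reverse := by
      funext j
      by_cases hj₁ : j = aux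
      · subst hj₁; simp [I, seekStore]
      · by_cases hj₂ : j = arr a
        · subst hj₂; simp
        · simp [I, seekStore, hj₁, hj₂]
    rw [List.tail_cons, e₀] at h₃
    have h₄ := exec_dup (y := reg x) (t := tmp) (x := aux) (by simp) (by simp) (by simp) (n := m)
      (update (update S (arr a) (encodeArray r)) aux (encodeArray (l.take k)).reverse)
      (by simpa using hx) (by simpa using htmp) (some none)
    have h₅ := (Exec.push (k := (aux : Stack ρ α D)) (f := fun _ => none) (v := none)
      (S := update (update (update S (arr a) (encodeArray r)) aux
          (encodeArray (l.take k)).reverse) aux (List.replicate m (some true) ++ update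
          (update S (arr a) (encodeArray r)) aux (encodeArray (l.take k)).reverse aux)))
    have e : update (update (update (update S (arr a) (encodeArray r)) aux
          (encodeArray (l.take k)).reverse) aux (List.replicate m (some true) ++ update
          (update S (arr a) (encodeArray r)) aux (encodeArray (l.take k)).reverse aux)) aux
        (none :: update (update (update S (arr a) (encodeArray r)) aux
          (encodeArray (l.take k)).reverse) aux (List.replicate m (some true) ++ update
          (update S (arr a) (encodeArray r)) aux (encodeArray (l.take k)).reverse aux) aux) =
        update (update S (arr a) (encodeArray r)) aux (encodeArray (l.take k ++ [m])).reverse := by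
      simp [encodeArray]
    rw [e] at h₅
    have h₆ := exec_unseek S a (encodeArray r) (encodeArray (l.take k ++ [m])) none
    refine ⟨_, ((Exec.seq h₁ (Exec.seq h₃ (Exec.seq
      (Exec.ite_true rfl (Exec.seq h₄ h₅)) h₆))).of_eq ?_ fun j => ?_)⟩
    · have := hlen (l.take k) (fun n hn => List.mem_of_mem_take hn) (by simp)
      simp only [encodeArray_append, List.length_append]
      simp only [encodeArray, List.flatMap_cons, List.flatMap_nil, List.length_append,
        List.length_replicate, List.length_cons, List.length_nil] at this ⊢
      nlinarith
    · by_cases hj₁ : j = aux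
      · subst hj₁; simp [haux]
      · by_cases hj₂ : j = arr a
        · subst hj₂
          rw [← hn.2]
          simp [← encodeArray_append, List.set_eq_take_append_cons_drop, hjl]
        · simp [hj₁, hj₂]

end Com

end StackProgram

/-! ### Compiling random access programs to stack programs -/

namespace StackProgram

open Function

variable {ρ α : Type} [DecidableEq ρ] [DecidableEq α] {D : ℕ}

namespace Prog

open Com Stack

/-- Implementation of `Prog.sub` for two different registers. -/
def subCom (x y : ρ) : Com (Stack ρ α D) :=
  Com.seq (move (reg y) tmp)
    (block tmp (Com.seq (push (reg y) fun _ => some true) (pop (reg x))))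

/-- Implementation of a program that is nested in `d` loops. -/
def compile : Prog ρ α → ℕ → Com (Stack ρ α D)
  | skip, _ => Com.skip
  | clr x, _ => clear (reg x)
  | inc x, _ => push (reg x) fun _ => some true
  | dec x, _ => pop (reg x)
  | cpy x y, _ => if x = y then Com.skip else
      Com.seq (clear (reg x)) (dup (reg y) tmp (reg x))
  | sub x y, _ => if x = y then clear (reg x) else subCom x y
  | load x a i, _ => Com.load x a i
  | store a i x, _ => Com.store a i x
  | ifz x p q, d => Com.seq (pop (reg x))
      (ite Option.isSome (Com.seq (push (reg x) fun _ => some true) (q.compile d)) (p.compile d))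
  | read pe ps p0 p1, d => Com.seq (pop inp)
      (ite (fun v => v == none) (pe.compile d) (ite (fun v => v == some none) (ps.compile d)
        (ite (fun v => v == some (some false)) (p0.compile d) (p1.compile d))))
  | emit c, _ => push out fun _ => c
  | seq p q, d => Com.seq (p.compile d) (q.compile d)
  | rep p, d => if h : d < D then
      Com.seq (block (todo ⟨d, h⟩)
        (Com.seq (push (done ⟨d, h⟩) fun _ => some true) (p.compile (d + 1))))
        (move (done ⟨d, h⟩) (todo ⟨d, h⟩))
      else Com.skip

end Prog

/-- The stacks that represent a memory, with the given counters of finished and unfinished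
executions of loop bodies. -/
def Mem.stacks (B : ℕ) (s : Mem ρ α) (todo done : Fin D → ℕ) : Stack ρ α D → List Sym
  | .reg x => List.replicate (s.reg x) (some true)
  | .arr a => encodeArray ((List.range B).map (s.arr a))
  | .todo d => List.replicate (todo d) (some true)
  | .done d => List.replicate (done d) (some true)
  | .inp => s.inp
  | .out => s.out.reverse
  | .result | .tmp | .idx | .aux => []

namespace Prog

open Com Stack

/-- The program, as implemented, has its specified effect. -/
def Implements (B : ℕ) (p : Prog ρ α) : Prop :=
  ∀ (d : ℕ) (s : Mem ρ α) (t u : Fin D → ℕ) (M N : ℕ) (v : Var),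
    (∀ j : Fin D, d ≤ j → t j = B ∧ u j = 0) → d + p.depth ≤ D → B ≤ N → s.Bounded M →
    M + p.cost.eval B ≤ N →
    ∃ v', Exec (p.compile d) (v, s.stacks B t u) (p.cost.eval B * (50 * (N + 1) ^ 2))
      (v', (p.run B s).stacks B t u)

theorem Mem.stacks_update_reg {B : ℕ} {s : Mem ρ α} {t u : Fin D → ℕ} (x : ρ) (n : ℕ) :
    ({ s with reg := update s.reg x n } : Mem ρ α).stacks B t u =
      update (s.stacks B t u) (reg x) (List.replicate n (some true)) := by
  funext j
  cases j with
  | reg y =>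
    by_cases hy : y = x
    · subst hy; simp [Mem.stacks]
    · simp [Mem.stacks, hy]
  | _ => simp [Mem.stacks]

theorem implements_cpy (B : ℕ) (x y : ρ) : Implements (D := D) B (cpy x y : Prog ρ α) := by
  intro d s t u M N v _ _ _ hM hN
  simp only [cost, Polynomial.eval_one] at hN ⊢
  by_cases hxy : x = y
  · subst hxy
    simp only [compile, if_true, run]
    rw [update_eq_self]
    exact ⟨_, Exec.skip.mono (by nlinarith)⟩
  · simp only [compile, if_neg hxy, run]
    rw [Mem.stacks_update_reg]
    have h₁ := exec_clear (reg x) v (s.stacks B t u)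
    have h₂ := exec_dup (y := reg y) (t := tmp) (x := reg x) (n := s.reg y) (by simp)
      (by simpa using Ne.symm hxy) (by simp) (update (s.stacks B t u) (reg x) [])
      (by simp [Ne.symm hxy, Mem.stacks]) (by simp [Mem.stacks]) none
    refine ⟨_, (Exec.seq h₁ h₂).of_eq ?_ fun j => by simp⟩
    have := hM.reg x
    have := hM.reg y
    simp [Mem.stacks]
    nlinarith

/-- Every symbol that returns from `tmp` to `y` removes one from `x`; popping an empty stack has no
effect, which yields truncated subtraction. -/
theorem implements_sub (B : ℕ) (x y : ρ) : Implements (D := D) B (sub x y : Prog ρ α) := by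
  intro d s t u M N v _ _ _ hM hN
  simp only [cost, Polynomial.eval_one] at hN ⊢
  by_cases hxy : x = y
  · subst hxy
    simp only [compile, if_true, run]
    rw [Mem.stacks_update_reg]
    refine ⟨_, (exec_clear (reg x) v (s.stacks B t u)).of_eq ?_ fun j => by simp⟩
    have := hM.reg x
    simp [Mem.stacks]
    nlinarith
  · simp only [compile, if_neg hxy, run]
    rw [Mem.stacks_update_reg]
    have h₁ := exec_move (reg y) tmp (by simp) v (s.stacks B t u)
    let I : ℕ → Stack ρ α D → List Sym := fun m =>
      update (update (update (s.stacks B t u) tmp (List.replicate m (some true)))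
        (reg y) (List.replicate (s.reg y - m) (some true)))
        (reg x) (List.replicate (s.reg x - (s.reg y - m)) (some true))
    have e₁ : update (update (s.stacks B t u) tmp ((s.stacks B t u (reg y)).reverse ++
        s.stacks B t u tmp)) (reg y) [] = I (s.reg y) := by
      funext j
      by_cases hx : j = reg x
      · subst hx; simp [I, Mem.stacks, hxy]
      · simp [I, hx, Mem.stacks]
    have e₂ : I 0 = update (s.stacks B t u) (reg x)
        (List.replicate (s.reg x - s.reg y) (some true)) := by
      funext j
      by_cases hx : j = reg x
      · subst hx; simp [I]
      · by_cases hy : j = reg y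
        · subst hy; simp [I, hx, Mem.stacks]
        · by_cases ht : j = tmp
          · subst ht; simp [I, Mem.stacks]
          · simp [I, hx, hy, ht]
    rw [e₁] at h₁
    have h₂ := exec_block_replicate (k := tmp)
      (p := Com.seq (push (K := Stack ρ α D) (reg y) fun _ => some true) (pop (reg x)))
      (n := s.reg y) (c := 2) I (fun i _ => by simp [I])
      (fun m hm => ⟨_, (Exec.seq Exec.push Exec.pop).of_eq le_rfl fun j => by
        have hm' : s.reg y - m = s.reg y - (m + 1) + 1 := by omega
        by_cases hx : j = reg x
        · subst hx; simp [I, hxy]; omega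
        · by_cases hy : j = reg y
          · subst hy; simp [I, hx, hm', List.replicate_succ]
          · by_cases ht : j = tmp
            · subst ht; simp [I]
            · simp [I, hx, hy, ht]⟩) none
    rw [e₂] at h₂
    refine ⟨_, (Exec.seq h₁ h₂).mono ?_⟩
    have := hM.reg y
    simp [Mem.stacks]
    nlinarith

theorem implements_load (B : ℕ) (x : ρ) (a : α) (i : ρ) :
    Implements (D := D) B (load x a i : Prog ρ α) := by
  intro d s t u M N v _ _ hB hM hN
  simp only [cost, Polynomial.eval_one] at hN ⊢
  obtain ⟨v', h⟩ := exec_load (s.stacks B t u) x a i ((List.range B).map (s.arr a)) (s.reg i) N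
    (by
      simp only [List.mem_map, forall_exists_index, and_imp]
      rintro _ j _ rfl
      exact (hM.arr a j).trans (by omega))
    ((hM.reg i).trans (by omega)) (by simpa using hB) rfl rfl
    (by have := hM.reg x; simp [Mem.stacks]; omega) rfl rfl rfl v
  refine ⟨v', ?_⟩
  simp only [compile, run]
  rw [Mem.stacks_update_reg]
  convert h.mono (Nat.le_of_eq (one_mul _).symm) using 4
  by_cases hi : s.reg i < B <;> simp [hi]

/-- For an index of at least `B`, the memory changes only in a cell that the stacks do not represent
and that `load` never returns. -/
theorem implements_store (B : ℕ) (a : α) (i x : ρ) :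
    Implements (D := D) B (store a i x : Prog ρ α) := by
  intro d s t u M N v _ _ hB hM hN
  simp only [cost, Polynomial.eval_one] at hN ⊢
  obtain ⟨v', h⟩ := exec_store (s.stacks B t u) x a i ((List.range B).map (s.arr a)) (s.reg i)
    (s.reg x) N
    (by
      simp only [List.mem_map, forall_exists_index, and_imp]
      rintro _ j _ rfl
      exact (hM.arr a j).trans (by omega))
    ((hM.reg i).trans (by omega)) ((hM.reg x).trans (by omega)) (by simpa using hB) rfl rfl rfl
    rfl rfl rfl v
  refine ⟨v', h.of_eq (by simp) fun j => ?_⟩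
  by_cases hj : j = arr a
  · subst hj
    simp only [run, Mem.stacks, update_self]
    congr 1
    refine List.ext_getElem (by simp) fun k h₁ h₂ => ?_
    simp only [List.getElem_map, List.getElem_range, List.getElem_set]
    by_cases hk : s.reg i = k
    · subst hk; simp
    · simp [hk, Ne.symm hk]
  · cases j with
    | arr b =>
      have hb : b ≠ a := fun h => hj (by rw [h])
      simp [run, Mem.stacks, hb]
    | _ => simp [run, Mem.stacks]

/-- Each nesting depth has its own pair of counters. One execution of the body passes a symbol from
`todo` to `done`; afterwards `done` is moved back, so that the loop can be entered again. Inner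
loops use only deeper counters, which `Implements` requires to be in their initial state. -/
theorem implements_rep (B : ℕ) (p : Prog ρ α) (hp : Implements (D := D) B p) :
    Implements (D := D) B (rep p) := by
  intro d s t u M N v hd hD hB hM hN
  simp only [depth] at hD
  simp only [cost, Polynomial.eval_add, Polynomial.eval_mul, Polynomial.eval_X,
    Polynomial.eval_one] at hN ⊢
  have hdD : d < D := by omega
  obtain ⟨htd, hud⟩ := hd ⟨d, hdD⟩ le_rfl
  simp only [compile, dif_pos hdD, run]
  have hbd : ∀ k, ((p.run B)^[k] s).Bounded (M + k * p.cost.eval B) := by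
    intro k
    induction k with
    | zero => simpa using hM
    | succ k ih =>
      rw [iterate_succ_apply']
      exact (Mem.Bounded.run p ih).mono (by rw [Nat.succ_mul]; omega)
  let I : ℕ → Stack ρ α D → List Sym := fun m =>
    ((p.run B)^[B - m] s).stacks B (update t ⟨d, hdD⟩ m) (update u ⟨d, hdD⟩ (B - m))
  have e₁ : s.stacks B t u = I B := by
    simp only [I, Nat.sub_self, iterate_zero, id]
    rw [← htd, update_eq_self, ← hud, update_eq_self]
  have h₁ := exec_block_replicate (k := todo ⟨d, hdD⟩)
    (p := Com.seq (push (K := Stack ρ α D) (done ⟨d, hdD⟩) fun _ => some true)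
      (p.compile (d + 1)))
    (n := B) (c := p.cost.eval B * (50 * (N + 1) ^ 2) + 1) I (fun i _ => by simp [I, Mem.stacks])
    (fun m hm => by
      have hm' : B - m = B - (m + 1) + 1 := by omega
      obtain ⟨v', h⟩ := hp (d + 1) ((p.run B)^[B - (m + 1)] s) (update t ⟨d, hdD⟩ m)
        (update u ⟨d, hdD⟩ (B - m)) (M + (B - (m + 1)) * p.cost.eval B) N (some (some true))
        (fun j hj => by
          have hj' : j ≠ ⟨d, hdD⟩ := by
            rintro rfl
            simp at hj
          simp only [update_of_ne hj']
          exact hd j (by omega)) (by omega) hB (hbd _)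
          (by
            have : (B - (m + 1)) * p.cost.eval B + p.cost.eval B ≤ B * p.cost.eval B := by
              rw [← Nat.succ_mul]
              exact Nat.mul_le_mul_right _ (by omega)
            nlinarith)
      have e : (p.run B) ((p.run B)^[B - (m + 1)] s) = (p.run B)^[B - m] s := by
        rw [hm', iterate_succ_apply']
      rw [e] at h
      have h₀ := Exec.push (k := (done ⟨d, hdD⟩ : Stack ρ α D)) (f := fun _ => some true)
        (v := some (some true))
        (S := update (I (m + 1)) (todo ⟨d, hdD⟩) (List.replicate m (some true)))
      have e' : update (update (I (m + 1)) (todo ⟨d, hdD⟩) (List.replicate m (some true)))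
          (done ⟨d, hdD⟩) (some true :: update (I (m + 1)) (todo ⟨d, hdD⟩)
            (List.replicate m (some true)) (done ⟨d, hdD⟩)) =
          ((p.run B)^[B - (m + 1)] s).stacks B (update t ⟨d, hdD⟩ m)
            (update u ⟨d, hdD⟩ (B - m)) := by
        funext j
        cases j with
        | todo j =>
          by_cases hj : j = ⟨d, hdD⟩
          · subst hj; simp [Mem.stacks]
          · simp [Mem.stacks, hj, I]
        | done j =>
          by_cases hj : j = ⟨d, hdD⟩
          · subst hj; simp [Mem.stacks, I, hm', List.replicate_succ]
          · simp [Mem.stacks, hj, I]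
        | _ => simp [Mem.stacks, I]
      rw [e'] at h₀
      exact ⟨v', (Exec.seq h₀ h).mono (by omega)⟩) v
  have h₂ := exec_move (done ⟨d, hdD⟩) (todo ⟨d, hdD⟩) (by simp) none (I 0)
  rw [e₁]
  refine ⟨_, (Exec.seq h₁ h₂).of_eq ?_ fun j => ?_⟩
  · simp [I, Mem.stacks]
    nlinarith
  · cases j with
    | todo j =>
      by_cases hj : j = ⟨d, hdD⟩
      · subst hj; simp [Mem.stacks, I, htd]
      · simp [Mem.stacks, hj, I]
    | done j =>
      by_cases hj : j = ⟨d, hdD⟩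
      · subst hj; simp [Mem.stacks, hud]
      · simp [Mem.stacks, hj, I]
    | _ => simp [Mem.stacks, I]

theorem implements_ifz (B : ℕ) (x : ρ) (p q : Prog ρ α) (hp : Implements (D := D) B p)
    (hq : Implements (D := D) B q) : Implements (D := D) B (ifz x p q) := by
  intro d s t u M N v hd hD hB hM hN
  simp only [depth] at hD
  simp only [cost, Polynomial.eval_add, Polynomial.eval_one] at hN ⊢
  have h₁ := Exec.pop (k := (reg x : Stack ρ α D)) (v := v) (S := s.stacks B t u)
  have e : s.stacks B t u (reg x) = List.replicate (s.reg x) (some true) := rfl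
  rw [e] at h₁
  rcases hx : s.reg x with _ | n
  · obtain ⟨v', h⟩ := hp d s t u M N none hd (by omega) hB hM (by omega)
    rw [hx] at h₁ e
    have e' : update (s.stacks B t u) (reg x) [] = s.stacks B t u := by
      conv_rhs => rw [← update_eq_self (reg x) (s.stacks B t u), e]
      rfl
    simp only [List.replicate_zero, List.tail_nil, e', List.head?_nil] at h₁
    refine ⟨v', ?_⟩
    rw [run, if_pos hx]
    exact (Exec.seq h₁ (Exec.ite_false rfl h)).mono (by nlinarith)
  · obtain ⟨v', h⟩ := hq d s t u M N (some (some true)) hd (by omega) hB hM (by omega)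
    rw [hx] at h₁ e
    simp only [List.replicate_succ, List.tail_cons, List.head?_cons] at h₁
    -- Testing a register pops a symbol, which has to be put back in the nonzero case.
    have h₂ := Exec.push (k := (reg x : Stack ρ α D)) (f := fun _ => some true)
      (v := some (some true))
      (S := update (s.stacks B t u) (reg x) (List.replicate n (some true)))
    have e' : update (update (s.stacks B t u) (reg x) (List.replicate n (some true))) (reg x)
        (some true :: update (s.stacks B t u) (reg x) (List.replicate n (some true)) (reg x)) =
        s.stacks B t u := by
      rw [update_idem, update_self, ← List.replicate_succ, ← e, update_eq_self]
    rw [e'] at h₂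
    refine ⟨v', ?_⟩
    rw [run, if_neg (by omega)]
    exact (Exec.seq h₁ (Exec.ite_true rfl (Exec.seq h₂ h))).mono (by nlinarith)

theorem implements_read (B : ℕ) (pe ps p0 p1 : Prog ρ α) (he : Implements (D := D) B pe)
    (hs : Implements (D := D) B ps) (h0 : Implements (D := D) B p0)
    (h1 : Implements (D := D) B p1) : Implements (D := D) B (read pe ps p0 p1) := by
  intro d s t u M N v hd hD hB hM hN
  simp only [depth] at hD
  simp only [cost, Polynomial.eval_add, Polynomial.eval_one] at hN ⊢
  have h₁ := Exec.pop (k := (inp : Stack ρ α D)) (v := v) (S := s.stacks B t u)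
  have e : s.stacks B t u inp = s.inp := rfl
  have e' (l : List Sym) : update (s.stacks B t u) inp l =
      ({ s with inp := l } : Mem ρ α).stacks B t u := by
    funext j
    cases j <;> simp [Mem.stacks]
  rw [e, e'] at h₁
  rw [run]
  rcases hi : s.inp with _ | ⟨_ | _ | _, l⟩
  · obtain ⟨v', h⟩ := he d s t u M N none hd (by omega) hB hM (by omega)
    have e'' : ({ s with inp := [] } : Mem ρ α) = s := by rw [← hi]
    simp only [hi, List.tail_nil, List.head?_nil, e''] at h₁
    exact ⟨v', (Exec.seq h₁ (Exec.ite_true rfl h)).mono (by nlinarith)⟩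
  · obtain ⟨v', h⟩ := hs d { s with inp := l } t u M N (some none) hd (by omega) hB
      (hM.of_inp hi) (by omega)
    simp only [hi, List.tail_cons, List.head?_cons] at h₁
    exact ⟨v', (Exec.seq h₁ (Exec.ite_false rfl (Exec.ite_true rfl h))).mono (by nlinarith)⟩
  · obtain ⟨v', h⟩ := h0 d { s with inp := l } t u M N (some (some false)) hd (by omega) hB
      (hM.of_inp hi) (by omega)
    simp only [hi, List.tail_cons, List.head?_cons] at h₁
    exact ⟨v', (Exec.seq h₁ (Exec.ite_false rfl (Exec.ite_false rfl
      (Exec.ite_true rfl h)))).mono (by nlinarith)⟩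
  · obtain ⟨v', h⟩ := h1 d { s with inp := l } t u M N (some (some true)) hd (by omega) hB
      (hM.of_inp hi) (by omega)
    simp only [hi, List.tail_cons, List.head?_cons] at h₁
    exact ⟨v', (Exec.seq h₁ (Exec.ite_false rfl (Exec.ite_false rfl
      (Exec.ite_false rfl h)))).mono (by nlinarith)⟩

theorem implements (B : ℕ) (p : Prog ρ α) : Implements (D := D) B p := by
  induction p with
  | skip =>
    intro d s t u M N v _ _ _ hM hN
    exact ⟨v, Exec.skip.mono (by simp [cost]; nlinarith)⟩
  | clr x =>
    intro d s t u M N v _ _ _ hM hN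
    simp only [run, Mem.stacks_update_reg]
    refine ⟨_, (exec_clear (reg x) v (s.stacks B t u)).of_eq ?_ fun j => by simp⟩
    have := hM.reg x
    simp [cost] at hN
    simp [Mem.stacks, cost]
    nlinarith
  | inc x =>
    intro d s t u M N v _ _ _ hM hN
    simp only [run, Mem.stacks_update_reg]
    exact ⟨_, Exec.push.of_eq (by simp [cost]; nlinarith) fun j => by
      simp [Mem.stacks, List.replicate_succ]⟩
  | dec x =>
    intro d s t u M N v _ _ _ hM hN
    simp only [run, Mem.stacks_update_reg]
    exact ⟨_, Exec.pop.of_eq (by simp [cost]; nlinarith) fun j => by simp [Mem.stacks]⟩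
  | cpy x y => exact implements_cpy B x y
  | sub x y => exact implements_sub B x y
  | load x a i => exact implements_load B x a i
  | store a i x => exact implements_store B a i x
  | ifz x p q ihp ihq => exact implements_ifz B x p q ihp ihq
  | read pe ps p0 p1 ihe ihs ih0 ih1 => exact implements_read B pe ps p0 p1 ihe ihs ih0 ih1
  | emit c =>
    intro d s t u M N v _ _ _ hM hN
    refine ⟨_, Exec.push.of_eq (by simp [cost]; nlinarith) fun j => ?_⟩
    cases j <;> simp [Mem.stacks, run]
  | seq p q ihp ihq =>
    intro d s t u M N v hd hD hB hM hN
    simp only [depth] at hD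
    simp only [cost, Polynomial.eval_add] at hN ⊢
    obtain ⟨v₁, h₁⟩ := ihp d s t u M N v hd (by omega) hB hM (by omega)
    obtain ⟨v₂, h₂⟩ := ihq d (p.run B s) t u (M + p.cost.eval B) N v₁ hd (by omega) hB
      (hM.run p) (by omega)
    exact ⟨v₂, (Exec.seq h₁ h₂).mono (by rw [add_mul])⟩
  | rep p ih => exact implements_rep B p ih

variable [Fintype ρ] [Fintype α]

/-- The initial memory. -/
def initialMem (w : List Sym) : Mem ρ α := ⟨fun _ => 0, fun _ _ => 0, w, []⟩

/-- The stacks that have to be filled at the beginning. -/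
def IsInitial : Stack ρ α D → Bool
  | .arr _ | .todo _ | .inp => true
  | _ => false

/-- The initial symbols on the stacks. -/
def initialSym : Stack ρ α D → Var → Sym
  | .arr _, _ => none
  | .todo _, _ => some true
  | _, v => v.getD none

/-- The program that prepares the memory, runs `p` and cleans up. -/
noncomputable def full (p : Prog ρ α) : Com (Stack ρ α p.depth) :=
  Com.seq (move inp tmp) <|
  Com.seq (drain tmp initialSym (Finset.univ.filter (IsInitial (ρ := ρ) (α := α) · = true)).toList) <|
  Com.seq (p.compile 0) <|
  Com.seq (clearAll (Finset.univ.erase out).toList) (move out result)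

theorem encodeArray_replicate_zero (n : ℕ) :
    encodeArray (List.replicate n 0) = List.replicate n none := by
  induction n with
  | zero => rfl
  | succ n ih => rw [List.replicate_succ, encodeArray_cons, ih]; rfl

/-- Moving the input to `tmp` and draining it back restores its order. Each drained symbol also puts
one separator on every array and one mark on every `todo` counter, which sets the number of cells
and of iterations to the length of the input. The final move undoes the reversal of the output. -/
theorem exec_full (p : Prog ρ α) : ∃ time : Polynomial ℕ, ∀ w : List Sym,
    Exec p.full (none, update (fun _ => []) inp w) (time.eval w.length)
      (none, update (fun _ => []) result (p.run w.length (initialMem w)).out) := by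
  classical
  let c := (Finset.univ.filter (IsInitial (ρ := ρ) (α := α) (D := p.depth) · = true)).toList.length
  let c' := (Finset.univ.erase (out : Stack ρ α p.depth)).toList.length
  -- `N` bounds all numbers in the memory, and `N₂` the length of every stack, since an array
  -- consists of at most `N` blocks of length at most `N + 1`.
  let N : Polynomial ℕ := Polynomial.X + p.cost
  let N₂ : Polynomial ℕ := N * (N + 1)
  refine ⟨(4 * Polynomial.X + 2) + (((c : Polynomial ℕ) + 3) * Polynomial.X + 2) +
    p.cost * (50 * (N + 1) ^ 2) + ((c' : Polynomial ℕ) * (3 * N₂ + 2) + 1) + (4 * N₂ + 2),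
    fun w => ?_⟩
  let S₀ : Stack ρ α p.depth → List Sym := fun _ => []
  have h₁ := exec_move (K := Stack ρ α p.depth) inp tmp (by simp) none
    (update S₀ inp w)
  have e₁ : update (update (update S₀ inp w) tmp
      ((update S₀ inp w inp).reverse ++ update S₀ inp w tmp)) inp [] =
      update S₀ tmp w.reverse := by
    funext j
    by_cases hj : j = inp
    · subst hj; simp [S₀]
    · by_cases hj' : j = tmp
      · subst hj'; simp [S₀]
      · simp [hj, hj']
  rw [e₁] at h₁
  have hmem (j : Stack ρ α p.depth) :
      j ∈ (Finset.univ.filter (IsInitial (ρ := ρ) (α := α) (D := p.depth) · = true)).toList ↔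
        IsInitial j = true := by simp
  have h₂ := exec_drain (K := Stack ρ α p.depth) tmp initialSym
    (Finset.univ.filter (IsInitial (ρ := ρ) (α := α) · = true)).toList (Finset.nodup_toList _)
    (by rw [hmem]; simp [IsInitial]) none (update S₀ tmp w.reverse)
  have e₂ : (fun j : Stack ρ α p.depth => if j = tmp then [] else
      if j ∈ (Finset.univ.filter (IsInitial (ρ := ρ) (α := α) · = true)).toList then
        ((update S₀ tmp w.reverse tmp).map fun a => initialSym j (some a)).reverse ++
          update S₀ tmp w.reverse j
      else update S₀ tmp w.reverse j) =
      (initialMem w : Mem ρ α).stacks w.length (fun _ => w.length) (fun _ => 0) := by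
    funext j
    simp only [hmem]
    cases j <;> simp [S₀, IsInitial, initialSym, Mem.stacks, initialMem, encodeArray_replicate_zero]
  rw [e₂] at h₂
  have hb : (initialMem w : Mem ρ α).Bounded w.length :=
    ⟨by simp [initialMem], by simp [initialMem], by simp [initialMem], by simp [initialMem]⟩
  obtain ⟨v, h₃⟩ := implements (D := p.depth) w.length p 0 (initialMem w) (fun _ => w.length)
    (fun _ => 0) w.length (N.eval w.length) none (by simp) (by simp) (by simp [N]) hb
    (by simp [N])
  have hb' : (p.run w.length (initialMem w)).Bounded (N.eval w.length) :=
    (hb.run p).mono (by simp [N])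
  generalize hs : p.run w.length (initialMem w) = s at h₃ hb'
  have hN : w.length ≤ N.eval w.length := by simp [N]
  have hlen (k : Stack ρ α p.depth) :
      (s.stacks w.length (fun _ => w.length) (fun _ => 0) k).length ≤ N₂.eval w.length := by
    simp only [N₂, Polynomial.eval_mul, Polynomial.eval_add, Polynomial.eval_one]
    generalize N.eval w.length = n at hb' hN
    cases k with
    | arr a =>
      refine (length_encodeArray_le (N := n) ?_).trans ?_
      · simp only [List.mem_map, forall_exists_index, and_imp]
        rintro _ j _ rfl
        exact hb'.arr a j
      · simp only [List.length_map, List.length_range]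
        exact Nat.mul_le_mul_right _ hN
    | reg x => have := hb'.reg x; simp [Mem.stacks]; nlinarith
    | inp => have := hb'.inp; simp [Mem.stacks]; nlinarith
    | out => have := hb'.out; simp [Mem.stacks]; nlinarith
    | _ => simp [Mem.stacks] <;> nlinarith
  obtain ⟨v', h₄⟩ := exec_clearAll (Finset.univ.erase (out : Stack ρ α p.depth)).toList v
    (s.stacks w.length (fun _ => w.length) (fun _ => 0)) _ hlen
  have h₅ := exec_move (K := Stack ρ α p.depth) out result (by simp) v'
    (fun k => if k ∈ (Finset.univ.erase (out : Stack ρ α p.depth)).toList then [] else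
      s.stacks w.length (fun _ => w.length) (fun _ => 0) k)
  refine (Exec.seq h₁ (Exec.seq h₂ (Exec.seq h₃ (Exec.seq h₄ h₅)))).of_eq ?_ fun j => ?_
  · have := hlen out
    simp [c, c'] at this ⊢
    omega
  · by_cases hj : j = out
    · subst hj; simp
    · by_cases hj' : j = result
      · subst hj'; simp [Mem.stacks]
      · simp [hj, hj']

/-- The functions computed by programs are computable in polynomial time. -/
theorem computable {β γ : Type} {ea : β → List Sym} {eb : γ → List Sym} {f : β → γ}
    (p : Prog ρ α) (h : ∀ b, (p.run (ea b).length (initialMem (ea b))).out = eb (f b)) :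
    Nonempty (Turing.TM2ComputableInPolyTime ea eb f) := by
  obtain ⟨time, ht⟩ := p.exec_full
  exact Com.computable_of_exec p.full inp result time fun b => by
    rw [← h]; exact ht (ea b)

end Prog

end StackProgram

/-! ### Walks, potentials, and the lower bound for flip sequences -/

namespace VertexFlip

namespace Multigraph

open Relation

variable {V E : Type*} (G : Multigraph V E)

/-- `l` is a walk from `u` to `v`. -/
def IsWalk : V → List (E × Bool) → V → Prop
  | u, [], v => u = v
  | u, d :: l, v => G.start d = u ∧ IsWalk (G.finish d) l v

variable {G}

theorem IsWalk.append {u v w : V} {l l' : List (E × Bool)} (h : G.IsWalk u l v)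
    (h' : G.IsWalk v l' w) : G.IsWalk u (l ++ l') w := by
  induction l generalizing u with
  | nil => obtain rfl : u = v := h; exact h'
  | cons d l ih => exact ⟨h.1, ih h.2⟩

theorem IsWalk.exists_of_append {u w : V} {l l' : List (E × Bool)} (h : G.IsWalk u (l ++ l') w) :
    ∃ v, G.IsWalk u l v ∧ G.IsWalk v l' w := by
  induction l generalizing u with
  | nil => exact ⟨u, rfl, h⟩
  | cons d l ih =>
    obtain ⟨v, h₁, h₂⟩ := ih h.2
    exact ⟨v, ⟨h.1, h₁⟩, h₂⟩

theorem start_not (d : E × Bool) : G.start (d.1, !d.2) = G.finish d := by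
  rcases d with ⟨e, _ | _⟩ <;> rfl

theorem finish_not (d : E × Bool) : G.finish (d.1, !d.2) = G.start d := by
  rcases d with ⟨e, _ | _⟩ <;> rfl

theorem IsWalk.reverse {u v : V} {l : List (E × Bool)} (h : G.IsWalk u l v) :
    G.IsWalk v (l.reverse.map fun d => (d.1, !d.2)) u := by
  induction l generalizing u with
  | nil => exact Eq.symm h
  | cons d l ih =>
    rw [List.reverse_cons, List.map_append]
    exact (ih h.2).append ⟨start_not d, (finish_not d).trans h.1⟩

theorem IsWalk.isChain {u v : V} {l : List (E × Bool)} (h : G.IsWalk u l v) :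
    l.IsChain fun d d' => G.finish d = G.start d' := by
  induction l generalizing u with
  | nil => exact .nil
  | cons d l ih =>
    cases l with
    | nil => exact .singleton _
    | cons d' l => exact .cons_cons h.2.1.symm (ih h.2)

theorem IsWalk.finish_getLast {u v : V} {l : List (E × Bool)} (h : G.IsWalk u l v) (hl : l ≠ []) :
    G.finish (l.getLast hl) = v := by
  induction l generalizing u with
  | nil => exact absurd rfl hl
  | cons d l ih =>
    cases l with
    | nil => exact h.2
    | cons d' l =>
      rw [List.getLast_cons (List.cons_ne_nil _ _)]
      exact ih h.2 _

/-- A nonempty closed walk without repeated vertices and edges is a cycle. -/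
def IsWalk.toCycle {u : V} {l : List (E × Bool)} (h : G.IsWalk u l u) (hl : l ≠ [])
    (hv : (l.map G.start).Nodup) (he : (l.map Prod.fst).Nodup) : G.Cycle where
  steps := l
  ne_nil := hl
  chain := h.isChain
  closed := by
    rw [h.finish_getLast hl]
    cases l with
    | nil => exact absurd rfl hl
    | cons d l => exact h.1.symm
  vertices_nodup := hv
  edges_nodup := he

theorem _root_.List.exists_append_of_not_nodup_map {α β : Type*} (f : α → β) {l : List α}
    (h : ¬ (l.map f).Nodup) : ∃ A d B d' C, l = A ++ d :: (B ++ d' :: C) ∧ f d = f d' := by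
  induction l with
  | nil => simp at h
  | cons a l ih =>
    by_cases hl : (l.map f).Nodup
    · have ha : f a ∈ l.map f := by
        by_contra hcon
        exact h (List.nodup_cons.2 ⟨hcon, hl⟩)
      obtain ⟨b, hb, hab⟩ := List.mem_map.1 ha
      obtain ⟨B, C, rfl⟩ := List.append_of_mem hb
      exact ⟨[], a, B, b, C, rfl, hab.symm⟩
    · obtain ⟨A, d, B, d', C, rfl, hd⟩ := ih hl
      exact ⟨a :: A, d, B, d', C, rfl, hd⟩

/-- A closed walk with a repeated vertex splits into two shorter closed walks. -/
theorem IsWalk.split {u : V} {A B C : List (E × Bool)} {d d' : E × Bool}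
    (h : G.IsWalk u (A ++ d :: (B ++ d' :: C)) u) (hd : G.start d = G.start d') :
    G.IsWalk (G.start d) (d :: B) (G.start d) ∧ G.IsWalk u (A ++ d' :: C) u := by
  obtain ⟨v, h₁, h₂⟩ := h.exists_of_append
  obtain ⟨w, h₃, h₄⟩ := IsWalk.exists_of_append (l := d :: B) h₂
  have hv : v = G.start d := h₂.1.symm
  have hw : w = G.start d := h₄.1.symm.trans hd.symm
  subst hv
  rw [hw] at h₃ h₄
  exact ⟨h₃, h₁.append h₄⟩

/-- The contribution of a traversed edge to the difference of the numbers of forward edges. -/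
def weight (X Y : Orientation E) (d : E × Bool) : ℤ :=
  (if X d.1 = d.2 then 1 else 0) - (if Y d.1 = d.2 then 1 else 0)

theorem weight_not (X Y : Orientation E) (d : E × Bool) :
    weight X Y (d.1, !d.2) = - weight X Y d := by
  rcases d with ⟨e, b⟩
  simp only [weight]
  cases X e <;> cases Y e <;> cases b <;> rfl

theorem sum_weight_eq (X Y : Orientation E) (l : List (E × Bool)) :
    (l.map (weight X Y)).sum =
      (l.countP (fun d => X d.1 == d.2) : ℤ) - l.countP (fun d => Y d.1 == d.2) := by
  induction l with
  | nil => rfl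
  | cons d l ih =>
    rw [List.map_cons, List.sum_cons, ih, List.countP_cons, List.countP_cons, weight]
    simp only [beq_iff_eq]
    split_ifs <;> push_cast <;> ring

theorem sum_weight_reverse (X Y : Orientation E) (l : List (E × Bool)) :
    ((l.reverse.map fun d => (d.1, !d.2)).map (weight X Y)).sum = -(l.map (weight X Y)).sum := by
  induction l with
  | nil => rfl
  | cons d l ih =>
    simp only [List.reverse_cons, List.map_append, List.sum_append, ih, List.map_cons,
      List.sum_cons, List.map_nil, List.sum_nil, weight_not]
    ring

/-- Closed walks have weight zero. -/
theorem IsWalk.sum_weight_eq_zero {X Y : Orientation E}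
    (hXY : ∀ C : G.Cycle, C.forward X = C.forward Y) {u : V} {l : List (E × Bool)}
    (h : G.IsWalk u l u) : (l.map (weight X Y)).sum = 0 := by
  induction hn : l.length using Nat.strong_induction_on generalizing u l with
  | _ n ih =>
  have hsplit : ∀ A d B d' C, l = A ++ d :: (B ++ d' :: C) → G.start d = G.start d' →
      (l.map (weight X Y)).sum = 0 := by
    rintro A d B d' C rfl hd
    obtain ⟨h₁, h₂⟩ := h.split hd
    have e₁ := ih _ (by rw [← hn]; simp only [List.length_append, List.length_cons]; omega) h₁ rfl
    have e₂ := ih _ (by rw [← hn]; simp only [List.length_append, List.length_cons]; omega) h₂ rfl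
    simp only [List.map_append, List.map_cons, List.sum_append, List.sum_cons] at e₁ e₂ ⊢
    linarith
  by_cases hl : l = []
  · subst hl; rfl
  by_cases hv : (l.map G.start).Nodup
  · by_cases he : (l.map Prod.fst).Nodup
    · have := hXY (h.toCycle hl hv he)
      rw [sum_weight_eq, sub_eq_zero]
      exact_mod_cast this
    · obtain ⟨A, d, B, d', C, hl', hd⟩ := List.exists_append_of_not_nodup_map _ he
      by_cases hd₂ : d.2 = d'.2
      · exact hsplit A d B d' C hl' (by rw [Prod.ext hd hd₂])
      -- The edge is traversed in both directions, so its two weights cancel. Both the part between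
      -- the two traversals and the part outside them are shorter closed walks.
      · obtain rfl : d' = (d.1, !d.2) :=
          Prod.ext hd.symm (by cases h : d.2 <;> cases h' : d'.2 <;> simp_all)
        subst hl'
        obtain ⟨v, h₁, h₂⟩ := h.exists_of_append
        obtain ⟨w, h₃, h₄⟩ := h₂.2.exists_of_append
        have hw : w = G.finish d := h₄.1.symm.trans (start_not d)
        rw [hw] at h₃
        have h₅ := h₄.2
        rw [finish_not, h₂.1] at h₅
        have e₁ := ih _ (by rw [← hn]; simp; omega) h₃ rfl
        have e₂ := ih _ (by rw [← hn]; simp; omega) (h₁.append h₅) rfl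
        have e₃ := weight_not X Y d
        simp only [List.map_append, List.map_cons, List.sum_append, List.sum_cons] at e₁ e₂ ⊢
        linarith
  · obtain ⟨A, d, B, d', C, hl', hd⟩ := List.exists_append_of_not_nodup_map _ hv
    exact hsplit A d B d' C hl' hd

theorem Connected.exists_isWalk (hG : G.Connected) (u v : V) : ∃ l, G.IsWalk u l v := by
  induction hG u v with
  | refl => exact ⟨[], rfl⟩
  | tail _ h ih =>
    obtain ⟨l, hl⟩ := ih
    obtain ⟨d, hd, hd'⟩ := h
    exact ⟨l ++ [d], hl.append ⟨hd, hd'⟩⟩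

variable (G) in
/-- `z v` is the number of times that `v` has to be flipped from a source to a sink, minus the
number of times that it has to be flipped from a sink to a source, on the way from `X` to `Y`. -/
def IsPotential (X Y : Orientation E) (z : V → ℤ) : Prop :=
  ∀ e, z (G.tail X e) = z (G.head X e) + if X e = Y e then 0 else 1

/-- Take for `z v` the weight of any walk from `v` to `top`. The edge `e`, the walk from its head
and the reversed walk from its tail form a closed walk, whose weight zero is the equation for `e`.
-/
theorem exists_isPotential (hG : G.Connected) {X Y : Orientation E}
    (hXY : ∀ C : G.Cycle, C.forward X = C.forward Y) (top : V) :
    ∃ z, G.IsPotential X Y z ∧ z top = 0 := by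
  choose l hl using fun v => hG.exists_isWalk v top
  refine ⟨fun v => ((l v).map (weight X Y)).sum, fun e => ?_, (hl top).sum_weight_eq_zero hXY⟩
  have h : G.IsWalk (G.tail X e) ((e, X e) :: l (G.head X e)) top := ⟨rfl, hl _⟩
  have h' := (h.append (hl (G.tail X e)).reverse).sum_weight_eq_zero hXY
  rw [List.map_append, List.sum_append, sum_weight_reverse, List.map_cons, List.sum_cons] at h'
  have hw : weight X Y (e, X e) = if X e = Y e then 0 else 1 := by
    simp only [weight]
    cases X e <;> cases Y e <;> rfl
  linarith

/-- A nonempty closed directed walk contains a directed cycle. -/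
theorem IsWalk.exists_cycle {X : Orientation E} {u : V} {l : List (E × Bool)}
    (h : G.IsWalk u l u) (hl : l ≠ []) (hX : ∀ d ∈ l, X d.1 = d.2) :
    ∃ C : G.Cycle, ∀ d ∈ C.steps, X d.1 = d.2 := by
  induction hn : l.length using Nat.strong_induction_on generalizing u l with
  | _ n ih =>
  have hsplit : ∀ A d B d' C, l = A ++ d :: (B ++ d' :: C) → G.start d = G.start d' →
      ∃ C : G.Cycle, ∀ d ∈ C.steps, X d.1 = d.2 := by
    rintro A d B d' C rfl hd
    refine ih _ ?_ (h.split hd).1 (List.cons_ne_nil _ _) (fun d' hd' => hX d' ?_) rfl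
    · rw [← hn]; simp; omega
    · simp only [List.mem_cons, List.mem_append] at hd' ⊢
      tauto
  by_cases hv : (l.map G.start).Nodup
  · by_cases he : (l.map Prod.fst).Nodup
    · exact ⟨h.toCycle hl hv he, hX⟩
    · obtain ⟨A, d, B, d', C, hl', hd⟩ := List.exists_append_of_not_nodup_map _ he
      refine hsplit A d B d' C hl' (congrArg _ (Prod.ext hd ?_))
      rw [← hX d (by simp [hl']), ← hX d' (by simp [hl']), hd]
  · obtain ⟨A, d, B, d', C, hl', hd⟩ := List.exists_append_of_not_nodup_map _ hv
    exact hsplit A d B d' C hl' hd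

theorem exists_isWalk_of_transGen {X : Orientation E} {u v : V}
    (h : TransGen (fun u v => ∃ e, G.tail X e = u ∧ G.head X e = v) u v) :
    ∃ l ≠ [], G.IsWalk u l v ∧ ∀ d ∈ l, X d.1 = d.2 := by
  induction h with
  | single h =>
    obtain ⟨e, rfl, rfl⟩ := h
    exact ⟨[(e, X e)], by simp, ⟨rfl, rfl⟩, by simp⟩
  | tail _ h ih =>
    obtain ⟨e, rfl, rfl⟩ := h
    obtain ⟨l, hl, hw, hX⟩ := ih
    refine ⟨l ++ [(e, X e)], by simp, hw.append ⟨rfl, rfl⟩, fun d hd => ?_⟩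
    rcases List.mem_append.1 hd with hd | hd
    · exact hX d hd
    · obtain rfl := List.mem_singleton.1 hd; rfl

/-- The vertices of an acyclic orientation can be ranked along the edges. -/
theorem Acyclic.exists_rank [Fintype V] {X : Orientation E} (hX : G.Acyclic X) :
    ∃ r : V → ℕ, (∀ e, r (G.tail X e) < r (G.head X e)) ∧ ∀ v, r v < Fintype.card V := by
  classical
  let R : V → V → Prop := fun u v => ∃ e, G.tail X e = u ∧ G.head X e = v
  have hR : ∀ v, ¬ TransGen R v v := fun v hv => by
    obtain ⟨l, hl, hw, hlX⟩ := exists_isWalk_of_transGen hv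
    exact hX (hw.exists_cycle hl hlX)
  -- The rank counts proper predecessors. By acyclicity a vertex does not precede itself, so the
  -- count grows strictly along edges and stays below the number of vertices.
  refine ⟨fun v => (Finset.univ.filter fun u => TransGen R u v).card, fun e => ?_, fun v => ?_⟩
  · refine Finset.card_lt_card (Finset.ssubset_iff_subset_ne.2 ⟨fun u hu => ?_, fun h => ?_⟩)
    · simp only [Finset.mem_filter, Finset.mem_univ, true_and] at hu ⊢
      exact hu.tail ⟨e, rfl, rfl⟩
    · have : G.tail X e ∈ Finset.univ.filter fun u => TransGen R u (G.head X e) := by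
        simp only [Finset.mem_filter, Finset.mem_univ, true_and]
        exact .single ⟨e, rfl, rfl⟩
      rw [← h] at this
      exact hR _ (by simpa using this)
  · refine Finset.card_lt_univ_of_notMem (x := v) ?_
    simpa using hR v

section

variable {X Y Z : Orientation E}

theorem tail_eq_or (e : E) : (G.tail X e = G.fst e ∧ G.head X e = G.snd e ∧ X e = true) ∨
    (G.tail X e = G.snd e ∧ G.head X e = G.fst e ∧ X e = false) := by
  cases h : X e <;> simp [tail, head, start, finish, h]

theorem tail_not (e : E) (h : Y e = !X e) : G.tail Y e = G.head X e ∧ G.head Y e = G.tail X e := by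
  cases h' : X e <;> simp [tail, head, start, finish, h, h']

theorem tail_congr (e : E) (h : Y e = X e) : G.tail Y e = G.tail X e ∧ G.head Y e = G.head X e := by
  simp [tail, head, h]

theorem isSource_not (v : V) : G.IsSource (fun e => !X e) v ↔ G.IsSink X v := by
  refine forall_congr' fun e => ?_
  rw [(tail_not (G := G) (X := X) (Y := fun e => !X e) e rfl).2]

theorem isSink_not (v : V) : G.IsSink (fun e => !X e) v ↔ G.IsSource X v := by
  refine forall_congr' fun e => ?_
  rw [(tail_not (G := G) (X := X) (Y := fun e => !X e) e rfl).1]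

/-- Reversing all edges exchanges sources and sinks; together with `isFlipSeq_not` this reduces
statements about sinks to statements about sources. -/
theorem IsPotential.not {z : V → ℤ} (h : G.IsPotential X Y z) :
    G.IsPotential (fun e => !X e) (fun e => !Y e) fun v => -z v := fun e => by
  obtain ⟨h₁, h₂⟩ := tail_not (G := G) (X := X) (Y := fun e => !X e) e rfl
  have := h e
  rw [h₁, h₂]
  cases hx : X e <;> cases hy : Y e <;> simp_all

theorem Connected.eq_of_forall_edge (hG : G.Connected) {β : Type*} {z : V → β}
    (h : ∀ e, z (G.tail X e) = z (G.head X e)) (u v : V) : z u = z v := by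
  induction hG u v with
  | refl => rfl
  | tail _ h' ih =>
    obtain ⟨⟨e, b⟩, rfl, rfl⟩ := h'
    have := h e
    rcases tail_eq_or (G := G) (X := X) e with ⟨h₁, h₂, _⟩ | ⟨h₁, h₂, _⟩ <;>
      rw [h₁, h₂] at this <;> cases b <;> simp_all [start, finish]

variable [DecidableEq V]

theorem flip_eq (e : E) (v : V) :
    G.flip X v e = if G.tail X e = v ∨ G.head X e = v then !X e else X e := by
  rcases tail_eq_or (G := G) (X := X) e with ⟨h₁, h₂, _⟩ | ⟨h₁, h₂, _⟩
  · rw [h₁, h₂]; rfl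
  · rw [h₁, h₂]; simp only [flip, or_comm]

theorem flip_not (v : V) : G.flip (fun e => !X e) v = fun e => !G.flip X v e := by
  funext e
  simp only [flip]
  split_ifs <;> rfl

theorem isFlipSeq_not {top : V} {l : List V} :
    G.IsFlipSeq top (fun e => !Y e) (fun e => !X e) l ↔ G.IsFlipSeq top Y X l := by
  induction l generalizing X with
  | nil =>
    refine ⟨fun h => funext fun e => ?_, fun h => funext fun e => ?_⟩
    · exact Bool.not_inj (congrFun (show (fun e => !X e) = fun e => !Y e from h) e)
    · rw [show X = Y from h]
  | cons v l ih =>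
    rw [IsFlipSeq, IsFlipSeq, isSource_not, isSink_not, flip_not, ih, or_comm]

theorem IsFlipSeq.append {top : V} {l l' : List V} (h : G.IsFlipSeq top Y X l)
    (h' : G.IsFlipSeq top Z Y l') : G.IsFlipSeq top Z X (l ++ l') := by
  induction l generalizing X with
  | nil => obtain rfl : X = Y := h; exact h'
  | cons v l ih => exact ⟨h.1, h.2.1, ih h.2.2⟩

/-- The edges at `v` all leave it. After the flip they enter `v` and their agreement with `Y` is
inverted; lowering `z v` by one accounts for both. -/
theorem IsPotential.flip_of_isSource {z : V → ℤ} (h : G.IsPotential X Y z) {v : V}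
    (hv : G.IsSource X v) :
    G.IsPotential (G.flip X v) Y (Function.update z v (z v - 1)) := fun e => by
  have he := h e
  have hh := hv e
  have hf := flip_eq (G := G) (X := X) e v
  by_cases ht : G.tail X e = v
  · rw [if_pos (Or.inl ht)] at hf
    obtain ⟨h₁, h₂⟩ := tail_not (G := G) (X := X) e hf
    rw [h₁, h₂, ht, hf, Function.update_self, Function.update_of_ne hh]
    rw [ht] at he
    cases hx : X e <;> cases hy : Y e <;> simp_all
  · rw [if_neg (by tauto)] at hf
    obtain ⟨h₁, h₂⟩ := tail_congr (G := G) (X := X) e hf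
    rw [h₁, h₂, hf, Function.update_of_ne hh, Function.update_of_ne ht, he]

variable [Fintype V]

theorem sum_abs_update_le (z : V → ℤ) (v : V) (k : ℤ) (hk : |k| ≤ |z v| + 1) :
    ∑ w, |Function.update z v k w| ≤ ∑ w, |z w| + 1 := by
  rw [← Finset.add_sum_erase _ _ (Finset.mem_univ v), ← Finset.add_sum_erase _ (fun w => |z w|)
    (Finset.mem_univ v), Function.update_self]
  have : ∑ w ∈ Finset.univ.erase v, |Function.update z v k w| =
      ∑ w ∈ Finset.univ.erase v, |z w| :=
    Finset.sum_congr rfl fun w hw => by rw [Function.update_of_ne (Finset.ne_of_mem_erase hw)]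
  rw [this]
  linarith

theorem sum_abs_update_succ (z : V → ℤ) (v : V) (hz : 0 ≤ z v) :
    ∑ w, |Function.update z v (z v + 1) w| = ∑ w, |z w| + 1 := by
  rw [← Finset.add_sum_erase _ _ (Finset.mem_univ v), ← Finset.add_sum_erase _ (fun w => |z w|)
    (Finset.mem_univ v), Function.update_self]
  have : ∑ w ∈ Finset.univ.erase v, |Function.update z v (z v + 1) w| =
      ∑ w ∈ Finset.univ.erase v, |z w| :=
    Finset.sum_congr rfl fun w hw => by rw [Function.update_of_ne (Finset.ne_of_mem_erase hw)]
  rw [this, abs_of_nonneg hz, abs_of_nonneg (by omega)]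
  ring

/-- A lower bound for the length of a vertex flip sequence. -/
theorem IsFlipSeq.sum_abs_le (hG : G.Connected) {top : V} {l : List V}
    (h : G.IsFlipSeq top Y X l) {z : V → ℤ} (hz : G.IsPotential X Y z) (htop : z top = 0) :
    ∑ v, |z v| ≤ l.length := by
  induction l generalizing X z with
  | nil =>
    -- For equal orientations the potential is constant along edges, hence zero by connectedness.
    obtain rfl : X = Y := h
    have h₀ (v : V) : z v = 0 := by
      rw [← htop]
      exact hG.eq_of_forall_edge (X := X) (fun e => by simpa using hz e) v top
    simp [h₀]
  | cons v l ih =>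
    obtain ⟨hv, hs, hl⟩ := h
    -- The flip changes the potential only at `v` and by one, so `∑ |z v|` decreases by at most one.
    -- The old potential is written as an update of the new one; the value at `top` survives because
    -- `v ≠ top`.
    obtain ⟨z', hz', htop', k, hk, hzz'⟩ : ∃ z' : V → ℤ, G.IsPotential (G.flip X v) Y z' ∧
        z' top = 0 ∧ ∃ k, |k| ≤ |z' v| + 1 ∧ z = Function.update z' v k := by
      rcases hs with hs | hs
      · refine ⟨_, hz.flip_of_isSource hs, ?_, z v, ?_, by simp⟩
        · rwa [Function.update_of_ne (Ne.symm hv)]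
        · rw [Function.update_self]
          have := abs_add_le (z v - 1) 1
          simpa using this
      · have := (hz.not.flip_of_isSource ((isSource_not v).2 hs)).not
        simp only [flip_not, Bool.not_not] at this
        refine ⟨_, this, ?_, z v, ?_, ?_⟩
        · rw [Function.update_of_ne (Ne.symm hv), htop]; rfl
        · rw [Function.update_self]
          have := abs_add_le (-(-z v - 1)) (-1)
          simpa using this
        · funext w
          by_cases hw : w = v
          · subst hw; simp
          · simp [hw]
    have h₁ := ih hl hz' htop'
    have h₂ := sum_abs_update_le z' v k hk
    rw [hzz', List.length_cons]
    push_cast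
    linarith

end

/-! ### Orientations described by numbers of flips -/

section

variable (X : Orientation E)

variable (G) in
/-- The orientation reached from `X` when `c v` says how many times the vertex `v` has been
flipped (counting flips of sources as `1` and flips of sinks as `-1`). -/
def orient (c : V → ℤ) : Orientation E :=
  fun e => if c (G.tail X e) = c (G.head X e) then X e else !X e

variable (G) in
/-- The numbers of flips that may have occurred. -/
def IsCount (c : V → ℤ) : Prop :=
  ∀ e, c (G.tail X e) = c (G.head X e) ∨ c (G.tail X e) = c (G.head X e) + 1

variable {X}

theorem orient_zero : G.orient X (fun _ => 0) = X := by
  funext e; simp [orient]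

theorem IsPotential.isCount {Y : Orientation E} {z : V → ℤ} (h : G.IsPotential X Y z) :
    G.IsCount X z := fun e => by
  have := h e
  split_ifs at this
  · left; simpa using this
  · right; exact this

theorem IsPotential.orient_eq {Y : Orientation E} {z : V → ℤ} (h : G.IsPotential X Y z) :
    G.orient X z = Y := by
  funext e
  have := h e
  rw [orient]
  cases hx : X e <;> cases hy : Y e <;> simp_all

theorem orient_neg (c : V → ℤ) :
    G.orient (fun e => !X e) (fun v => -c v) = fun e => !G.orient X c e := by
  funext e
  obtain ⟨h₁, h₂⟩ := tail_not (G := G) (X := X) (Y := fun e => !X e) e rfl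
  simp only [orient, h₁, h₂, neg_inj, eq_comm]
  split_ifs <;> rfl

/-- Flipping a vertex all of whose out-neighbours have been flipped as often as the vertex itself,
and all of whose in-neighbours have been flipped once more. -/
theorem IsCount.flip [DecidableEq V] {c : V → ℤ} {v : V} (hc : G.IsCount X c)
    (hloop : ∀ e, G.tail X e ≠ G.head X e)
    (hout : ∀ e, G.tail X e = v → c (G.head X e) = c v)
    (hin : ∀ e, G.head X e = v → c (G.tail X e) = c v + 1) :
    G.IsCount X (Function.update c v (c v + 1)) ∧ G.IsSource (G.orient X c) v ∧
      G.flip (G.orient X c) v = G.orient X (Function.update c v (c v + 1)) := by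
  refine ⟨fun e => ?_, fun e => ?_, funext fun e => ?_⟩
  · have := hloop e
    by_cases ht : G.tail X e = v
    · have hh : G.head X e ≠ v := fun h => this (ht.trans h.symm)
      rw [ht, Function.update_self, Function.update_of_ne hh, hout e ht]
      exact Or.inr rfl
    · by_cases hh : G.head X e = v
      · rw [hh, Function.update_self, Function.update_of_ne ht, hin e hh]
        exact Or.inl rfl
      · rw [Function.update_of_ne ht, Function.update_of_ne hh]
        exact hc e
  -- Edges of `X` into `v` have unequal counts by `hin` and are thus reversed, while edges out of
  -- `v` have equal counts by `hout` and keep their direction.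
  · by_cases h : c (G.tail X e) = c (G.head X e)
    · have he : G.orient X c e = X e := if_pos h
      rw [(tail_congr (G := G) e he).2]
      intro hh
      have := hin e hh
      rw [hh] at h
      omega
    · have he : G.orient X c e = !X e := if_neg h
      rw [(tail_not (G := G) e he).2]
      intro ht
      exact h (by rw [hout e ht, ht])
  · have hl := hloop e
    have hinc : (G.tail (G.orient X c) e = v ∨ G.head (G.orient X c) e = v) ↔
        (G.tail X e = v ∨ G.head X e = v) := by
      by_cases h : c (G.tail X e) = c (G.head X e)
      · have he : G.orient X c e = X e := if_pos h
        rw [(tail_congr (G := G) e he).1, (tail_congr (G := G) e he).2]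
      · have he : G.orient X c e = !X e := if_neg h
        rw [(tail_not (G := G) e he).1, (tail_not (G := G) e he).2, or_comm]
    rw [flip_eq, if_congr hinc rfl rfl]
    simp only [orient]
    by_cases ht : G.tail X e = v
    · have hh : G.head X e ≠ v := fun h => hl (ht.trans h.symm)
      have := hout e ht
      rw [if_pos (Or.inl ht), ht, Function.update_self, Function.update_of_ne hh, this, if_pos rfl,
        if_neg (by omega)]
    · by_cases hh : G.head X e = v
      · have := hin e hh
        rw [if_pos (Or.inr hh), hh, Function.update_self, Function.update_of_ne ht, this,
          if_pos rfl, if_neg (by omega), Bool.not_not]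
      · rw [if_neg (by tauto), Function.update_of_ne ht, Function.update_of_ne hh]

end

end Multigraph

end VertexFlip

/-! ### Size of the potential, and flipping in rounds -/

namespace VertexFlip

namespace Multigraph

section

variable {V E : Type*} {G : Multigraph V E} {X Y : Orientation E}

/-- A discrete intermediate value theorem: a walk from `u` to `v` changes `z` by at most one per
edge and cannot jump over `k`. -/
theorem Connected.exists_eq_of_le (hG : G.Connected) {z : V → ℤ}
    (hz : ∀ e, z (G.tail X e) = z (G.head X e) ∨ z (G.tail X e) = z (G.head X e) + 1) {u v : V}
    {k : ℤ} (hu : z u ≤ k) (hv : k ≤ z v) : ∃ w, z w = k := by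
  by_contra! hcon
  have : z v < k := by
    clear hv
    induction hG u v with
    | refl => exact lt_of_le_of_ne hu (hcon u)
    | tail _ h' ih =>
      obtain ⟨⟨e, b⟩, rfl, rfl⟩ := h'
      refine lt_of_le_of_ne ?_ (hcon _)
      have := hz e
      rcases tail_eq_or (G := G) (X := X) e with ⟨h₁, h₂, _⟩ | ⟨h₁, h₂, _⟩ <;>
        rw [h₁, h₂] at this <;> cases b <;> simp only [start, finish] at * <;> grind
  omega

/-- If `z v` is nonnegative, all of `0, …, z v` are attained, which requires `z v + 1` vertices. -/
theorem IsCount.lt_card [Fintype V] (hG : G.Connected) {z : V → ℤ} (hz : G.IsCount X z) {top : V}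
    (htop : z top = 0) (v : V) : z v < Fintype.card V := by
  classical
  have h : Finset.Icc 0 (z v) ⊆ Finset.univ.image z := fun k hk => by
    rw [Finset.mem_Icc] at hk
    obtain ⟨w, hw⟩ := hG.exists_eq_of_le hz (u := top) (v := v) (by omega) hk.2
    exact Finset.mem_image.2 ⟨w, Finset.mem_univ _, hw⟩
  have h₁ := (Finset.card_le_card h).trans Finset.card_image_le
  rw [Int.card_Icc, Finset.card_univ] at h₁
  omega

theorem IsPotential.neg_lt_card [Fintype V] (hG : G.Connected) {z : V → ℤ}
    (hz : G.IsPotential X Y z) {top : V} (htop : z top = 0) (v : V) :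
    -z v < Fintype.card V :=
  hz.not.isCount.lt_card (top := top) hG (by rw [htop]; rfl) v

/-- Every vertex except possibly one is an endpoint of an edge. This bounds the number of vertices,
which the input gives only in binary, by the length of the edge list. -/
theorem Connected.card_le [Fintype V] [Fintype E] (hG : G.Connected) :
    Fintype.card V ≤ 2 * Fintype.card E + 1 := by
  classical
  by_cases hV : Nonempty V
  · obtain ⟨top⟩ := hV
    have h : (Finset.univ : Finset V) ⊆
        insert top (Finset.univ.image G.fst ∪ Finset.univ.image G.snd) := fun v _ => by
      simp only [Finset.mem_insert, Finset.mem_union, Finset.mem_image, Finset.mem_univ, true_and]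
      induction hG top v with
      | refl => exact Or.inl rfl
      | tail _ h _ =>
        obtain ⟨⟨e, b⟩, _, rfl⟩ := h
        cases b
        · exact Or.inr (Or.inl ⟨e, rfl⟩)
        · exact Or.inr (Or.inr ⟨e, rfl⟩)
    have h₁ := Finset.card_le_card h
    have h₂ := Finset.card_insert_le top (Finset.univ.image G.fst ∪ Finset.univ.image G.snd)
    have h₃ := Finset.card_union_le (Finset.univ.image G.fst) (Finset.univ.image G.snd)
    have h₄ := Finset.card_image_le (s := Finset.univ) (f := G.fst)
    have h₅ := Finset.card_image_le (s := Finset.univ) (f := G.snd)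
    simp only [Finset.card_univ] at h₁ h₄ h₅
    omega
  · rw [not_nonempty_iff] at hV
    simp

end

section

variable {n : ℕ} {E : Type*} {G : Multigraph (Fin n) E} {X Y : Orientation E}

/-- The list `l` of flipped vertices, recording the numbers `c` of flips, transforms `X` without
ever undoing a flip. -/
structure Reaches (G : Multigraph (Fin n) E) (top : Fin n) (X : Orientation E) (c : Fin n → ℤ)
    (l : List (Fin n)) : Prop where
  isCount : G.IsCount X c
  isFlipSeq : G.IsFlipSeq top (G.orient X c) X l
  length_eq : (l.length : ℤ) = ∑ v, |c v|

theorem Reaches.nil (top : Fin n) : G.Reaches top X (fun _ => 0) [] :=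
  ⟨fun _ => Or.inl rfl, (orient_zero (G := G)).symm, by simp⟩

theorem Reaches.not {top : Fin n} {c : Fin n → ℤ} {l : List (Fin n)} (h : G.Reaches top X c l) :
    G.Reaches top (fun e => !X e) (fun v => -c v) l where
  isCount e := by
    have := h.isCount e
    obtain ⟨h₁, h₂⟩ := tail_not (G := G) (X := X) (Y := fun e => !X e) e rfl
    rw [h₁, h₂]
    change -c _ = -c _ ∨ -c _ = -c _ + 1
    omega
  isFlipSeq := by rw [orient_neg, isFlipSeq_not]; exact h.isFlipSeq
  length_eq := by simp [h.length_eq]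

/-- The numbers of flips after `j` complete rounds and a part of the next one, in which the
vertices of rank less than `r`, and those of rank `r` with number less than `k`, have had their
turn. The numbers at the beginning are `a`, and the vertex `v` is to be flipped `z v` times,
provided that this number is positive. -/
def partialCount (a z : Fin n → ℤ) (D : Fin n → ℕ) (j r k : ℕ) : Fin n → ℤ :=
  fun v => a v + min (max (z v) 0) (j + if D v < r ∨ D v = r ∧ (v : ℕ) < k then 1 else 0)

theorem partialCount_zero (a z : Fin n → ℤ) (D : Fin n → ℕ) : partialCount a z D 0 0 0 = a := by
  funext v; simp [partialCount]

/-- With the two lemmas that follow, this closes the three nested loops: over the vertices of a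
rank, over the ranks, and over the rounds. -/
theorem partialCount_vertices (a z : Fin n → ℤ) (D : Fin n → ℕ) (j r k : ℕ) (hk : n ≤ k) :
    partialCount a z D j r k = partialCount a z D j (r + 1) 0 := by
  funext v
  have : (v : ℕ) < k := by omega
  simp only [partialCount, this, and_true, not_lt_zero, and_false, or_false]
  congr 4
  exact propext (by omega)

theorem partialCount_ranks (a z : Fin n → ℤ) (D : Fin n → ℕ) (j r : ℕ) (hr : ∀ v, D v < r) :
    partialCount a z D j r 0 = partialCount a z D (j + 1) 0 0 := by
  funext v
  simp [partialCount, hr v]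

theorem partialCount_rounds (a z : Fin n → ℤ) (D : Fin n → ℕ) (j : ℕ) (hj : ∀ v, z v ≤ j) :
    partialCount a z D j 0 0 = fun v => a v + max (z v) 0 := by
  funext v
  have := hj v
  simp only [partialCount]
  split_ifs <;> omega

theorem partialCount_succ_of_not (a z : Fin n → ℤ) (D : Fin n → ℕ) (j r : ℕ) (k : ℕ)
    (hk : ∀ h : k < n, ¬ (D ⟨k, h⟩ = r ∧ (j : ℤ) < z ⟨k, h⟩)) :
    partialCount a z D j r (k + 1) = partialCount a z D j r k := by
  funext v
  simp only [partialCount]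
  by_cases hv : (v : ℕ) = k
  · have := hk (hv ▸ v.2)
    simp only [← hv, Fin.eta] at this
    split_ifs <;> omega
  · congr 4
    exact propext (by omega)

/-- The vertex whose turn it is has been flipped `j` times and is a source, by comparison of ranks
and potentials with its neighbours. Since `a` vanishes wherever `z` is nonnegative, flips made for
the other sign do not interfere with the vertex or its neighbours. -/
theorem Reaches.step {top : Fin n} {a z : Fin n → ℤ} {D : Fin n → ℕ} {j r : ℕ} {l : List (Fin n)}
    {v : Fin n} (hz : G.IsCount X z) (ha : ∀ v, 0 ≤ z v → a v = 0) (htop : z top = 0)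
    (hD : ∀ e, D (G.tail X e) < D (G.head X e)) (hr : D v = r) (hj : (j : ℤ) < z v)
    (h : G.Reaches top X (partialCount a z D j r v) l) :
    G.Reaches top X (partialCount a z D j r (v + 1)) (l ++ [v]) := by
  have hloop (e : E) : G.tail X e ≠ G.head X e := fun he => by
    have := hD e
    rw [he] at this
    omega
  have hv : partialCount a z D j r v v = j := by
    have := ha v (by omega)
    simp only [partialCount, this, hr]
    simp
    omega
  have e : partialCount a z D j r (v + 1) =
      Function.update (partialCount a z D j r v) v (partialCount a z D j r v v + 1) := by
    funext w
    by_cases hw : w = v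
    · subst hw
      rw [Function.update_self, hv]
      have := ha w (by omega)
      simp only [partialCount, this, hr]
      simp
      omega
    · rw [Function.update_of_ne hw]
      simp only [partialCount]
      have : (w : ℕ) ≠ v := fun h => hw (Fin.ext h)
      congr 4
      exact propext (by omega)
  obtain ⟨h₁, h₂, h₃⟩ := h.isCount.flip (v := v) hloop
    -- An out-neighbour has potential at least `z v - 1`, hence at least `j`, and larger rank: it
    -- has been flipped exactly `j` times.
    (fun e he => by
      have h₁ := hD e
      have h₂ := hz e
      rw [he] at h₁ h₂
      have h₃ := ha (G.head X e) (by omega)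
      rw [hv]
      simp only [partialCount, h₃]
      rw [if_neg (by omega)]
      omega)
    -- An in-neighbour has potential at least `z v`, hence more than `j`, and smaller rank: it has
    -- been flipped `j + 1` times.
    (fun e he => by
      have h₁ := hD e
      have h₂ := hz e
      rw [he] at h₁ h₂
      have h₃ := ha (G.tail X e) (by omega)
      rw [hv]
      simp only [partialCount, h₃]
      rw [if_pos (by omega)]
      omega)
  rw [e]
  refine ⟨h₁, h.isFlipSeq.append ⟨?_, Or.inl h₂, h₃⟩, ?_⟩
  · rintro rfl
    omega
  · rw [sum_abs_update_succ _ _ (by rw [hv]; omega), List.length_append, ← h.length_eq]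
    simp

theorem Reaches.isShortestFlipSeq (hG : G.Connected) {top : Fin n} {z : Fin n → ℤ}
    (hz : G.IsPotential X Y z) (htop : z top = 0) {l : List (Fin n)} (h : G.Reaches top X z l) :
    G.IsShortestFlipSeq top X Y l := by
  have h₁ := h.isFlipSeq
  rw [hz.orient_eq] at h₁
  refine ⟨h₁, fun l' hl' => ?_⟩
  have := hl'.sum_abs_le hG hz htop
  rw [← h.length_eq] at this
  exact_mod_cast this

end

end Multigraph

/-! ### Relaxation along an edge -/

section Relaxation

/-- Replace the value of `f` at `x` by `a` if this makes it larger. -/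
def raise (f : ℕ → ℕ) (x a : ℕ) : ℕ → ℕ := Function.update f x (max (f x) a)

variable {f ub : ℕ → ℕ} {x a n B : ℕ}

theorem le_raise (v : ℕ) : f v ≤ raise f x a v := by
  by_cases hv : v = x
  · subst hv; simp [raise]
  · simp [raise, hv]

theorem raise_le (h : ∀ v < B, f v ≤ ub v) (ha : a ≤ ub x) : ∀ v < B, raise f x a v ≤ ub v := by
  intro v hv
  by_cases hvx : v = x
  · subst hvx; simpa [raise] using ⟨h v hv, ha⟩
  · simpa [raise, hvx] using h v hv

theorem sum_le_sum_raise :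
    ∑ v ∈ Finset.range n, f v ≤ ∑ v ∈ Finset.range n, raise f x a v :=
  Finset.sum_le_sum fun v _ => le_raise v

theorem raise_eq_or (hx : x < n) : (raise f x a = f ∧ a ≤ f x) ∨
    ∑ v ∈ Finset.range n, f v < ∑ v ∈ Finset.range n, raise f x a v := by
  by_cases h : a ≤ f x
  · left
    rw [raise, max_eq_left h, Function.update_eq_self]
    exact ⟨rfl, h⟩
  · right
    exact Finset.sum_lt_sum (fun v _ => le_raise v)
      ⟨x, Finset.mem_range.2 hx, by simp [raise]; omega⟩

/-- The tentative potentials after the edge from `x` to `y` has been considered; `w` is `1` if this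
edge has to be reversed and `0` otherwise. -/
def relaxPotential (Z : ℕ → ℕ) (x y w : ℕ) : ℕ → ℕ :=
  raise (raise Z x (Z y + w)) y (raise Z x (Z y + w) x - w)

/-- The tentative ranks after the edge from `x` to `y` has been considered. -/
def relaxRank (D : ℕ → ℕ) (x y : ℕ) : ℕ → ℕ := raise D y (D x + 1)

variable {Z D : ℕ → ℕ} {y w : ℕ}

/-- Each of the three calls of `raise` either leaves its function alone, which gives an inequality,
or increases a sum. If all are idle, `Z y + w ≤ Z x` and `Z x - w ≤ Z y` combine to an equation. -/
theorem relax_eq_or (hx : x < n) (hy : y < n) :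
    (relaxPotential Z x y w = Z ∧ relaxRank D x y = D ∧ Z x = Z y + w ∧ D x < D y) ∨
      ∑ v ∈ Finset.range n, Z v + ∑ v ∈ Finset.range n, D v <
        ∑ v ∈ Finset.range n, relaxPotential Z x y w v +
          ∑ v ∈ Finset.range n, relaxRank D x y v := by
  have h₁ := raise_eq_or (f := Z) (a := Z y + w) hx
  have h₂ := raise_eq_or (f := raise Z x (Z y + w)) (a := raise Z x (Z y + w) x - w) hy
  have h₃ := raise_eq_or (f := D) (a := D x + 1) hy
  have h₄ := sum_le_sum_raise (f := Z) (x := x) (a := Z y + w) (n := n)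
  have h₅ := sum_le_sum_raise (f := raise Z x (Z y + w)) (x := y)
    (a := raise Z x (Z y + w) x - w) (n := n)
  have h₆ := sum_le_sum_raise (f := D) (x := y) (a := D x + 1) (n := n)
  simp only [relaxPotential, relaxRank]
  rcases h₁ with ⟨e₁, h₁⟩ | h₁
  · rcases h₂ with ⟨e₂, h₂⟩ | h₂
    · rcases h₃ with ⟨e₃, h₃⟩ | h₃
      · left
        rw [e₁] at e₂ h₂ ⊢
        exact ⟨e₂, e₃, by omega, h₃⟩
      · right; omega
    · right; omega
  · right; omega

/-- An upper bound that satisfies the equation of the edge is never exceeded, as each new value is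
transported along that equation. -/
theorem relaxPotential_le (h : ∀ v < B, Z v ≤ ub v) (hx : x < B) (hy : y < B)
    (hxy : ub x = ub y + w) : ∀ v < B, relaxPotential Z x y w v ≤ ub v := by
  have h₁ := raise_le (x := x) (a := Z y + w) h (by have := h y hy; omega)
  exact raise_le h₁ (by have := h₁ x hx; omega)

theorem relaxRank_le (h : ∀ v < B, D v ≤ ub v) (hx : x < B) (hxy : ub x < ub y) :
    ∀ v < B, relaxRank D x y v ≤ ub v :=
  raise_le h (by have := h x hx; omega)

end Relaxation

end VertexFlip

/-! ### The subroutines of the algorithm -/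

namespace VertexFlip

open StackProgram StackProgram.Prog Function

/-- The registers of the algorithm. -/
inductive Reg
  | n | top | q | i | r | v | x | y | a | b | t | w | p | f
  deriving DecidableEq

instance : Fintype Reg :=
  .ofList [.n, .top, .q, .i, .r, .v, .x, .y, .a, .b, .t, .w, .p, .f] (by intro z; cases z <;> decide)

/-- The arrays of the algorithm: the tails and heads of the edges, their kinds (`1` if the two
orientations agree, `2` if they differ, `0` if there is no edge), and, for the vertices, tentative
potentials and ranks. -/
inductive Arr
  | T | H | W | Z | D
  deriving DecidableEq

instance : Fintype Arr := .ofList [.T, .H, .W, .Z, .D] (by intro z; cases z <;> decide)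

/-- Programs of the algorithm. -/
abbrev Program := Prog Reg Arr

/-- Execution of a list of programs. -/
def seqs : List Program → Program
  | [] => .skip
  | p :: l => .seq p (seqs l)

variable {B : ℕ} {s : Mem Reg Arr}

theorem run_seqs_nil : (seqs []).run B s = s := rfl

theorem run_seqs_cons (p : Program) (l : List Program) :
    (seqs (p :: l)).run B s = (seqs l).run B (p.run B s) := rfl

theorem iterate_induction {σ : Type*} {f : σ → σ} {s : σ} (P : ℕ → σ → Prop) (h : P 0 s) {k : ℕ}
    (step : ∀ j < k, ∀ t, P j t → P (j + 1) (f t)) : P k (f^[k] s) := by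
  induction k with
  | zero => exact h
  | succ k ih =>
    rw [iterate_succ_apply']
    exact step k (Nat.lt_succ_self k) _ (ih fun j hj => step j (by omega))

/-- Add the register `p` to the register `d`. -/
def addTo (d : Reg) : Program :=
  seqs [.cpy .t .p, .rep (.ifz .t .skip (seqs [.dec .t, .inc d]))]

/-- The loop has exactly `B` iterations, of which those after the first `p` are idle. As the summand
is copied to `t` beforehand, `d` may be `p` itself, which is how `p` gets doubled. -/
theorem run_addTo (d : Reg) (hd : d ≠ .t) (hs : s.reg .p ≤ B) :
    (addTo d).run B s =
      { s with reg := update (update s.reg .t 0) d (s.reg d + s.reg .p) } := by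
  have h := iterate_induction (σ := Mem Reg Arr)
    (f := (Prog.ifz .t .skip (seqs [.dec .t, .inc d])).run B)
    (s := { s with reg := update s.reg .t (s.reg .p) })
    (fun k t => t =
      { s with reg := update (update s.reg .t (s.reg .p - k)) d (s.reg d + min k (s.reg .p)) })
    (k := B)
    (by
      congr 1
      funext z
      by_cases hz : z = d
      · subst hz; simp [hd]
      · simp [hz])
    (fun j _ t ht => by
      subst ht
      by_cases hj : s.reg .p ≤ j
      · rw [Prog.run, if_pos (by simp [Ne.symm hd]; omega)]
        simp only [Prog.run]
        congr 1
        rw [min_eq_right hj, min_eq_right (by omega), Nat.sub_eq_zero_of_le hj,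
          Nat.sub_eq_zero_of_le (by omega)]
      · rw [Prog.run, if_neg (by simp [Ne.symm hd]; omega)]
        simp only [run_seqs_cons, run_seqs_nil, Prog.run]
        congr 1
        funext z
        by_cases hz : z = d
        · subst hz; simp [hd]; omega
        · by_cases hz' : z = .t
          · subst hz'; simp [Ne.symm hd]; omega
          · simp [hz, hz'])
  refine h.trans ?_
  simp [hs]

/-- Read one symbol of a number, adding its contribution to the register `d`. -/
def readBit (d : Reg) : Program :=
  .ifz .f (.read (.inc .f) (.inc .f) (addTo .p) (seqs [addTo d, addTo .p])) .skip

/-- Read a number into the register `d`. -/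
def readNumber (d : Reg) : Program :=
  seqs [.clr d, .clr .p, .inc .p, .clr .f, .rep (readBit d)]

theorem iterate_readBit_of_ne {d : Reg} (hf : s.reg .f ≠ 0) (k : ℕ) :
    ((readBit d).run B)^[k] s = s := by
  refine Function.iterate_fixed ?_ k
  rw [readBit, Prog.run, if_neg hf]
  rfl

theorem encodePosNum_eq (p : PosNum) :
    encodePosNum p = ((p : ℕ) % 2 == 1) :: encodeNat ((p : ℕ) / 2) := by
  cases p with
  | one => rfl
  | bit0 p =>
    have h : ((PosNum.bit0 p : PosNum) : ℕ) = 2 * p := by rw [PosNum.cast_bit0]; ring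
    rw [h, Nat.mul_mod_right, Nat.mul_div_cancel_left _ (by norm_num), encodePosNum, encodeNat,
      PosNum.of_to_nat]
    rfl
  | bit1 p =>
    have h : ((PosNum.bit1 p : PosNum) : ℕ) = 2 * p + 1 := by rw [PosNum.cast_bit1]; ring
    rw [h, show (2 * (p : ℕ) + 1) % 2 = 1 by omega, show (2 * (p : ℕ) + 1) / 2 = p by omega,
      encodePosNum, encodeNat, PosNum.of_to_nat]
    rfl

theorem encodeNat_eq {k : ℕ} (hk : k ≠ 0) : encodeNat k = (k % 2 == 1) :: encodeNat (k / 2) := by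
  have h := Num.to_of_nat k
  rw [encodeNat]
  rcases hn : (k : Num) with _ | p
  · rw [hn] at h; exact absurd h.symm hk
  · rw [hn] at h
    have : (p : ℕ) = k := h
    rw [encodeNum, encodePosNum_eq, this]

theorem encodeNumber_zero : encodeNumber 0 = [none] := rfl

theorem encodeNumber_eq {k : ℕ} (hk : k ≠ 0) :
    encodeNumber k = some (k % 2 == 1) :: encodeNumber (k / 2) := by
  rw [encodeNumber, encodeNat_eq hk]
  rfl

theorem length_encodeNumber_pos (k : ℕ) : 1 ≤ (encodeNumber k).length := by
  simp [encodeNumber]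

/-- Digits come with the least significant one first, and `p` holds the current place value. The
quantity `p * k` bounds what is still to be added, so all additions stay within `B`. The end marker
sets `f`, after which the iterations are idle. -/
theorem iterate_readBit {d : Reg} (hp : d ≠ .p) (hf : d ≠ .f) (ht : d ≠ .t) (k : ℕ)
    {rest : List Sym} {N : ℕ} (hm : (encodeNumber k).length ≤ N)
    (hi : s.inp = encodeNumber k ++ rest) (hs : s.reg .f = 0) (hB : s.reg .p * k ≤ B) :
    ∃ r', ((readBit d).run B)^[N] s = { s with inp := rest, reg := r' } ∧
      r' d = s.reg d + s.reg .p * k ∧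
      ∀ z, z ≠ d → z ≠ .p → z ≠ .f → z ≠ .t → r' z = s.reg z := by
  induction k using Nat.strong_induction_on generalizing s N with
  | _ k ih =>
  obtain ⟨N, rfl⟩ : ∃ N', N = N' + 1 :=
    ⟨N - 1, by have := length_encodeNumber_pos k; omega⟩
  rw [iterate_succ_apply]
  rcases Nat.eq_zero_or_pos k with rfl | hk
  · rw [encodeNumber_zero] at hi
    have e : (readBit d).run B s = { s with inp := rest, reg := update s.reg .f 1 } := by
      simp [readBit, Prog.run, hs, hi]
    rw [e, iterate_readBit_of_ne (by simp)]
    exact ⟨_, rfl, by simp [hf], fun z _ _ h _ => by simp [h]⟩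
  · rw [encodeNumber_eq hk.ne'] at hi hm
    rw [List.length_cons] at hm
    have hpB : s.reg .p ≤ B := (Nat.le_mul_of_pos_right _ hk).trans hB
    rcases Nat.mod_two_eq_zero_or_one k with hk2 | hk2
    · have e : (readBit d).run B s =
          { s with inp := encodeNumber (k / 2) ++ rest,
                   reg := update (update s.reg .t 0) .p (s.reg .p + s.reg .p) } := by
        simp only [readBit, Prog.run, hs, hi, hk2, if_true, List.cons_append]
        exact run_addTo .p (by decide) hpB
      rw [e]
      have hkk : s.reg .p * k = (s.reg .p + s.reg .p) * (k / 2) := by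
        conv_lhs => rw [show k = 2 * (k / 2) by omega]
        ring
      obtain ⟨r', h₁, h₂, h₃⟩ := ih (k / 2) (by omega)
        (s := { s with inp := encodeNumber (k / 2) ++ rest,
                       reg := update (update s.reg .t 0) .p (s.reg .p + s.reg .p) })
        (N := N) (by omega) rfl (by simpa using hs) (by simpa [← hkk] using hB)
      refine ⟨r', h₁, ?_, fun z hz hz₁ hz₂ hz₃ => ?_⟩
      · rw [h₂, hkk]; simp [hp, ht]
      · rw [h₃ z hz hz₁ hz₂ hz₃]; simp [hz₁, hz₃]
    · have e : (readBit d).run B s =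
          { s with inp := encodeNumber (k / 2) ++ rest,
                   reg := update (update (update (update s.reg .t 0) d (s.reg d + s.reg .p)) .t 0)
                     .p (s.reg .p + s.reg .p) } := by
        simp only [readBit, Prog.run, hs, hi, hk2, if_true, List.cons_append]
        change (addTo .p).run B ((addTo d).run B { s with inp := encodeNumber (k / 2) ++ rest }) = _
        rw [run_addTo (s := { s with inp := encodeNumber (k / 2) ++ rest }) d ht hpB,
          run_addTo .p (by decide) (by simpa [Ne.symm hp] using hpB)]
        simp [Ne.symm hp]
      rw [e]
      have hkk : s.reg .p * k = s.reg .p + (s.reg .p + s.reg .p) * (k / 2) := by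
        conv_lhs => rw [show k = 2 * (k / 2) + 1 by omega]
        ring
      obtain ⟨r', h₁, h₂, h₃⟩ := ih (k / 2) (by omega)
        (s := { s with inp := encodeNumber (k / 2) ++ rest,
                       reg := update (update (update (update s.reg .t 0) d
                         (s.reg d + s.reg .p)) .t 0) .p (s.reg .p + s.reg .p) })
        (N := N) (by omega) rfl (by simpa [Ne.symm hf] using hs)
        (by simp only [update_self]; omega)
      refine ⟨r', h₁, ?_, fun z hz hz₁ hz₂ hz₃ => ?_⟩
      · rw [h₂, hkk]; simp [hp, ht]; ring
      · rw [h₃ z hz hz₁ hz₂ hz₃]; simp [hz₁, hz₃, hz]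

theorem run_readNumber {d : Reg} (hp : d ≠ .p) (hf : d ≠ .f) (ht : d ≠ .t) (k : ℕ)
    {rest : List Sym} (hi : s.inp = encodeNumber k ++ rest) (hk : k ≤ B)
    (hB : s.inp.length ≤ B) :
    ∃ r', (readNumber d).run B s = { s with inp := rest, reg := r' } ∧ r' d = k ∧
      ∀ z, z ≠ d → z ≠ .p → z ≠ .f → z ≠ .t → r' z = s.reg z := by
  simp only [readNumber, run_seqs_cons, run_seqs_nil, Prog.run]
  obtain ⟨r', h₁, h₂, h₃⟩ := iterate_readBit hp hf ht k (rest := rest) (N := B) (B := B)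
    (s := { s with reg := update (update (update (update s.reg d 0) .p 0) .p
      (update (update s.reg d 0) .p 0 .p + 1)) .f 0 })
    (by rw [hi] at hB; simp at hB; omega) hi (by simp) (by simpa using hk)
  refine ⟨r', h₁, ?_, fun z hz hz₁ hz₂ hz₃ => ?_⟩
  · rw [h₂]; simp [hp, hf]
  · rw [h₃ z hz hz₁ hz₂ hz₃]; simp [hz, hz₁, hz₂]

/-- The loop over the edges runs `B` times, so reading is also attempted at the end of the input;
only scratch registers and `d` may then change. -/
theorem run_readNumber_nil {d : Reg} (hi : s.inp = []) :
    ∃ r', (readNumber d).run B s = { s with reg := r' } ∧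
      ∀ z, z ≠ d → z ≠ .p → z ≠ .f → z ≠ .t → r' z = s.reg z := by
  simp only [readNumber, run_seqs_cons, run_seqs_nil, Prog.run]
  rcases B with _ | B
  · exact ⟨_, rfl, fun z hz hz₁ hz₂ hz₃ => by simp [hz, hz₁, hz₂]⟩
  · rw [iterate_succ_apply]
    have e (r : Reg → ℕ) : (readBit d).run (B + 1) { s with reg := update r .f 0 } =
        { s with reg := update r .f 1 } := by
      simp [readBit, Prog.run, hi]
    rw [e, iterate_readBit_of_ne (by simp)]
    exact ⟨_, rfl, fun z hz hz₁ hz₂ hz₃ => by simp [hz, hz₁, hz₂]⟩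

/-- Record an edge with the given tail and head. -/
def putEdge (k l : Reg) (b : Bool) : Program :=
  seqs [.store .T .i k, .store .H .i l, .clr .w, .inc .w, bif b then .inc .w else .skip,
    .store .W .i .w, .inc .i]

/-- Read an edge and record it. -/
def readEdge : Program :=
  seqs [readNumber .x, readNumber .y, .read .skip .skip
    (.read .skip .skip (putEdge .y .x false) (putEdge .y .x true))
    (.read .skip .skip (putEdge .x .y true) (putEdge .x .y false))]

/-- The arrays after an edge with tail `k`, head `l` and kind `w` has been recorded. -/
def putArr (arr : Arr → ℕ → ℕ) (i k l w : ℕ) : Arr → ℕ → ℕ :=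
  update (update (update arr .T (update (arr .T) i k)) .H (update (arr .H) i l)) .W
    (update (arr .W) i w)

theorem run_putEdge (k l : Reg) (b : Bool) (hk : k = .x ∨ k = .y) (hl : l = .x ∨ l = .y) :
    ∃ r', (putEdge k l b).run B s =
      { s with
        reg := r'
        arr := putArr s.arr (s.reg .i) (s.reg k) (s.reg l) (bif b then 2 else 1) } ∧
      r' .i = s.reg .i + 1 ∧ r' .n = s.reg .n ∧ r' .top = s.reg .top := by
  cases b <;> rcases hk with rfl | rfl <;> rcases hl with rfl | rfl <;>
    simp [putEdge, putArr, run_seqs_cons, run_seqs_nil, Prog.run]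

theorem run_readEdge {u v : ℕ} {a b : Bool} {rest : List Sym}
    (hi : s.inp = encodeNumber u ++ (encodeNumber v ++ some a :: some b :: rest))
    (hB : s.inp.length ≤ B) (hu : u ≤ B) (hv : v ≤ B) :
    ∃ r', readEdge.run B s =
      { s with
        inp := rest
        reg := r'
        arr := putArr s.arr (s.reg .i) (bif a then u else v) (bif a then v else u)
          (if a = b then 1 else 2) } ∧
      r' .i = s.reg .i + 1 ∧ r' .n = s.reg .n ∧ r' .top = s.reg .top := by
  rw [readEdge, run_seqs_cons]
  obtain ⟨r₁, h₁, hx, hr₁⟩ := run_readNumber (d := .x) (by decide) (by decide) (by decide) u hi hu hB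
  rw [h₁, run_seqs_cons]
  obtain ⟨r₂, h₂, hy, hr₂⟩ := run_readNumber (d := .y) (by decide) (by decide) (by decide) v
    (s := { s with inp := encodeNumber v ++ some a :: some b :: rest, reg := r₁ }) rfl hv
    (by rw [hi] at hB; simp at hB ⊢; omega)
  have hx' : r₂ .x = u := (hr₂ .x (by decide) (by decide) (by decide) (by decide)).trans hx
  have hr (z : Reg) (h₁ : z ≠ .x) (h₂ : z ≠ .y) (h₃ : z ≠ .p) (h₄ : z ≠ .f) (h₅ : z ≠ .t) :
      r₂ z = s.reg z := (hr₂ z h₂ h₃ h₄ h₅).trans (hr₁ z h₁ h₃ h₄ h₅)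
  rw [h₂, run_seqs_cons, run_seqs_nil]
  have e₁ := hr .i (by decide) (by decide) (by decide) (by decide) (by decide)
  have e₂ := hr .n (by decide) (by decide) (by decide) (by decide) (by decide)
  have e₃ := hr .top (by decide) (by decide) (by decide) (by decide) (by decide)
  cases a <;> cases b <;> simp only [Prog.run]
  · simpa [e₁, e₂, e₃, hx', hy] using run_putEdge .y .x false (Or.inr rfl) (Or.inl rfl)
      (B := B) (s := ⟨r₂, s.arr, rest, s.out⟩)
  · simpa [e₁, e₂, e₃, hx', hy] using run_putEdge .y .x true (Or.inr rfl) (Or.inl rfl)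
      (B := B) (s := ⟨r₂, s.arr, rest, s.out⟩)
  · simpa [e₁, e₂, e₃, hx', hy] using run_putEdge .x .y true (Or.inl rfl) (Or.inr rfl)
      (B := B) (s := ⟨r₂, s.arr, rest, s.out⟩)
  · simpa [e₁, e₂, e₃, hx', hy] using run_putEdge .x .y false (Or.inl rfl) (Or.inr rfl)
      (B := B) (s := ⟨r₂, s.arr, rest, s.out⟩)

theorem run_readEdge_nil (hi : s.inp = []) :
    ∃ r', readEdge.run B s = { s with reg := r' } ∧
      r' .i = s.reg .i ∧ r' .n = s.reg .n ∧ r' .top = s.reg .top := by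
  rw [readEdge, run_seqs_cons]
  obtain ⟨r₁, h₁, hr₁⟩ := run_readNumber_nil (d := .x) hi (B := B)
  rw [h₁, run_seqs_cons]
  obtain ⟨r₂, h₂, hr₂⟩ := run_readNumber_nil (d := .y) (s := { s with reg := r₁ }) hi (B := B)
  have hr (z : Reg) (h₁ : z ≠ .x) (h₂ : z ≠ .y) (h₃ : z ≠ .p) (h₄ : z ≠ .f) (h₅ : z ≠ .t) :
      r₂ z = s.reg z := (hr₂ z h₂ h₃ h₄ h₅).trans (hr₁ z h₁ h₃ h₄ h₅)
  rw [h₂, run_seqs_cons, run_seqs_nil]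
  refine ⟨r₂, ?_, ?_, ?_, ?_⟩
  · simp [Prog.run, hi]
  all_goals exact hr _ (by decide) (by decide) (by decide) (by decide) (by decide)

/-- Set the entry of `A` at `k` to `a` if this makes it larger. -/
def raiseEntry (A : Arr) (k : Reg) : Program :=
  seqs [.load .b A k, .cpy .t .a, .sub .t .b, .ifz .t .skip (.store A k .a)]

theorem run_raiseEntry (A : Arr) (k : Reg) (hk : k = .x ∨ k = .y) (hB : s.reg k < B) :
    (raiseEntry A k).run B s =
      { s with
        reg := update (update s.reg .b (s.arr A (s.reg k))) .t (s.reg .a - s.arr A (s.reg k))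
        arr := update s.arr A (raise (s.arr A) (s.reg k) (s.reg .a)) } := by
  have hkb : k ≠ .b := by rcases hk with rfl | rfl <;> decide
  have hkt : k ≠ .t := by rcases hk with rfl | rfl <;> decide
  simp only [raiseEntry, run_seqs_cons, run_seqs_nil, Prog.run, if_pos hB]
  by_cases h : s.reg .a ≤ s.arr A (s.reg k)
  · rw [if_pos (by simp; omega)]
    simp only [raise, max_eq_left h, update_eq_self]
    simp
  · rw [if_neg (by simp; omega)]
    simp [raise, max_eq_right (le_of_not_ge h), hkb, hkt]

/-- Update the tentative potentials and ranks according to the edge with number `i`. -/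
def relaxEdge (A₁ A₂ : Arr) : Program :=
  seqs [.load .w .W .i, .ifz .w .skip (seqs [.dec .w, .load .x A₁ .i, .load .y A₂ .i,
    .load .a .Z .y, .ifz .w .skip (.inc .a), raiseEntry .Z .x,
    .load .a .Z .x, .ifz .w .skip (.dec .a), raiseEntry .Z .y,
    .load .a .D .x, .inc .a, raiseEntry .D .y]), .inc .i]

/-- Kinds are shifted by one so that `0` can mark the numbers beyond the last edge, which are
skipped. -/
theorem run_relaxEdge (A₁ A₂ : Arr) (hi : s.reg .i < B) (hx : s.arr A₁ (s.reg .i) < B)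
    (hy : s.arr A₂ (s.reg .i) < B) (hw : s.arr .W (s.reg .i) ≤ 2) :
    ∃ r', (relaxEdge A₁ A₂).run B s =
      { s with
        reg := r'
        arr := if s.arr .W (s.reg .i) = 0 then s.arr else update (update s.arr
          .Z (relaxPotential (s.arr .Z) (s.arr A₁ (s.reg .i)) (s.arr A₂ (s.reg .i))
            (s.arr .W (s.reg .i) - 1)))
          .D (relaxRank (s.arr .D) (s.arr A₁ (s.reg .i)) (s.arr A₂ (s.reg .i))) } ∧
      r' .i = s.reg .i + 1 ∧ r' .n = s.reg .n ∧ r' .top = s.reg .top := by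
  obtain h | h | h : s.arr .W (s.reg .i) = 0 ∨ s.arr .W (s.reg .i) = 1 ∨
    s.arr .W (s.reg .i) = 2 := by omega
  · simp [relaxEdge, run_seqs_cons, run_seqs_nil, Prog.run, h, hi]
  · simp [relaxEdge, run_seqs_cons, run_seqs_nil, Prog.run, h, hi, run_raiseEntry, hx, hy,
      relaxPotential, relaxRank]
  · simp [relaxEdge, run_seqs_cons, run_seqs_nil, Prog.run, h, hi, run_raiseEntry, hx, hy,
      relaxPotential, relaxRank]

/-- Compute half of `x` and its last binary digit. -/
def halve : Program :=
  seqs [.clr .y, .clr .t, .rep (.ifz .x .skip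
    (seqs [.dec .x, .ifz .t (.inc .t) (seqs [.dec .t, .inc .y])]))]

theorem run_halve (hB : s.reg .x ≤ B) :
    halve.run B s =
      { s with reg := update (update (update s.reg .y (s.reg .x / 2)) .t (s.reg .x % 2)) .x 0 } := by
  have h := iterate_induction (σ := Mem Reg Arr)
    (f := (Prog.ifz .x .skip (seqs [.dec .x, .ifz .t (.inc .t) (seqs [.dec .t, .inc .y])])).run B)
    (s := { s with reg := update (update s.reg .y 0) .t 0 })
    (fun k t => t =
      { s with
        reg := update (update (update s.reg .y (min k (s.reg .x) / 2)) .t (min k (s.reg .x) % 2)) .x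
          (s.reg .x - k) })
    (k := B)
    (by
      congr 1
      funext z
      by_cases hz : z = .x
      · subst hz; simp
      · simp [hz])
    (fun j _ _ ht => by
      subst ht
      by_cases hj : s.reg .x ≤ j
      · have e₁ : s.reg .x - j = 0 := by omega
        have e₂ : s.reg .x - (j + 1) = 0 := by omega
        have e₃ : min j (s.reg .x) = s.reg .x := by omega
        have e₄ : min (j + 1) (s.reg .x) = s.reg .x := by omega
        simp [Prog.run, e₁, e₂, e₃, e₄]
      · have e₁ : s.reg .x - j ≠ 0 := by omega
        have e₂ : s.reg .x - j - 1 = s.reg .x - (j + 1) := by omega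
        have e₃ : min j (s.reg .x) = j := by omega
        have e₄ : min (j + 1) (s.reg .x) = j + 1 := by omega
        rcases Nat.mod_two_eq_zero_or_one j with h | h
        · have e₅ : (j + 1) / 2 = j / 2 := by omega
          have e₆ : (j + 1) % 2 = 1 := by omega
          simp only [Prog.run, run_seqs_cons, run_seqs_nil, e₃, e₄, h, e₅, e₆]
          simp [e₁]
          funext z
          cases z <;> simp [e₂]
        · have e₅ : (j + 1) / 2 = j / 2 + 1 := by omega
          have e₆ : (j + 1) % 2 = 0 := by omega
          simp only [Prog.run, run_seqs_cons, run_seqs_nil, e₃, e₄, h, e₅, e₆]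
          simp [e₁]
          funext z
          cases z <;> simp [e₂])
  refine h.trans ?_
  simp [hB]

/-- Write the binary digits of `v`. -/
def emitNumber : Program :=
  seqs [.cpy .x .v, .rep (.ifz .x .skip
    (seqs [halve, .ifz .t (.emit (some false)) (.emit (some true)), .cpy .x .y])), .emit none]

theorem iterate_emitDigit (k : ℕ) (hk : s.reg .x = k) (hB : k ≤ B) (N : ℕ) (hN : k ≤ N) :
    ∃ r', ((Prog.ifz .x .skip (seqs [halve, .ifz .t (.emit (some false)) (.emit (some true)),
        .cpy .x .y]) : Program).run B)^[N] s =
      { s with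
        reg := r'
        out := s.out ++ (encodeNat k).map some } ∧
      ∀ z, z ≠ .x → z ≠ .y → z ≠ .t → r' z = s.reg z := by
  induction k using Nat.strong_induction_on generalizing s N with
  | _ k ih =>
  rcases Nat.eq_zero_or_pos k with rfl | hk₀
  · rw [Function.iterate_fixed (by rw [Prog.run, if_pos hk]; rfl)]
    exact ⟨s.reg, by simp [encodeNat, encodeNum], fun _ _ _ _ => rfl⟩
  · obtain ⟨N, rfl⟩ : ∃ N', N = N' + 1 := ⟨N - 1, by omega⟩
    rw [iterate_succ_apply]
    have e : (Prog.ifz .x .skip (seqs [halve, .ifz .t (.emit (some false)) (.emit (some true)),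
        .cpy .x .y]) : Program).run B s =
        { s with
          reg := update (update (update s.reg .y (k / 2)) .t (k % 2)) .x (k / 2)
          out := s.out ++ [some (k % 2 == 1)] } := by
      rw [Prog.run, if_neg (by omega), run_seqs_cons, run_halve (by omega), hk]
      rcases Nat.mod_two_eq_zero_or_one k with h | h <;>
        simp [run_seqs_cons, run_seqs_nil, Prog.run, h]
    rw [e]
    obtain ⟨r', h₁, h₂⟩ := ih (k / 2) (by omega)
      (s := { s with
        reg := update (update (update s.reg .y (k / 2)) .t (k % 2)) .x (k / 2)
        out := s.out ++ [some (k % 2 == 1)] }) (by simp) (by omega) N (by omega)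
    refine ⟨r', ?_, fun z hz₁ hz₂ hz₃ => ?_⟩
    · rw [h₁, encodeNat_eq hk₀.ne']; simp
    · rw [h₂ z hz₁ hz₂ hz₃]; simp [hz₁, hz₂, hz₃]

theorem run_emitNumber (hB : s.reg .v ≤ B) :
    ∃ r', emitNumber.run B s =
      { s with
        reg := r'
        out := s.out ++ encodeNumber (s.reg .v) } ∧
      ∀ z, z ≠ .x → z ≠ .y → z ≠ .t → r' z = s.reg z := by
  obtain ⟨r', h₁, h₂⟩ := iterate_emitDigit (B := B)
    (s := { s with reg := update s.reg .x (s.reg .v) }) (s.reg .v) (by simp) hB B hB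
  refine ⟨r', ?_, fun z hz₁ hz₂ hz₃ => ?_⟩
  · rw [emitNumber, run_seqs_cons, run_seqs_cons, run_seqs_cons, run_seqs_nil]
    change (Prog.emit none : Program).run B (_ ^[B] _) = _
    erw [h₁]
    simp [Prog.run, encodeNumber]
  · rw [h₂ z hz₁ hz₂ hz₃]; simp [hz₁]

/-- Write the number `v` if the vertex with this number is to be flipped. -/
def emitVertex : Program :=
  seqs [.load .a .D .v, .cpy .t .a, .sub .t .r, .ifz .t (seqs [.cpy .t .r, .sub .t .a,
    .ifz .t (seqs [.load .a .Z .v, .sub .a .q, .ifz .a .skip emitNumber]) .skip]) .skip, .inc .v]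

/-- Equality of rank and `r` is tested by two truncated differences, and `q < Z v` by a third one.
-/
theorem run_emitVertex (hB : s.reg .v < B) :
    ∃ r', emitVertex.run B s =
      { s with
        reg := r'
        out := s.out ++ if s.arr .D (s.reg .v) = s.reg .r ∧ s.reg .q < s.arr .Z (s.reg .v) then
          encodeNumber (s.reg .v) else [] } ∧
      r' .v = s.reg .v + 1 ∧ r' .n = s.reg .n ∧ r' .top = s.reg .top ∧ r' .q = s.reg .q ∧
        r' .r = s.reg .r := by
  simp only [emitVertex, run_seqs_cons, run_seqs_nil, Prog.run, if_pos hB]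
  rcases lt_trichotomy (s.arr .D (s.reg .v)) (s.reg .r) with h | h | h
  · have h₁ : s.arr .D (s.reg .v) - s.reg .r = 0 := by omega
    have h₂ : s.reg .r - s.arr .D (s.reg .v) ≠ 0 := by omega
    simp [h₁, h₂, h.ne]
  · by_cases h' : s.reg .q < s.arr .Z (s.reg .v)
    · have h₁ : s.arr .Z (s.reg .v) - s.reg .q ≠ 0 := by omega
      obtain ⟨r', e₁, e₂⟩ := run_emitNumber (B := B)
        (s := { s with
          reg := update (update (update s.reg .a (s.reg .r)) .t 0) .a
            (s.arr .Z (s.reg .v) - s.reg .q) })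
        (by simpa using hB.le)
      have hr (z : Reg) (hz : z = .n ∨ z = .top ∨ z = .q ∨ z = .r ∨ z = .v) : r' z = s.reg z := by
        rcases hz with rfl | rfl | rfl | rfl | rfl <;>
          exact (e₂ _ (by decide) (by decide) (by decide)).trans (by simp)
      refine ⟨update r' .v (r' .v + 1), ?_, ?_⟩
      · simp [h, h', h₁, hB] at e₁ ⊢
        simp [e₁]
      · simp [hr]
    · have h₁ : s.arr .Z (s.reg .v) - s.reg .q = 0 := by omega
      simp [h, h', h₁, hB]
  · have h₁ : s.arr .D (s.reg .v) - s.reg .r ≠ 0 := by omega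
    simp [h₁, h.ne']

end VertexFlip

/-! ### Computing the potential and a ranking, and writing the flips -/

namespace VertexFlip

open StackProgram StackProgram.Prog Multigraph Function

variable {B n m : ℕ} {s t u : Mem Reg Arr} {G : Multigraph (Fin n) (Fin m)} {top : Fin n}
  {X Y : Orientation (Fin m)} {A₁ A₂ : Arr}

/-- The graph with the given pair of orientations is stored in the memory: the tails and heads of
the edges in the arrays `A₁` and `A₂`, their kinds in the array `W`. -/
structure Loaded (G : Multigraph (Fin n) (Fin m)) (top : Fin n) (X Y : Orientation (Fin m))
    (A₁ A₂ : Arr) (s : Mem Reg Arr) : Prop where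
  n_eq : s.reg .n = n
  top_eq : s.reg .top = top
  tail_eq : ∀ e : Fin m, s.arr A₁ e = G.tail X e
  head_eq : ∀ e : Fin m, s.arr A₂ e = G.head X e
  kind_eq : ∀ e : Fin m, s.arr .W e = if X e = Y e then 1 else 2
  tail_lt : ∀ k, s.arr A₁ k < n
  head_lt : ∀ k, s.arr A₂ k < n
  kind_eq_zero : ∀ k, m ≤ k → s.arr .W k = 0

/-- The size of the graph, the vertex `top` and all arrays except for the tentative potentials and
ranks are the same in both memories, and so is the output. -/
structure Keeps (s t : Mem Reg Arr) : Prop where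
  n_eq : t.reg .n = s.reg .n
  top_eq : t.reg .top = s.reg .top
  arr_eq : ∀ A, A ≠ .Z → A ≠ .D → t.arr A = s.arr A
  out_eq : t.out = s.out

theorem Keeps.trans (h : Keeps s t) (h' : Keeps t u) : Keeps s u :=
  ⟨h'.n_eq.trans h.n_eq, h'.top_eq.trans h.top_eq,
    fun A hZ hD => (h'.arr_eq A hZ hD).trans (h.arr_eq A hZ hD), h'.out_eq.trans h.out_eq⟩

theorem Loaded.congr (h : Loaded G top X Y A₁ A₂ s) (hn : t.reg .n = s.reg .n)
    (htop : t.reg .top = s.reg .top) (h₁ : t.arr A₁ = s.arr A₁) (h₂ : t.arr A₂ = s.arr A₂)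
    (hW : t.arr .W = s.arr .W) : Loaded G top X Y A₁ A₂ t where
  n_eq := hn.trans h.n_eq
  top_eq := htop.trans h.top_eq
  tail_eq := by rw [h₁]; exact h.tail_eq
  head_eq := by rw [h₂]; exact h.head_eq
  kind_eq := by rw [hW]; exact h.kind_eq
  tail_lt := by rw [h₁]; exact h.tail_lt
  head_lt := by rw [h₂]; exact h.head_lt
  kind_eq_zero := by rw [hW]; exact h.kind_eq_zero

/-- Exchanging the arrays of tails and heads reverses both orientations, so the same program serves
for the flips of sinks. -/
theorem Loaded.not (h : Loaded G top X Y A₁ A₂ s) :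
    Loaded G top (fun e => !X e) (fun e => !Y e) A₂ A₁ s where
  n_eq := h.n_eq
  top_eq := h.top_eq
  tail_eq e := by rw [h.head_eq, (tail_not (X := X) e rfl).1]
  head_eq e := by rw [h.tail_eq, (tail_not (X := X) e rfl).2]
  kind_eq e := by rw [h.kind_eq]; simp
  tail_lt := h.head_lt
  head_lt := h.tail_lt
  kind_eq_zero := h.kind_eq_zero

/-- The final position of tentative potentials and ranks. -/
def StableEdge (G : Multigraph (Fin n) (Fin m)) (X Y : Orientation (Fin m)) (Z D : ℕ → ℕ)
    (e : Fin m) : Prop :=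
  Z (G.tail X e) = Z (G.head X e) + (if X e = Y e then 0 else 1) ∧ D (G.tail X e) < D (G.head X e)

/-- Bounds for the tentative potentials and ranks. -/
structure Tentative (z : Fin n → ℤ) (rank : Fin n → ℕ) (top : Fin n) (B : ℕ) (Z D : ℕ → ℕ) :
    Prop where
  potential_le : ∀ v < B, Z v ≤ if h : v < n then (n + z ⟨v, h⟩).toNat else 0
  rank_le : ∀ v < B, D v ≤ if h : v < n then rank ⟨v, h⟩ else 0
  le_potential_top : n ≤ Z top

/-- The sum of the tentative potentials and ranks. -/
def total (n : ℕ) (Z D : ℕ → ℕ) : ℕ := ∑ v ∈ Finset.range n, Z v + ∑ v ∈ Finset.range n, D v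

variable {z : Fin n → ℤ} {rank : Fin n → ℕ}

theorem total_relax_or {Z D : ℕ → ℕ} (e : Fin m) :
    relaxPotential Z (G.tail X e) (G.head X e) (if X e = Y e then 0 else 1) = Z ∧
        relaxRank D (G.tail X e) (G.head X e) = D ∧ StableEdge G X Y Z D e ∨
      ¬ StableEdge G X Y Z D e ∧ total n Z D <
        total n (relaxPotential Z (G.tail X e) (G.head X e) (if X e = Y e then 0 else 1))
          (relaxRank D (G.tail X e) (G.head X e)) := by
  by_cases h : StableEdge G X Y Z D e
  · left
    have h₁ (f : ℕ → ℕ) (a b : ℕ) (hab : b ≤ f a) : raise f a b = f := by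
      rw [raise, max_eq_left hab, update_eq_self]
    have e₁ : raise Z (G.tail X e) (Z (G.head X e) + if X e = Y e then 0 else 1) = Z :=
      h₁ _ _ _ h.1.ge
    refine ⟨?_, h₁ _ _ _ h.2, h⟩
    rw [relaxPotential, e₁]
    exact h₁ _ _ _ (by rw [h.1, Nat.add_sub_cancel])
  · right
    rcases relax_eq_or (Z := Z) (D := D) (w := if X e = Y e then 0 else 1) (G.tail X e).2
      (G.head X e).2 with h' | h'
    · exact absurd h'.2.2 h
    · exact ⟨h, h'⟩

/-- The shifted potential `n + z` and the ranking are admissible upper bounds; `-z v < n` ensures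
that `toNat` loses nothing. -/
theorem Tentative.relax {Z D : ℕ → ℕ} (hG : G.Connected) (hz : G.IsPotential X Y z)
    (htop : z top = 0) (hr : ∀ e, rank (G.tail X e) < rank (G.head X e)) (hB : n ≤ B)
    (h : Tentative z rank top B Z D) (e : Fin m) :
    Tentative z rank top B
      (relaxPotential Z (G.tail X e) (G.head X e) (if X e = Y e then 0 else 1))
      (relaxRank D (G.tail X e) (G.head X e)) where
  potential_le := by
    refine relaxPotential_le (ub := fun v => if h : v < n then (n + z ⟨v, h⟩).toNat else 0)
      h.potential_le ((G.tail X e).2.trans_le hB) ((G.head X e).2.trans_le hB) ?_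
    have h₁ := hz e
    have h₂ := hz.neg_lt_card hG htop (G.head X e)
    rw [Fintype.card_fin] at h₂
    simp only [Fin.is_lt, dite_true, Fin.eta]
    split_ifs at h₁ ⊢ <;> omega
  rank_le := by
    refine relaxRank_le (ub := fun v => if h : v < n then rank ⟨v, h⟩ else 0)
      h.rank_le ((G.tail X e).2.trans_le hB) ?_
    simpa using hr e
  le_potential_top := h.le_potential_top.trans ((le_raise _).trans (le_raise _))

/-- Potentials are below `2 * n` and ranks below `n`, so the total is at most `3 * n * n`, less than
`(2 * n) ^ 2`. -/
theorem Tentative.total_lt {Z D : ℕ → ℕ} (hG : G.Connected) (hz : G.IsPotential X Y z)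
    (htop : z top = 0) (hr : ∀ v, rank v < n) (hB : 2 * n ≤ B)
    (h : Tentative z rank top B Z D) : total n Z D < B * B := by
  have hn : 0 < n := top.pos
  have h₁ : total n Z D ≤ ∑ _v ∈ Finset.range n, 3 * n := by
    rw [total, ← Finset.sum_add_distrib]
    refine Finset.sum_le_sum fun v hv => ?_
    rw [Finset.mem_range] at hv
    have h₁ := h.potential_le v (by omega)
    have h₂ := h.rank_le v (by omega)
    rw [dif_pos hv] at h₁ h₂
    have h₃ := hz.isCount.lt_card hG htop ⟨v, hv⟩
    rw [Fintype.card_fin] at h₃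
    have h₄ := hr ⟨v, hv⟩
    omega
  rw [Finset.sum_const, Finset.card_range, smul_eq_mul] at h₁
  nlinarith [Nat.mul_le_mul hB hB, Nat.mul_pos hn hn]

/-- Stability makes `Z - z` constant, and at `top` the value `n` is both a lower and an upper bound.
-/
theorem Tentative.potential_eq {Z D : ℕ → ℕ} (hG : G.Connected) (hz : G.IsPotential X Y z)
    (htop : z top = 0) (hB : n ≤ B) (h : Tentative z rank top B Z D)
    (hs : ∀ e, StableEdge G X Y Z D e) (v : Fin n) : (Z v : ℤ) = n + z v := by
  have h₁ := hG.eq_of_forall_edge (z := fun v => (Z v : ℤ) - z v) (X := X) (fun e => by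
    have h₁ := (hs e).1
    have h₂ := hz e
    split_ifs at h₁ h₂ <;> omega) v top
  have h₂ := h.potential_le top (top.2.trans_le hB)
  have h₃ := h.le_potential_top
  simp [htop] at h₁ h₂
  omega

/-- The arrays `Z` and `D` contain the potentials, increased by the number of vertices, and an
admissible ranking of the vertices. -/
structure Solved (G : Multigraph (Fin n) (Fin m)) (X : Orientation (Fin m)) (z : Fin n → ℤ) (B : ℕ)
    (arr : Arr → ℕ → ℕ) : Prop where
  potential_eq : ∀ v : Fin n, (arr .Z v : ℤ) = n + z v
  potential_eq_zero : ∀ v < B, n ≤ v → arr .Z v = 0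
  rank_lt_rank : ∀ e, arr .D (G.tail X e) < arr .D (G.head X e)
  rank_lt : ∀ v : Fin n, arr .D v < n

/-- Consider all edges once. -/
def relaxEdges (A₁ A₂ : Arr) : Program := seqs [.clr .i, .rep (relaxEdge A₁ A₂)]

theorem run_relaxEdges (h₁Z : A₁ ≠ .Z) (h₁D : A₁ ≠ .D) (h₂Z : A₂ ≠ .Z) (h₂D : A₂ ≠ .D)
    (hG : G.Connected) (hz : G.IsPotential X Y z)
    (htop : z top = 0) (hr : ∀ e, rank (G.tail X e) < rank (G.head X e)) (hB : n ≤ B) (hm : m ≤ B)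
    (hs : Loaded G top X Y A₁ A₂ s) (ht : Tentative z rank top B (s.arr .Z) (s.arr .D)) :
    Keeps s ((relaxEdges A₁ A₂).run B s) ∧
      Tentative z rank top B (((relaxEdges A₁ A₂).run B s).arr .Z)
        (((relaxEdges A₁ A₂).run B s).arr .D) ∧
      ((∀ e, StableEdge G X Y (((relaxEdges A₁ A₂).run B s).arr .Z)
          (((relaxEdges A₁ A₂).run B s).arr .D) e) ∨
        (¬ ∀ e, StableEdge G X Y (s.arr .Z) (s.arr .D) e) ∧
          total n (s.arr .Z) (s.arr .D) < total n (((relaxEdges A₁ A₂).run B s).arr .Z)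
            (((relaxEdges A₁ A₂).run B s).arr .D)) := by
  obtain ⟨hk, hT, -, hP⟩ := iterate_induction (σ := Mem Reg Arr) (f := (relaxEdge A₁ A₂).run B)
    (s := (Prog.clr .i : Program).run B s) (k := B)
    -- Either nothing has changed so far and the edges already considered are stable, or some edge
    -- was unstable at the beginning and the total has increased.
    (fun j t => Keeps s t ∧ Tentative z rank top B (t.arr .Z) (t.arr .D) ∧ t.reg .i = j ∧
      ((t.arr .Z = s.arr .Z ∧ t.arr .D = s.arr .D ∧
          ∀ e : Fin m, (e : ℕ) < j → StableEdge G X Y (s.arr .Z) (s.arr .D) e) ∨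
        (¬ ∀ e, StableEdge G X Y (s.arr .Z) (s.arr .D) e) ∧
          total n (s.arr .Z) (s.arr .D) < total n (t.arr .Z) (t.arr .D)))
    ⟨⟨rfl, rfl, fun _ _ _ => rfl, rfl⟩, ht, rfl, Or.inl ⟨rfl, rfl, fun _ h => absurd h (by omega)⟩⟩
    (fun j hj t ⟨hk, hT, hi, hP⟩ => by
      have ht := hs.congr hk.n_eq hk.top_eq (hk.arr_eq _ h₁Z h₁D) (hk.arr_eq _ h₂Z h₂D)
        (hk.arr_eq _ (by decide) (by decide))
      have hw : t.arr .W j ≤ 2 := by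
        by_cases hjm : j < m
        · have := ht.kind_eq ⟨j, hjm⟩
          simp only at this
          split_ifs at this <;> omega
        · rw [ht.kind_eq_zero j (by omega)]
          omega
      obtain ⟨r', e, hr₁, hr₂, hr₃⟩ := run_relaxEdge (B := B) (s := t) A₁ A₂ (by omega)
        ((ht.tail_lt _).trans_le hB) ((ht.head_lt _).trans_le hB) (by rwa [hi])
      rw [hi] at e hr₁
      rw [e]
      refine ⟨hk.trans ⟨hr₂, hr₃, fun A hZ hD => ?_, rfl⟩, ?_⟩
      · simp only
        split_ifs
        · rfl
        · simp [hZ, hD]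
      · by_cases hjm : j < m
        · have h₁ := ht.tail_eq ⟨j, hjm⟩
          have h₂ := ht.head_eq ⟨j, hjm⟩
          have h₃ := ht.kind_eq ⟨j, hjm⟩
          have h₄ : t.arr .W j - 1 = if X ⟨j, hjm⟩ = Y ⟨j, hjm⟩ then 0 else 1 := by
            simp only at h₃
            rw [h₃]
            split_ifs <;> rfl
          have h₅ : t.arr .W j ≠ 0 := by
            simp only at h₃
            rw [h₃]
            split_ifs <;> omega
          simp only at h₁ h₂
          simp only [h₅, if_false, h₁, h₂, h₄, update_self, ne_eq, reduceCtorEq, not_false_eq_true,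
            update_of_ne]
          refine ⟨hT.relax hG hz htop hr hB _, hr₁, ?_⟩
          rcases total_relax_or (G := G) (X := X) (Y := Y) (Z := t.arr .Z) (D := t.arr .D)
            ⟨j, hjm⟩ with ⟨e₁, e₂, e₃⟩ | ⟨e₁, e₂⟩
          · rw [e₁, e₂]
            rcases hP with ⟨p₁, p₂, p₃⟩ | hP
            · refine Or.inl ⟨p₁, p₂, fun e he => ?_⟩
              rcases Nat.lt_succ_iff_lt_or_eq.1 he with he | he
              · exact p₃ e he
              · rw [p₁, p₂] at e₃
                rwa [show e = ⟨j, hjm⟩ from Fin.ext he]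
            · exact Or.inr hP
          · right
            rcases hP with ⟨p₁, p₂, p₃⟩ | ⟨p₁, p₂⟩
            · rw [p₁, p₂] at e₁ e₂ ⊢
              exact ⟨fun h => e₁ (h _), e₂⟩
            · exact ⟨p₁, p₂.trans e₂⟩
        · simp only [ht.kind_eq_zero j (by omega), if_true]
          refine ⟨hT, hr₁, hP.imp_left fun ⟨p₁, p₂, p₃⟩ => ⟨p₁, p₂, fun e _ => p₃ e (by omega)⟩⟩)
  refine ⟨hk, hT, hP.imp_left fun ⟨p₁, p₂, p₃⟩ e => ?_⟩
  change StableEdge G X Y (Mem.arr (((relaxEdge A₁ A₂).run B)^[B] _) .Z)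
    (Mem.arr (((relaxEdge A₁ A₂).run B)^[B] _) .D) e
  rw [p₁, p₂]
  exact p₃ e (by omega)

/-- Initialize the tentative potentials and ranks. -/
def initTables : Program :=
  seqs [.clr .i, .clr .a, .rep (seqs [.store .Z .i .a, .store .D .i .a, .inc .i]),
    .store .Z .top .n]

theorem run_initTables (hz : z top = 0) (hs : Loaded G top X Y A₁ A₂ s) :
    Keeps s (initTables.run B s) ∧ Tentative z rank top B ((initTables.run B s).arr .Z)
      ((initTables.run B s).arr .D) := by
  obtain ⟨hk, ha, hi, h⟩ := iterate_induction (σ := Mem Reg Arr)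
    (f := (seqs [.store .Z .i .a, .store .D .i .a, .inc .i]).run B)
    (s := (Prog.clr .a : Program).run B ((Prog.clr .i : Program).run B s)) (k := B)
    (fun j t => Keeps s t ∧ t.reg .a = 0 ∧ t.reg .i = j ∧
      ∀ v < j, t.arr .Z v = 0 ∧ t.arr .D v = 0)
    ⟨⟨rfl, rfl, fun _ _ _ => rfl, rfl⟩, rfl, rfl, fun _ h => absurd h (by omega)⟩
    (fun j hj t ⟨hk, ha, hi, h⟩ => by
      simp only [run_seqs_cons, run_seqs_nil, Prog.run]
      refine ⟨hk.trans ⟨by simp, by simp, fun A hZ hD => by simp [hZ, hD], rfl⟩, by simpa using ha,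
        by simp [hi], fun v hv => ?_⟩
      by_cases hvj : v = j
      · simp [hi, ha, hvj]
      · have := h v (by omega)
        simpa [hi, hvj] using this)
  have e : initTables.run B s = (Prog.store .Z .top .n : Program).run B
    (((seqs [.store .Z .i .a, .store .D .i .a, .inc .i]).run B)^[B]
      ((Prog.clr .a : Program).run B ((Prog.clr .i : Program).run B s))) := rfl
  rw [e]
  generalize ((seqs [.store .Z .i .a, .store .D .i .a, .inc .i]).run B)^[B]
    ((Prog.clr .a : Program).run B ((Prog.clr .i : Program).run B s)) = t at hk ha hi h
  have hn := hk.n_eq.trans hs.n_eq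
  have ht := hk.top_eq.trans hs.top_eq
  refine ⟨hk.trans ⟨rfl, rfl, fun A hZ _ => by simp [Prog.run, hZ], rfl⟩,
    fun v hv => ?_, fun v hv => ?_, ?_⟩
  · by_cases hvt : v = top
    · subst hvt
      simp [Prog.run, hn, ht, hz]
    · simp [Prog.run, ht, hvt, (h v hv).1]
  · simp [Prog.run, (h v hv).2]
  · simp [Prog.run, hn, ht]

/-- Compute the potentials and a ranking. -/
def solve (A₁ A₂ : Arr) : Program := seqs [initTables, .rep (.rep (relaxEdges A₁ A₂))]

theorem run_solve (h₁Z : A₁ ≠ .Z) (h₁D : A₁ ≠ .D) (h₂Z : A₂ ≠ .Z) (h₂D : A₂ ≠ .D)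
    (hG : G.Connected) (hz : G.IsPotential X Y z) (htop : z top = 0)
    (hr : ∀ e, rank (G.tail X e) < rank (G.head X e)) (hrn : ∀ v, rank v < n) (hB : 2 * n ≤ B)
    (hm : m ≤ B) (hs : Loaded G top X Y A₁ A₂ s) :
    Keeps s ((solve A₁ A₂).run B s) ∧ Solved G X z B ((solve A₁ A₂).run B s).arr := by
  obtain ⟨hk₀, hT₀⟩ := run_initTables (B := B) (rank := rank) htop hs
  obtain ⟨hk, hT, hP⟩ := iterate_induction (σ := Mem Reg Arr) (f := (relaxEdges A₁ A₂).run B)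
    (s := initTables.run B s) (k := B * B)
    (fun j t => Keeps s t ∧ Tentative z rank top B (t.arr .Z) (t.arr .D) ∧
      -- As long as stability is not reached, every pass adds at least one to the total, which stays
      -- below `B * B`.
      ((∀ e, StableEdge G X Y (t.arr .Z) (t.arr .D) e) ∨ j ≤ total n (t.arr .Z) (t.arr .D)))
    ⟨hk₀, hT₀, Or.inr (Nat.zero_le _)⟩
    (fun j _ t ⟨hk, hT, hP⟩ => by
      obtain ⟨hk', hT', hP'⟩ := run_relaxEdges h₁Z h₁D h₂Z h₂D hG hz htop hr (by omega) hm
        (hs.congr hk.n_eq hk.top_eq (hk.arr_eq _ h₁Z h₁D) (hk.arr_eq _ h₂Z h₂D)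
          (hk.arr_eq _ (by decide) (by decide))) hT
      refine ⟨hk.trans hk', hT', ?_⟩
      rcases hP' with hP' | ⟨hP₁, hP₂⟩
      · exact Or.inl hP'
      · rcases hP with hP | hP
        · exact absurd hP hP₁
        · exact Or.inr (by omega))
  have e : (solve A₁ A₂).run B s =
      ((relaxEdges A₁ A₂).run B)^[B * B] (initTables.run B s) := by
    rw [iterate_mul]
    rfl
  rw [e]
  generalize ((relaxEdges A₁ A₂).run B)^[B * B] (initTables.run B s) = t at hk hT hP
  have hst := hP.resolve_right (hT.total_lt hG hz htop hrn hB).not_ge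
  refine ⟨hk, hT.potential_eq hG hz htop (by omega) hst, fun v hv hvn => ?_, fun e => (hst e).2,
    fun v => ?_⟩
  · have := hT.potential_le v hv
    rw [dif_neg (by omega)] at this
    omega
  · have := hT.rank_le v (by have := v.2; omega)
    rw [dif_pos v.2] at this
    exact this.trans_lt (hrn v)

/-- The word describes a list of vertices that are flipped in turn. -/
def Emitted (G : Multigraph (Fin n) (Fin m)) (top : Fin n) (X : Orientation (Fin m))
    (c : Fin n → ℤ) (w : List Sym) : Prop :=
  ∃ l : List (Fin n), w = encodeNumbers (l.map Fin.val) ∧ G.Reaches top X c l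

theorem Emitted.not {c : Fin n → ℤ} {w : List Sym} (h : Emitted G top X c w) :
    Emitted G top (fun e => !X e) (fun v => -c v) w :=
  let ⟨l, h₁, h₂⟩ := h
  ⟨l, h₁, h₂.not⟩

/-- The situation after `j` complete rounds and a part of the next one, in which the vertices of
rank less than `r`, and those of rank `r` with number less than `k`, have had their turn. -/
structure Emitting (G : Multigraph (Fin n) (Fin m)) (top : Fin n) (X : Orientation (Fin m))
    (a z : Fin n → ℤ) (s : Mem Reg Arr) (j r k : ℕ) (t : Mem Reg Arr) : Prop where
  n_eq : t.reg .n = s.reg .n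
  top_eq : t.reg .top = s.reg .top
  arr_eq : t.arr = s.arr
  round_eq : t.reg .q = n + j
  emitted : Emitted G top X (partialCount a z (fun v => s.arr .D v) j r k) t.out

variable {a : Fin n → ℤ}

theorem Emitting.run_emitVertex (hz : G.IsCount X z) (ha : ∀ v, 0 ≤ z v → a v = 0)
    (htop : z top = 0) (hs : Solved G X z B s.arr) {j r k : ℕ} (hk : k < B)
    (h : Emitting G top X a z s j r k t) (hr : t.reg .r = r) (hv : t.reg .v = k) :
    Emitting G top X a z s j r (k + 1) (emitVertex.run B t) ∧ (emitVertex.run B t).reg .r = r ∧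
      (emitVertex.run B t).reg .v = k + 1 := by
  obtain ⟨r', e, h₁, h₂, h₃, h₄, h₅⟩ := VertexFlip.run_emitVertex (B := B) (s := t) (by omega)
  rw [e]
  rw [hv] at h₁
  refine ⟨⟨h₂.trans h.n_eq, h₃.trans h.top_eq, h.arr_eq, h₄.trans h.round_eq, ?_⟩,
    h₅.trans hr, h₁⟩
  simp only [h.arr_eq, hr, hv, h.round_eq]
  obtain ⟨l, hl₁, hl₂⟩ := h.emitted
  by_cases hkn : k < n
  · have hp := hs.potential_eq ⟨k, hkn⟩
    simp only at hp
    split_ifs with hc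
    · refine ⟨l ++ [⟨k, hkn⟩], ?_, ?_⟩
      · rw [hl₁]; simp [encodeNumbers]
      · exact hl₂.step (v := ⟨k, hkn⟩) hz ha htop hs.rank_lt_rank hc.1 (by omega)
    · rw [partialCount_succ_of_not _ _ _ _ _ _ fun _ h => hc ⟨h.1, by omega⟩]
      exact ⟨l, by simp [hl₁], hl₂⟩
  -- Numbers from `n` on are not vertices: their entry in `Z` is `0`, while `q` is at least `n`, so
  -- nothing is written.
  · have hp := hs.potential_eq_zero k hk (by omega)
    rw [if_neg (by omega), partialCount_succ_of_not _ _ _ _ _ _ fun h => absurd h hkn]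
    exact ⟨l, by simp [hl₁], hl₂⟩

/-- Write the numbers of the vertices of rank `r` that are to be flipped in the current round. -/
def emitRank : Program := seqs [.clr .v, .rep emitVertex, .inc .r]

theorem Emitting.run_emitRank (hz : G.IsCount X z) (ha : ∀ v, 0 ≤ z v → a v = 0)
    (htop : z top = 0) (hs : Solved G X z B s.arr) (hB : n ≤ B) {j r : ℕ}
    (h : Emitting G top X a z s j r 0 t) (hr : t.reg .r = r) :
    Emitting G top X a z s j (r + 1) 0 (emitRank.run B t) ∧ (emitRank.run B t).reg .r = r + 1 := by
  obtain ⟨h₁, h₂, -⟩ := iterate_induction (σ := Mem Reg Arr) (f := emitVertex.run B)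
    (s := (Prog.clr .v : Program).run B t) (k := B)
    (fun k u => Emitting G top X a z s j r k u ∧ u.reg .r = r ∧ u.reg .v = k)
    ⟨⟨h.n_eq, h.top_eq, h.arr_eq, h.round_eq, h.emitted⟩, hr, rfl⟩
    (fun k hk u ⟨h₁, h₂, h₃⟩ => h₁.run_emitVertex hz ha htop hs hk h₂ h₃)
  refine ⟨⟨h₁.n_eq, h₁.top_eq, h₁.arr_eq, h₁.round_eq, ?_⟩, congrArg (· + 1) h₂⟩
  rw [← partialCount_vertices _ _ _ _ _ _ hB]
  exact h₁.emitted

/-- Write the numbers of all vertices that are to be flipped in the current round. -/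
def emitRound : Program := seqs [.clr .r, .rep emitRank, .inc .q]

theorem Emitting.run_emitRound (hz : G.IsCount X z) (ha : ∀ v, 0 ≤ z v → a v = 0)
    (htop : z top = 0) (hs : Solved G X z B s.arr) (hB : n ≤ B) {j : ℕ}
    (h : Emitting G top X a z s j 0 0 t) :
    Emitting G top X a z s (j + 1) 0 0 (emitRound.run B t) := by
  obtain ⟨h₁, -⟩ := iterate_induction (σ := Mem Reg Arr) (f := emitRank.run B)
    (s := (Prog.clr .r : Program).run B t) (k := B)
    (fun r u => Emitting G top X a z s j r 0 u ∧ u.reg .r = r)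
    ⟨⟨h.n_eq, h.top_eq, h.arr_eq, h.round_eq, h.emitted⟩, rfl⟩
    (fun r _ u ⟨h₁, h₂⟩ => h₁.run_emitRank hz ha htop hs hB h₂)
  refine ⟨h₁.n_eq, h₁.top_eq, h₁.arr_eq, congrArg (· + 1) h₁.round_eq, ?_⟩
  rw [← partialCount_ranks _ _ _ _ _ fun v => (hs.rank_lt v).trans_le hB]
  exact h₁.emitted

/-- Write the numbers of all vertices that are to be flipped in one of the two directions. -/
def phase (A₁ A₂ : Arr) : Program := seqs [solve A₁ A₂, .cpy .q .n, .rep emitRound]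

/-- The round counter `q` starts at `n` to match the shift of the potentials. All `z v` are below
`n`, so `B` rounds suffice; `a` records the flips of an earlier phase. -/
theorem run_phase (h₁Z : A₁ ≠ .Z) (h₁D : A₁ ≠ .D) (h₂Z : A₂ ≠ .Z) (h₂D : A₂ ≠ .D)
    (hG : G.Connected) (hz : G.IsPotential X Y z) (htop : z top = 0)
    (hr : ∀ e, rank (G.tail X e) < rank (G.head X e)) (hrn : ∀ v, rank v < n)
    (hB : 2 * n ≤ B) (hm : m ≤ B) (ha : ∀ v, 0 ≤ z v → a v = 0) (hs : Loaded G top X Y A₁ A₂ s)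
    (h : Emitted G top X a s.out) :
    Loaded G top X Y A₁ A₂ ((phase A₁ A₂).run B s) ∧
      Emitted G top X (fun v => a v + max (z v) 0) ((phase A₁ A₂).run B s).out := by
  obtain ⟨hk, hS⟩ := run_solve h₁Z h₁D h₂Z h₂D hG hz htop hr hrn hB hm hs
  have hL := hs.congr hk.n_eq hk.top_eq (hk.arr_eq _ h₁Z h₁D) (hk.arr_eq _ h₂Z h₂D)
    (hk.arr_eq _ (by decide) (by decide))
  have e : (phase A₁ A₂).run B s = (emitRound.run B)^[B]
    ((Prog.cpy .q .n : Program).run B ((solve A₁ A₂).run B s)) := rfl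
  rw [e]
  generalize (solve A₁ A₂).run B s = t at hk hS hL
  have hE := iterate_induction (σ := Mem Reg Arr) (f := emitRound.run B)
    (s := (Prog.cpy .q .n : Program).run B t) (k := B)
    (fun j u => Emitting G top X a z t j 0 0 u)
    ⟨rfl, rfl, rfl, hL.n_eq, by rw [partialCount_zero, ← hk.out_eq] at *; exact h⟩
    (fun j _ u h => h.run_emitRound hz.isCount ha htop hS (by omega))
  have hE₂ := hE.emitted
  rw [partialCount_rounds _ _ _ _ fun v => by
    have := hz.isCount.lt_card hG htop v
    rw [Fintype.card_fin] at this
    omega] at hE₂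
  exact ⟨hL.congr hE.n_eq hE.top_eq (by rw [hE.arr_eq]) (by rw [hE.arr_eq]) (by rw [hE.arr_eq]),
    hE₂⟩

end VertexFlip

/-! ### Reading the input, and the whole algorithm -/

namespace VertexFlip

open StackProgram StackProgram.Prog Multigraph Function

variable {B n m : ℕ} {s t : Mem Reg Arr} {G : Multigraph (Fin n) (Fin m)} {top : Fin n}
  {X Y : Orientation (Fin m)}

/-- The word describing an edge together with its two orientations. -/
def encodeEdge (G : Multigraph (Fin n) (Fin m)) (X Y : Orientation (Fin m)) (e : Fin m) :
    List Sym :=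
  encodeNumber (G.fst e) ++ encodeNumber (G.snd e) ++ [some (X e), some (Y e)]

/-- The situation after `k` edges have been read. -/
structure Reading (G : Multigraph (Fin n) (Fin m)) (top : Fin n) (X Y : Orientation (Fin m))
    (B k : ℕ) (s : Mem Reg Arr) : Prop where
  n_eq : s.reg .n = n
  top_eq : s.reg .top = top
  out_eq : s.out = []
  inp_eq : s.inp = ((List.finRange m).drop k).flatMap (encodeEdge G X Y)
  length_le : s.inp.length ≤ B
  index_eq : s.reg .i = min k m
  tail_eq : ∀ e : Fin m, (e : ℕ) < k → s.arr .T e = G.tail X e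
  head_eq : ∀ e : Fin m, (e : ℕ) < k → s.arr .H e = G.head X e
  kind_eq : ∀ e : Fin m, (e : ℕ) < k → s.arr .W e = if X e = Y e then 1 else 2
  tail_lt : ∀ i, s.arr .T i < n
  head_lt : ∀ i, s.arr .H i < n
  kind_eq_zero : ∀ i, min k m ≤ i → s.arr .W i = 0

theorem Reading.loaded {k : ℕ} (h : Reading G top X Y B k s) (hk : m ≤ k) :
    Loaded G top X Y .T .H s where
  n_eq := h.n_eq
  top_eq := h.top_eq
  tail_eq e := h.tail_eq e (e.2.trans_le hk)
  head_eq e := h.head_eq e (e.2.trans_le hk)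
  kind_eq e := h.kind_eq e (e.2.trans_le hk)
  tail_lt := h.tail_lt
  head_lt := h.head_lt
  kind_eq_zero i hi := h.kind_eq_zero i (by omega)

theorem Reading.run_readEdge {k : ℕ} (hB : n ≤ B) (h : Reading G top X Y B k s) :
    Reading G top X Y B (k + 1) (readEdge.run B s) := by
  by_cases hk : k < m
  · have hi := h.inp_eq
    rw [List.drop_eq_getElem_cons (by simpa using hk), List.flatMap_cons, List.getElem_finRange,
      encodeEdge] at hi
    simp only [Fin.cast_mk, List.append_assoc, List.cons_append, List.nil_append] at hi
    have hl := h.length_le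
    have hik := h.index_eq
    rw [min_eq_left hk.le] at hik
    obtain ⟨r', e, h₁, h₂, h₃⟩ := VertexFlip.run_readEdge hi hl ((Fin.is_lt _).le.trans hB)
      ((Fin.is_lt _).le.trans hB)
    rw [e]
    have hs : (bif X ⟨k, hk⟩ then (G.fst ⟨k, hk⟩ : ℕ) else G.snd ⟨k, hk⟩) = G.tail X ⟨k, hk⟩ := by
      cases hX : X ⟨k, hk⟩ <;> simp [tail, start, hX]
    have hf : (bif X ⟨k, hk⟩ then (G.snd ⟨k, hk⟩ : ℕ) else G.fst ⟨k, hk⟩) = G.head X ⟨k, hk⟩ := by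
      cases hX : X ⟨k, hk⟩ <;> simp [head, finish, hX]
    rw [hs, hf, hik]
    have hne (i : Fin m) (hi : (i : ℕ) < k + 1) : i = ⟨k, hk⟩ ∨ (i : ℕ) ≠ k ∧ (i : ℕ) < k := by
      rcases Nat.lt_succ_iff_lt_or_eq.1 hi with hi | hi
      · exact Or.inr ⟨hi.ne, hi⟩
      · exact Or.inl (Fin.ext hi)
    refine ⟨h₂.trans h.n_eq, h₃.trans h.top_eq, h.out_eq, rfl, ?_, ?_, ?_, ?_, ?_, ?_, ?_, ?_⟩
    · rw [hi] at hl
      simp only [List.length_append, List.length_cons] at hl ⊢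
      omega
    · simp only [h₁, hik]
      omega
    · intro i hi
      rcases hne i hi with rfl | ⟨h₁, h₂⟩
      · simp [putArr]
      · simp [putArr, h₁, h.tail_eq i h₂]
    · intro i hi
      rcases hne i hi with rfl | ⟨h₁, h₂⟩
      · simp [putArr]
      · simp [putArr, h₁, h.head_eq i h₂]
    · intro i hi
      rcases hne i hi with rfl | ⟨h₁, h₂⟩
      · simp [putArr]
      · simp [putArr, h₁, h.kind_eq i h₂]
    · intro i
      by_cases hik : i = k
      · simp [putArr, hik]
      · simp [putArr, hik, h.tail_lt i]
    · intro i
      by_cases hik : i = k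
      · simp [putArr, hik]
      · simp [putArr, hik, h.head_lt i]
    · intro i hi
      have hik : i ≠ k := by omega
      simp [putArr, hik, h.kind_eq_zero i (by omega)]
  -- All edges have been read; the surplus iterations change nothing that matters.
  · have hi : s.inp = [] := by
      rw [h.inp_eq, List.drop_eq_nil_of_le (by simpa using not_lt.1 hk), List.flatMap_nil]
    obtain ⟨r', e, h₁, h₂, h₃⟩ := run_readEdge_nil (B := B) hi
    rw [e]
    refine ⟨h₂.trans h.n_eq, h₃.trans h.top_eq, h.out_eq, ?_, h.length_le, ?_,
      fun e _ => h.tail_eq e (by omega), fun e _ => h.head_eq e (by omega),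
      fun e _ => h.kind_eq e (by omega), h.tail_lt, h.head_lt,
      fun i hi => h.kind_eq_zero i (by omega)⟩
    · rw [List.drop_eq_nil_of_le (by simp; omega), List.flatMap_nil]
      exact hi
    · simp only [h₁, h.index_eq]
      omega

/-- Read the input. -/
def readInput : Program := seqs [readNumber .n, readNumber .top, .clr .i, .rep readEdge]

theorem length_flatMap_encodeEdge (l : List (Fin m)) :
    4 * l.length ≤ (l.flatMap (encodeEdge G X Y)).length := by
  induction l with
  | nil => simp
  | cons e l ih =>
    have h₁ := length_encodeNumber_pos (G.fst e)
    have h₂ := length_encodeNumber_pos (G.snd e)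
    simp only [List.flatMap_cons, List.length_append, encodeEdge, List.length_cons,
      List.length_nil] at *
    omega

/-- An edge takes at least two end markers and two bits, and the two leading numbers one marker
each. With `n ≤ 2 * m + 1` this gives precisely the bound `2 * n ≤ B` required by `run_solve`. -/
theorem length_encode_ge (I : Input) : 4 * I.m + 2 ≤ I.encode.length := by
  have h₁ := length_encodeNumber_pos I.n
  have h₂ := length_encodeNumber_pos I.top
  have h₃ := length_flatMap_encodeEdge (G := I.G) (X := I.X) (Y := I.Y) (List.finRange I.m)
  rw [List.length_finRange] at h₃
  rw [Input.encode, List.length_append, List.length_append]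
  change _ ≤ _ + ((List.finRange I.m).flatMap (encodeEdge I.G I.X I.Y)).length
  omega

theorem run_readInput (I : Input) (hn : I.n ≤ I.encode.length) :
    Loaded I.G I.top I.X I.Y .T .H
        (readInput.run I.encode.length (initialMem I.encode)) ∧
      (readInput.run I.encode.length (initialMem I.encode)).out = [] := by
  have hB := length_encode_ge I
  have hi : (initialMem I.encode : Mem Reg Arr).inp = encodeNumber I.n ++ (encodeNumber I.top ++
      (List.finRange I.m).flatMap (encodeEdge I.G I.X I.Y)) := by
    rw [← List.append_assoc]
    rfl
  have hl : (initialMem I.encode : Mem Reg Arr).inp.length ≤ I.encode.length := le_rfl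
  generalize I.encode.length = B at hn hB hl
  obtain ⟨r₁, e₁, h₁, -⟩ := run_readNumber (d := .n) (by decide) (by decide) (by decide) I.n hi hn
    hl
  rw [hi, List.length_append, List.length_append] at hl
  obtain ⟨r₂, e₂, h₂, h₂'⟩ := run_readNumber (B := B) (d := .top) (by decide) (by decide)
    (by decide) I.top
    (s := { (initialMem I.encode : Mem Reg Arr) with
      inp := encodeNumber I.top ++ (List.finRange I.m).flatMap (encodeEdge I.G I.X I.Y)
      reg := r₁ }) rfl (I.top.2.le.trans hn) (by rw [List.length_append]; omega)
  have e : readInput.run B (initialMem I.encode) = (readEdge.run B)^[B]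
    ((Prog.clr .i : Program).run B ((readNumber .top).run B ((readNumber .n).run B
      (initialMem I.encode)))) := rfl
  rw [e, e₁, e₂]
  have h := iterate_induction (σ := Mem Reg Arr) (f := readEdge.run B) (k := B)
    (s := (Prog.clr .i : Program).run B
      { (initialMem I.encode : Mem Reg Arr) with
        inp := (List.finRange I.m).flatMap (encodeEdge I.G I.X I.Y)
        reg := r₂ })
    (fun k t => Reading I.G I.top I.X I.Y B k t)
    { n_eq := (h₂' .n (by decide) (by decide) (by decide) (by decide)).trans h₁
      top_eq := h₂
      out_eq := rfl
      inp_eq := rfl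
      length_le := by simp only [Prog.run]; omega
      index_eq := by simp [Prog.run]
      tail_eq := fun _ h => absurd h (by omega)
      head_eq := fun _ h => absurd h (by omega)
      kind_eq := fun _ h => absurd h (by omega)
      tail_lt := fun _ => I.top.pos
      head_lt := fun _ => I.top.pos
      kind_eq_zero := fun _ _ => rfl }
    (fun k _ t h => h.run_readEdge hn)
  exact ⟨h.loaded (by omega), h.out_eq⟩

/-- The algorithm. -/
def shortestFlipSeq : Program := seqs [readInput, phase .T .H, phase .H .T]

theorem exists_run_shortestFlipSeq (I : Input) (hI : I.Admissible) :
    ∃ l, I.G.IsShortestFlipSeq I.top I.X I.Y l ∧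
      (shortestFlipSeq.run I.encode.length (initialMem I.encode)).out =
        encodeNumbers (l.map Fin.val) := by
  have hG := hI.connected
  obtain ⟨c, hX, hY⟩ := hI.cOrientations
  obtain ⟨z, hz, htop⟩ := exists_isPotential hG (fun C => (hX C).trans (hY C).symm) I.top
  obtain ⟨rank, hr, hrn⟩ := hI.acyclic_X.exists_rank
  have hB := length_encode_ge I
  have hn := hG.card_le
  simp only [Fintype.card_fin] at hn hrn
  obtain ⟨h₁, h₁'⟩ := run_readInput I (by omega)
  have e : shortestFlipSeq.run I.encode.length (initialMem I.encode) =
    (phase .H .T).run I.encode.length ((phase .T .H).run I.encode.length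
      (readInput.run I.encode.length (initialMem I.encode))) := rfl
  rw [e]
  obtain ⟨h₂, h₂'⟩ := run_phase (B := I.encode.length) (A₁ := .T) (A₂ := .H)
    (a := fun _ => 0) (by decide) (by decide) (by decide) (by decide)
    hG hz htop hr hrn (by omega) (by omega) (fun _ _ => rfl) h₁ ⟨[], h₁', Reaches.nil _⟩
  -- The second phase works with all edges reversed, so the potential is `-z`, the ranking is
  -- inverted, and the flips made so far count as `-max (z v) 0`, which vanishes where `-z v` is
  -- nonnegative.
  obtain ⟨-, h₃⟩ := run_phase (B := I.encode.length) (A₁ := .H) (A₂ := .T)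
    (rank := fun v => I.n - 1 - rank v)
    (by decide) (by decide) (by decide) (by decide)
    hG hz.not (by simp [htop]) (fun e => by
      rw [(tail_not (X := I.X) (Y := fun e => !I.X e) e rfl).1, (tail_not (X := I.X) (Y := fun e => !I.X e) e rfl).2]
      have h₁ := hr e
      have h₂ := hrn (I.G.head I.X e)
      omega) (fun v => by have := hrn v; omega) (by omega) (by omega)
    (fun v hv => by omega) h₂.not h₂'.not
  obtain ⟨l, h₄, h₅⟩ := h₃.not
  refine ⟨l, Reaches.isShortestFlipSeq hG hz htop ?_, h₄⟩
  -- Reversing once more restores `X`, and the positive and negative parts combine to `z`.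
  convert h₅ using 1
  · funext e; simp
  · funext v; omega

end VertexFlip

theorem mainTheorem2 :
    ∃ shortest : (I : {I : VertexFlip.Input // I.Admissible}) → List (Fin I.1.n),
      Nonempty (Turing.TM2ComputableInPolyTime
        (fun I : {I : VertexFlip.Input // I.Admissible} => I.1.encode)
        VertexFlip.encodeNumbers
        (fun I => (shortest I).map Fin.val)) ∧
      ∀ I : {I : VertexFlip.Input // I.Admissible},
        I.1.G.IsShortestFlipSeq I.1.top I.1.X I.1.Y (shortest I) := by
  -- `shortest` is chosen as the list that the program writes, so its computability amounts to `h₂`.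
  choose shortest h₁ h₂ using fun I : {I : VertexFlip.Input // I.Admissible} =>
    VertexFlip.exists_run_shortestFlipSeq I.1 I.2
  exact ⟨shortest, StackProgram.Prog.computable VertexFlip.shortestFlipSeq h₂, h₁⟩
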